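/- **Setting.** Let $G=(V,E)$ be a connected undirected graph with $n$ nodes and integer edge lengths $0\le \ell(e)\le n^{c}$, with an arbitrary fixed orientation of its edges and distinct node identifiers smaller than $n^{c}$, where $c$ is a constant. Let $\tau=\log_2^7 n$, $\beta=8\tau$, $D_i=\beta^i$; the distance scales are the $D_i$ with $i\ge 1$ and $D_i\le n^2\max_e \ell(e)$. A *potential for scale $D_i$ with respect to $S\subseteq V$* is a function $\phi:V\to\mathbb R_{\ge 0}$ with $|\phi(u)-\phi(v)|\le\ell(u,v)$ for every edge $uv$, $\phi=0$ on $S$, and $\phi(v)\ge \frac12 D_i/\tau$ whenever $\operatorname{dist}_G(v,S)\ge D_i/\tau$. A *distance structure for scale $D_i$* consists of at most $c(\lfloor\log_2 n\rfloor+1)$ clusterings (each a family of pairwise disjoint clusters $C\subseteq V$) such that for every node $v$ the ball $\{u:\operatorname{dist}_G(u,v)\le D_i/\tau\}$ lies in some cluster of one of the clusterings; each cluster $C$ comes with a center $v_C\in C$, a spanning tree $T_C$ of $C$ in $G$ rooted at $v_C$ of (weighted) diameter at most $D_i$, and a potential for scale $D_i$ with respect to $V\setminus C$. It is *given* if each node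 knows, for each scale and each clustering in which it is clustered, the identifiers of its cluster center and of its parent in $T_C$ and its own potential value. A *flow* is $f\in\mathbb R^E$, with cost $\sum_e \ell(e)|f(e)|$; it routes $b\in\mathbb R^V$ if the net inflow at every node $v$ is $b(v)$. A matrix $R\in\mathbb R^{E\times V}$ is an *$\alpha$-competitive $\ell_1$-oblivious routing* for $G$ if for every $b$ with $\sum_v b(v)=0$ the flow $Rb$ routes $b$ and costs at most $\alpha$ times any flow routing $b$. In the *Minor-Aggregation model*, nodes and edges are computational units with private states; nodes initially know $n$ and their identifier, edges know the identifiers of their endpoints and their length. In each round (1) each edge decides whether it is contracted, defining supernodes; (2) each node picks a message, and all nodes of a supernode learn the aggregate of its messages under a predetermined commutative, associative operator; (3) each edge between different supernodes learns both aggregates and picks one message for each of the two supernodes, and all nodes of a supernode learn the aggregate of the messages it receives, again under a predetermined operator. Below, $\tilde O(1)$ means at most $K(\lfloor\log_2 n\rfloor+1)^{K}$ with a constant $K$ depending only on $c$. **Theorem (Distance structures give $\ell_1$-oblivious routing).** For every constant $c$ there are deterministic Minor-Aggregation algorithms $\mathcal A,\mathcal A'$ such that for every $G$ as above and every choice of a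 distance structure for each distance scale $D_i$, given to the nodes, there is an $\tilde O(1)$-competitive $\ell_1$-oblivious routing $R$ for $G$ such that $R$ and $R^{T}$ are evaluated in $\tilde O(1)$ Minor-Aggregation rounds: for every $w$, * for every $b\in\mathbb Z^V$ with $|b(v)|<2^w$ for all $v$, where each node $v$ is given $b(v)$, after the run of $\mathcal A$ each edge $e$ outputs $(Rb)(e)$; * for every $f\in\mathbb Z^E$ with $|f(e)|<2^w$ for all $e$, where each edge $e$ is given $f(e)$, after the run of $\mathcal A'$ each node $v$ outputs $(R^{T}f)(v)$. Both algorithms know $n$ and $w$ and use $\tilde O(1)$ rounds (a bound independent of $w$) and messages of $(w+1)\cdot\tilde O(1)$ bits, that is, $\tilde O(1)$-bit messages for $\tilde O(1)$-bit inputs. -/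

import Mathlib

open scoped ENNReal

noncomputable section

/-! ## Weighted graphs, distances, distance scales -/

/-- A connected undirected graph with nonnegative integer edge lengths, an arbitrary fixed orientation
`src e → tgt e` of every edge (used only to give a sign to flows) and distinct node identifiers.
Only the values of `len` on edges of `graph` are ever used. -/
structure Network (V : Type) where
  graph : SimpleGraph V
  connected : graph.Connected
  len : Sym2 V → ℕ
  src : graph.edgeSet → V
  tgt : graph.edgeSet → V
  ends : ∀ e : graph.edgeSet, (e : Sym2 V) = s(src e, tgt e)
  id : V → ℕ
  id_injective : Function.Injective id

/-- Total length of a walk. -/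
def walkLen {V : Type} {H : SimpleGraph V} (len : Sym2 V → ℕ) {u v : V} (p : H.Walk u v) : ℕ :=
  (p.edges.map len).sum

/-- Weighted distance in a graph `H` (it is `∞` if there is no walk). -/
def wdist {V : Type} (H : SimpleGraph V) (len : Sym2 V → ℕ) (u v : V) : ℝ≥0∞ :=
  ⨅ p : H.Walk u v, (walkLen len p : ℝ≥0∞)

/-- Weighted distance from a node to a set (it is `∞` if the set is empty). -/
def setDist {V : Type} (H : SimpleGraph V) (len : Sym2 V → ℕ) (v : V) (S : Set V) : ℝ≥0∞ :=
  ⨅ u ∈ S, wdist H len v u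

/-- `τ = (log n)^7`. -/
def tau (n : ℕ) : ℝ := (Real.logb 2 n) ^ 7

/-- `D_i = β^i`, where `β = 8 τ`. -/
def scaleD (n i : ℕ) : ℝ := (8 * tau n) ^ i

/-- `D_i` is a distance scale: `i ≥ 1` and `D_i ≤ n² · max_e ℓ(e)`. -/
def Network.IsScale {V : Type} [Fintype V] (N : Network V) (i : ℕ) : Prop :=
  1 ≤ i ∧ ∃ e ∈ N.graph.edgeSet,
    scaleD (Fintype.card V) i ≤ (Fintype.card V : ℝ) ^ 2 * (N.len e : ℝ)

/-! ## Distance structures -/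

/-- `φ` is a potential with respect to `S` at resolution `r` (`r = D_i / τ` for scale `D_i`): it is
nonnegative, changes by at most `ℓ(u,v)` along every edge `uv`, vanishes on `S`, and is at least
`r / 2` at all nodes at distance at least `r` from `S`. -/
structure Network.IsPotential {V : Type} (N : Network V) (r : ℝ) (S : Set V) (φ : V → ℝ) :
    Prop where
  nonneg : ∀ v, 0 ≤ φ v
  lipschitz : ∀ u v, N.graph.Adj u v → |φ u - φ v| ≤ (N.len s(u, v) : ℝ)
  zero : ∀ v ∈ S, φ v = 0
  large : ∀ v, ENNReal.ofReal r ≤ setDist N.graph N.len v S → (1 / 2) * r ≤ φ v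

/-- The graph whose edges are the pairs `{v, parent v}` for `v ∈ verts`, `v ≠ root`. -/
def parentGraph {V : Type} (verts : Set V) (root : V) (parent : V → V) : SimpleGraph V :=
  SimpleGraph.fromRel fun v u => v ∈ verts ∧ v ≠ root ∧ u = parent v

/-- A cluster with a spanning tree of diameter at most `D`, rooted at the cluster center and given by
parent pointers, and with a potential with respect to the complement of the cluster. -/
structure Cluster {V : Type} (N : Network V) (D r : ℝ) where
  verts : Set V
  center : V
  center_mem : center ∈ verts
  parent : V → V
  parent_center : parent center = center
  parent_mem : ∀ v ∈ verts, parent v ∈ verts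
  parent_adj : ∀ v ∈ verts, v ≠ center → N.graph.Adj v (parent v)
  parent_reach : ∀ v ∈ verts, ∃ k : ℕ, parent^[k] v = center
  tree_diam : ∀ u ∈ verts, ∀ v ∈ verts,
    wdist (parentGraph verts center parent) N.len u v ≤ ENNReal.ofReal D
  potential : V → ℝ
  isPotential : N.IsPotential r vertsᶜ potential

/-- A distance structure with cluster diameter `D` and covering radius `r`: `numClusterings` many
clusterings (families of pairwise disjoint clusters) such that every ball of radius `r` is
contained in some cluster of one of them. -/
structure DistanceStructure {V : Type} (N : Network V) (D r : ℝ) where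
  numClusterings : ℕ
  clustering : Fin numClusterings → Set (Cluster N D r)
  disjoint : ∀ t, (clustering t).PairwiseDisjoint Cluster.verts
  cover : ∀ v, ∃ t, ∃ K ∈ clustering t,
    {u | wdist N.graph N.len v u ≤ ENNReal.ofReal r} ⊆ K.verts

/-- A distance structure for every distance scale `D_i`. -/
def DistanceStructures {V : Type} [Fintype V] (N : Network V) : Type :=
  ∀ i, N.IsScale i → DistanceStructure N (scaleD (Fintype.card V) i)
    (scaleD (Fintype.card V) i / tau (Fintype.card V))

/-! ## `ℓ₁`-oblivious routing -/

section Flow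
variable {V : Type} (N : Network V) [Fintype N.graph.edgeSet]

open scoped Classical in
/-- The flow `f` routes the demand `b`: the net inflow at every node `v` is `b v`. -/
def Network.Routes (f : N.graph.edgeSet → ℝ) (b : V → ℝ) : Prop :=
  ∀ v, (∑ e, if N.tgt e = v then f e else 0) - (∑ e, if N.src e = v then f e else 0) = b v

/-- The transshipment cost of a flow. -/
def Network.cost (f : N.graph.edgeSet → ℝ) : ℝ :=
  ∑ e : N.graph.edgeSet, (N.len e : ℝ) * |f e|

/-- `R` is an `α`-competitive `ℓ₁`-oblivious routing: for every demand `b` (with sum zero) `R b`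
routes `b` at a cost of at most `α` times the cost of any flow routing `b`. -/
def Network.IsObliviousRouting [Fintype V] (α : ℝ) (R : Matrix N.graph.edgeSet V ℝ) : Prop :=
  ∀ b : V → ℝ, ∑ v, b v = 0 →
    N.Routes (R.mulVec b) b ∧
      ∀ f : N.graph.edgeSet → ℝ, N.Routes f b → N.cost (R.mulVec b) ≤ α * N.cost f

end Flow

/-! ## The Minor-Aggregation model -/

/-- A message of `bits` bits, as a number. (A type of its own, so that the only multiplication on it
is the aggregation operator chosen by the algorithm.) -/
def Message (bits : ℕ) : Type := Fin (2 ^ bits)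

/-- A deterministic Minor-Aggregation algorithm. Nodes and edges are computational units with
private states; messages have `bits` bits. Each round `t` consists of
* contraction: every edge decides whether it is contracted;
* consensus: every node chooses a message, and each supernode (connected component of contracted
  edges) computes the aggregate of the messages of its nodes with respect to `consensusOp t`,
  which its nodes learn;
* aggregation: every edge joining two different supernodes learns the consensus values of
  both and chooses one message for each of them; each supernode aggregates the messages addressed to
  it with respect to `aggregationOp t`, and its nodes learn the result.
The algorithm stops after `rounds` rounds, and each unit then outputs a function of its state. -/
structure MinorAggAlgorithm (NodeIn EdgeIn NodeOut EdgeOut : Type) where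
  bits : ℕ
  rounds : ℕ
  NodeState : Type
  EdgeState : Type
  nodeInit : NodeIn → NodeState
  edgeInit : EdgeIn → EdgeState
  contract : ℕ → EdgeState → Bool
  nodeMsg : ℕ → NodeState → Message bits
  consensusOp : ℕ → CommMonoid (Message bits)
  /-- From the consensus values at the source and the target, the messages to the supernodes of the
  source and of the target. -/
  edgeMsg : ℕ → EdgeState → Message bits → Message bits → Message bits × Message bits
  aggregationOp : ℕ → CommMonoid (Message bits)
  /-- New node state, from the consensus value and the aggregate of its supernode. -/
  nodeStep : ℕ → NodeState → Message bits → Message bits → NodeState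
  /-- New edge state, from the consensus values at its two ends (`none` if the edge lies inside
  a supernode). -/
  edgeStep : ℕ → EdgeState → Option (Message bits × Message bits) → EdgeState
  nodeOut : NodeState → NodeOut
  edgeOut : EdgeState → EdgeOut

namespace MinorAggAlgorithm

variable {NodeIn EdgeIn NodeOut EdgeOut : Type}
  (A : MinorAggAlgorithm NodeIn EdgeIn NodeOut EdgeOut)
  {V : Type} (N : Network V)

/-- Two nodes lie in the same supernode in round `t`. -/
def SameSupernode (t : ℕ) (σ : N.graph.edgeSet → A.EdgeState) : V → V → Prop :=
  Relation.EqvGen fun u v => ∃ e, A.contract t (σ e) = true ∧ N.src e = u ∧ N.tgt e = v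

open scoped Classical in
/-- The consensus value of the supernode of `v` in round `t`. -/
def consensus [Fintype V] (t : ℕ) (s : V → A.NodeState) (σ : N.graph.edgeSet → A.EdgeState)
    (v : V) : Message A.bits :=
  letI := A.consensusOp t
  ∏ u with A.SameSupernode N t σ v u, A.nodeMsg t (s u)

open scoped Classical in
/-- The aggregate, over the edges leaving the supernode of `v` in round `t`, of their messages to
this supernode. -/
def aggregate [Fintype V] [Fintype N.graph.edgeSet] (t : ℕ) (s : V → A.NodeState)
    (σ : N.graph.edgeSet → A.EdgeState) (v : V) : Message A.bits :=
  letI := A.aggregationOp t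
  let msg := fun e => A.edgeMsg t (σ e) (A.consensus N t s σ (N.src e))
    (A.consensus N t s σ (N.tgt e))
  (∏ e with A.SameSupernode N t σ v (N.src e) ∧ ¬ A.SameSupernode N t σ v (N.tgt e), (msg e).1) *
    ∏ e with A.SameSupernode N t σ v (N.tgt e) ∧ ¬ A.SameSupernode N t σ v (N.src e), (msg e).2

open scoped Classical in
/-- The states of all nodes and edges after `t` rounds. -/
def states [Fintype V] [Fintype N.graph.edgeSet] (nodeIn : V → NodeIn)
    (edgeIn : N.graph.edgeSet → EdgeIn) :
    ℕ → (V → A.NodeState) × (N.graph.edgeSet → A.EdgeState)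
  | 0 => (fun v => A.nodeInit (nodeIn v), fun e => A.edgeInit (edgeIn e))
  | t + 1 =>
    let s := (states nodeIn edgeIn t).1
    let σ := (states nodeIn edgeIn t).2
    (fun v => A.nodeStep t (s v) (A.consensus N t s σ v) (A.aggregate N t s σ v),
     fun e => A.edgeStep t (σ e)
      (if A.SameSupernode N t σ (N.src e) (N.tgt e) then none
       else some (A.consensus N t s σ (N.src e), A.consensus N t s σ (N.tgt e))))

/-- The output of a node at the end of the run. -/
def nodeResult [Fintype V] [Fintype N.graph.edgeSet] (nodeIn : V → NodeIn)
    (edgeIn : N.graph.edgeSet → EdgeIn) (v : V) : NodeOut :=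
  A.nodeOut ((A.states N nodeIn edgeIn A.rounds).1 v)

/-- The output of an edge at the end of the run. -/
def edgeResult [Fintype V] [Fintype N.graph.edgeSet] (nodeIn : V → NodeIn)
    (edgeIn : N.graph.edgeSet → EdgeIn) (e : N.graph.edgeSet) : EdgeOut :=
  A.edgeOut ((A.states N nodeIn edgeIn A.rounds).2 e)

end MinorAggAlgorithm

/-! ## Distributed input -/

/-- What a node knows about a cluster that contains it: the identifiers of the center and of its parent
in the cluster tree (its own identifier if it is the center), and its potential. -/
structure ClusterKnowledge where
  centerId : ℕ
  parentId : ℕ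
  potential : ℝ

/-- What a node knows: its identifier, and for every scale `D_i` and every clustering `t` of the
distance structure for `D_i` the data of its cluster (`none` if it is in no cluster of it). -/
structure NodeKnowledge where
  id : ℕ
  cluster : ℕ → ℕ → Option ClusterKnowledge

/-- What an edge knows: the identifiers of its two ends (in the order of its orientation) and its
length. -/
structure EdgeKnowledge where
  srcId : ℕ
  tgtId : ℕ
  len : ℕ

open scoped Classical in
/-- The knowledge of node `v` about clustering `t` of a distance structure. -/
def DistanceStructure.knowledge {V : Type} {N : Network V} {D r : ℝ}
    (S : DistanceStructure N D r) (t : ℕ) (v : V) : Option ClusterKnowledge :=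
  if h : ∃ ht : t < S.numClusterings, ∃ K ∈ S.clustering ⟨t, ht⟩, v ∈ K.verts then
    some ⟨N.id h.choose_spec.choose.center, N.id (h.choose_spec.choose.parent v),
      h.choose_spec.choose.potential v⟩
  else none

open scoped Classical in
/-- The initial knowledge of node `v`. -/
def nodeKnowledge {V : Type} [Fintype V] {N : Network V} (S : DistanceStructures N) (v : V) :
    NodeKnowledge where
  id := N.id v
  cluster i t := if h : N.IsScale i then (S i h).knowledge t v else none

/-- The initial knowledge of edge `e`. -/
def edgeKnowledge {V : Type} (N : Network V) (e : N.graph.edgeSet) : EdgeKnowledge where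
  srcId := N.id (N.src e)
  tgtId := N.id (N.tgt e)
  len := N.len e

/-- A bound of the form `Õ(1)`: `C · (⌊log₂ n⌋ + 1) ^ C`. -/
def polylog (C n : ℕ) : ℕ := C * (Nat.log 2 n + 1) ^ C

end

/-! The routing is a hierarchy of layers. Layer `i` consists of `numSets c n` edge sets: the cluster
trees of each clustering for `D_i`, the edges of length zero if `i = 0`, and all edges if `i > 0`
and `D_i` is not a scale. Each node spreads one unit over the roots of its components in the sets of
layer `i`, in proportions `weight / rho`, where `rho n i = ⌊D_{i-1}⌋`. The column of the matrix at
`v` is a telescoping flow: from the roots of `v` in layer `i + 1` to those in layer `i`, for every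
`i`, and from the root in layer `0` to `v` itself. The top layer is connected and has one root for
all nodes, so each column ships a unit from this root to `v`, and demands of sum zero are routed
(`netInflow_routing`).

Two properties of the weights carry this. A transfer is possible only if the root of `v` in layer
`i` lies in the component of `v` in the set of layer `i + 1`. The weight is positive only where the
potential of the cluster exceeds `D_i`; the root is within distance `D_i` of `v`, so its potential
is still positive and it is in the cluster (`conn_root_of_weight_ne_zero`). By linearity,
competitiveness only asks that the columns at the two ends of an edge differ by a flow of cost a
polylogarithmic factor times its length (`isObliviousRouting_of_stretch`). Weights change by at most
`2 * numSets c n` times the length along an edge, and if the ends lie in different components both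
weights are at most the length, since potentials vanish off the cluster. Dividing by `rho n i`,
about `D_{i-1}`, and multiplying by the path length `D_{i+1}` loses only about `(8 τ)²` per part
(`cost_routingPart_le`).

For the evaluation, spanning forests of the edge sets are built by deterministic star merges: tails
join heads, with symmetry broken by the bits of component leaders, and incomplete components double
in each phase (`card_comp_of_incomplete`). Cluster tree edges are bridges, so the forest keeps them
all and inherits the small diameter (`exists_isUnitFlow`). Undoing the merges backwards determines a
tree flow from its net inflows (`flow_of_picked`); performing them forwards builds potentials with
prescribed differences (`pot_sub`), which is what the transpose needs. Weights are integers over a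
common denominator, so only integers are communicated, modulo a power of two. The predicate `Comp`
allows distributed computations to be composed without mentioning states. -/

noncomputable section

namespace MinorAgg

/-! ## Connectivity by a set of edges -/

/-- Two nodes are connected by edges of `S`. -/
def Conn {V : Type} (N : Network V) (S : N.graph.edgeSet → Prop) : V → V → Prop :=
  Relation.EqvGen fun u v => ∃ e, S e ∧ N.src e = u ∧ N.tgt e = v

section Conn
variable {V : Type} {N : Network V} {S S' : N.graph.edgeSet → Prop} {u v x : V}

theorem Conn.refl (v : V) : Conn N S v v := Relation.EqvGen.refl v

theorem Conn.symm (h : Conn N S u v) : Conn N S v u := Relation.EqvGen.symm _ _ h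

theorem Conn.trans (h : Conn N S u v) (h' : Conn N S v x) : Conn N S u x :=
  Relation.EqvGen.trans _ _ _ h h'

theorem Conn.edge {e : N.graph.edgeSet} (h : S e) : Conn N S (N.src e) (N.tgt e) :=
  Relation.EqvGen.rel _ _ ⟨e, h, rfl, rfl⟩

theorem Conn.mono (hS : ∀ e, S e → S' e) (h : Conn N S u v) : Conn N S' u v :=
  Relation.EqvGen.mono (fun _ _ ⟨e, he, h⟩ => ⟨e, hS e he, h⟩) _ _ h

theorem Conn.congr_left (h : Conn N S u v) : Conn N S u x ↔ Conn N S v x :=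
  ⟨fun h' => h.symm.trans h', fun h' => h.trans h'⟩

theorem Conn.congr_right (h : Conn N S u v) : Conn N S x u ↔ Conn N S x v :=
  ⟨fun h' => h'.trans h, fun h' => h'.trans h.symm⟩

/-- A property preserved by all edges of `S` is preserved by `S`-connectivity. -/
theorem Conn.iff_of_edges {p : V → Prop} (hp : ∀ e, S e → (p (N.src e) ↔ p (N.tgt e)))
    (h : Conn N S u v) : p u ↔ p v := by
  induction h with
  | rel _ _ h => obtain ⟨e, he, rfl, rfl⟩ := h; exact hp e he
  | refl _ => rfl
  | symm _ _ _ ih => exact ih.symm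
  | trans _ _ _ _ _ ih ih' => exact ih.trans ih'

theorem conn_empty (hS : ∀ e, ¬ S e) : Conn N S u v ↔ u = v := by
  refine ⟨fun h => ?_, fun h => h ▸ Conn.refl u⟩
  exact ((Conn.iff_of_edges (p := fun x => u = x) (fun e he => (hS e he).elim) h).1 rfl)

end Conn

theorem src_ne_tgt {V : Type} (N : Network V) (e : N.graph.edgeSet) : N.src e ≠ N.tgt e := by
  have h := e.2
  rw [N.ends e, SimpleGraph.mem_edgeSet] at h
  exact h.ne

/-! ## Instances and what can be computed on them -/

/-- An instance of the routing problem: a network, a distance structure for every scale, a demand and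
an edge vector, of the sizes for which an algorithm is designed. -/
structure Inst (c n w : ℕ) where
  V : Type
  [fintypeV : Fintype V]
  N : Network V
  [fintypeE : Fintype N.graph.edgeSet]
  S : DistanceStructures N
  b : V → ℤ
  f : N.graph.edgeSet → ℤ
  card_eq : Fintype.card V = n
  len_le : ∀ e ∈ N.graph.edgeSet, N.len e ≤ n ^ c
  id_lt : ∀ v, N.id v < n ^ c
  num_le : ∀ i hi, (S i hi).numClusterings ≤ c * (Nat.log 2 n + 1)
  b_lt : ∀ v, |b v| < 2 ^ w
  f_lt : ∀ e, |f e| < 2 ^ w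

attribute [instance] Inst.fintypeV Inst.fintypeE

/-- The edges of an instance. -/
abbrev Inst.E {c n w : ℕ} (I : Inst c n w) : Type := I.N.graph.edgeSet

/-- The input of a node. -/
def Inst.nodeIn {c n w : ℕ} (I : Inst c n w) (v : I.V) : NodeKnowledge × ℤ :=
  (nodeKnowledge I.S v, I.b v)

/-- The input of an edge. -/
def Inst.edgeIn {c n w : ℕ} (I : Inst c n w) (e : I.E) : EdgeKnowledge × ℤ :=
  (edgeKnowledge I.N e, I.f e)

/-- Some Minor-Aggregation algorithm with `B`-bit messages and at most `k` rounds computes, on every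
instance, the value `F v` at every node `v` and the value `G e` at every edge `e`. -/
def Comp {c n w : ℕ} {X Y : Type} (B k : ℕ) (F : ∀ I : Inst c n w, I.V → X)
    (G : ∀ I : Inst c n w, I.E → Y) : Prop :=
  ∃ A : MinorAggAlgorithm (NodeKnowledge × ℤ) (EdgeKnowledge × ℤ) X Y,
    A.bits = B ∧ A.rounds ≤ k ∧ ∀ I : Inst c n w,
      (∀ v, A.nodeResult I.N I.nodeIn I.edgeIn v = F I v) ∧
        ∀ e, A.edgeResult I.N I.nodeIn I.edgeIn e = G I e

/-- Node and edge inputs are known without communication. -/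
theorem comp_input {c n w : ℕ} (B : ℕ) :
    Comp B 0 (fun I : Inst c n w => I.nodeIn) (fun I => I.edgeIn) := by
  refine ⟨{ bits := B, rounds := 0, NodeState := _, EdgeState := _, nodeInit := id, edgeInit := id,
            contract := fun _ _ => false, nodeMsg := fun _ _ => ⟨0, by positivity⟩,
            consensusOp := fun _ => ?_, edgeMsg := fun _ _ x y => (x, y),
            aggregationOp := fun _ => ?_, nodeStep := fun _ s _ _ => s, edgeStep := fun _ s _ => s,
            nodeOut := id, edgeOut := id }, rfl, le_rfl, fun I => ⟨fun v => rfl, fun e => rfl⟩⟩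
  all_goals exact inferInstanceAs (CommMonoid (Fin (2 ^ B)))

section Comp
variable {c n w B k k' : ℕ} {X X' Y Y' : Type} {F : ∀ I : Inst c n w, I.V → X}
  {G : ∀ I : Inst c n w, I.E → Y}

open scoped Classical in
/-- The effect of round `t` on the states of all nodes and edges. -/
def roundMap {NI EI NO EO V : Type} (A : MinorAggAlgorithm NI EI NO EO) [Fintype V] (N : Network V)
    [Fintype N.graph.edgeSet] (t : ℕ) (p : (V → A.NodeState) × (N.graph.edgeSet → A.EdgeState)) :
    (V → A.NodeState) × (N.graph.edgeSet → A.EdgeState) :=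
  (fun v => A.nodeStep t (p.1 v) (A.consensus N t p.1 p.2 v) (A.aggregate N t p.1 p.2 v),
    fun e => A.edgeStep t (p.2 e) (if A.SameSupernode N t p.2 (N.src e) (N.tgt e) then none
      else some (A.consensus N t p.1 p.2 (N.src e), A.consensus N t p.1 p.2 (N.tgt e))))

theorem states_succ {NI EI NO EO V : Type} (A : MinorAggAlgorithm NI EI NO EO) [Fintype V]
    (N : Network V) [Fintype N.graph.edgeSet] (x : V → NI) (y : N.graph.edgeSet → EI) (t : ℕ) :
    A.states N x y (t + 1) = roundMap A N t (A.states N x y t) := rfl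

/-- Local computation is free in the model: only the output maps change and the run is identical.
This also serves to forget intermediate values. -/
theorem Comp.map (h : Comp B k F G) (p : X → X') (q : Y → Y')
    {F' : ∀ I : Inst c n w, I.V → X'} {G' : ∀ I : Inst c n w, I.E → Y'}
    (hF : ∀ I v, F' I v = p (F I v)) (hG : ∀ I e, G' I e = q (G I e)) : Comp B k F' G' := by
  obtain ⟨A, hB, hk, hA⟩ := h
  refine ⟨{ A with nodeOut := p ∘ A.nodeOut, edgeOut := q ∘ A.edgeOut }, hB, hk, fun I => ?_⟩
  have hst : ∀ t, MinorAggAlgorithm.states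
      { A with nodeOut := p ∘ A.nodeOut, edgeOut := q ∘ A.edgeOut } I.N I.nodeIn I.edgeIn t =
      A.states I.N I.nodeIn I.edgeIn t := by
    intro t
    induction t with
    | zero => rfl
    | succ t ih => rw [states_succ, states_succ, ih]; rfl
  refine ⟨fun v => ?_, fun e => ?_⟩
  · rw [hF, ← (hA I).1 v]
    simp only [MinorAggAlgorithm.nodeResult, hst]; rfl
  · rw [hG, ← (hA I).2 e]
    simp only [MinorAggAlgorithm.edgeResult, hst]; rfl

theorem Comp.mono (h : Comp B k F G) (hk : k ≤ k') : Comp B k' F G := by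
  obtain ⟨A, hB, hk', hA⟩ := h
  exact ⟨A, hB, hk'.trans hk, hA⟩

open scoped Classical in
/-- The product of `m` over the component of `v`. -/
def compProd {M V : Type} [CommMonoid M] [Fintype V] (N : Network V) (S : N.graph.edgeSet → Prop)
    (m : V → M) (v : V) : M :=
  ∏ u with Conn N S v u, m u

open scoped Classical in
/-- The product over the edges leaving the component of `v` of the messages `m` to it. -/
def boundaryProd {M V : Type} [CommMonoid M] [Fintype V] (N : Network V) [Fintype N.graph.edgeSet]
    (S : N.graph.edgeSet → Prop) (m : N.graph.edgeSet → M × M) (v : V) : M :=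
  (∏ e with Conn N S v (N.src e) ∧ ¬ Conn N S v (N.tgt e), (m e).1) *
    ∏ e with Conn N S v (N.tgt e) ∧ ¬ Conn N S v (N.src e), (m e).2

open scoped Classical in
/-- One more round of communication, with messages in arbitrary commutative monoids that have as many
elements as there are messages. -/
theorem Comp.round (h : Comp B k F G) {M₁ M₂ : Type} [CommMonoid M₁] [CommMonoid M₂]
    (e₁ : Message B ≃ M₁) (e₂ : Message B ≃ M₂) (ct : Y → Bool) (m : X → M₁) (em : Y → M₂ × M₂) :
    Comp B (k + 1)
      (fun I v => (F I v, compProd I.N (fun e => ct (G I e) = true) (fun u => m (F I u)) v,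
        boundaryProd I.N (fun e => ct (G I e) = true) (fun e => em (G I e)) v))
      (fun I e => (G I e, if Conn I.N (fun e => ct (G I e) = true) (I.N.src e) (I.N.tgt e) then none
        else some (compProd I.N (fun e => ct (G I e) = true) (fun u => m (F I u)) (I.N.src e),
          compProd I.N (fun e => ct (G I e) = true) (fun u => m (F I u)) (I.N.tgt e)))) := by
  obtain ⟨A, rfl, hk, hA⟩ := h
  -- A filler for the two extra message slots of the state. They hold it until the additional round,
  -- so that up to then the new algorithm shadows `A`.
  let z : Message A.bits := ⟨0, by positivity⟩
  let A' : MinorAggAlgorithm (NodeKnowledge × ℤ) (EdgeKnowledge × ℤ) (X × M₁ × M₂)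
      (Y × Option (M₁ × M₁)) :=
    { bits := A.bits
      rounds := A.rounds + 1
      NodeState := A.NodeState × Message A.bits × Message A.bits
      EdgeState := A.EdgeState × Option (Message A.bits × Message A.bits)
      nodeInit := fun x => (A.nodeInit x, z, z)
      edgeInit := fun x => (A.edgeInit x, none)
      contract := fun t s => if t = A.rounds then ct (A.edgeOut s.1) else A.contract t s.1
      nodeMsg := fun t s => if t = A.rounds then e₁.symm (m (A.nodeOut s.1)) else A.nodeMsg t s.1
      consensusOp := fun t => if t = A.rounds then e₁.commMonoid else A.consensusOp t
      edgeMsg := fun t s x y => if t = A.rounds then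
        (e₂.symm (em (A.edgeOut s.1)).1, e₂.symm (em (A.edgeOut s.1)).2) else A.edgeMsg t s.1 x y
      aggregationOp := fun t => if t = A.rounds then e₂.commMonoid else A.aggregationOp t
      nodeStep := fun t s x y => if t = A.rounds then (s.1, x, y) else (A.nodeStep t s.1 x y, z, z)
      edgeStep := fun t s x => if t = A.rounds then (s.1, x) else (A.edgeStep t s.1 x, none)
      nodeOut := fun s => (A.nodeOut s.1, e₁ s.2.1, e₂ s.2.2)
      edgeOut := fun s => (A.edgeOut s.1, s.2.map fun p => (e₁ p.1, e₁ p.2)) }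
  refine ⟨A', rfl, by simpa [A'] using hk, fun I => ?_⟩
  have hst : ∀ t ≤ A.rounds, A'.states I.N I.nodeIn I.edgeIn t =
      (fun v => ((A.states I.N I.nodeIn I.edgeIn t).1 v, z, z),
        fun e => ((A.states I.N I.nodeIn I.edgeIn t).2 e, none)) := by
    intro t ht
    induction t with
    | zero => rfl
    | succ t ih =>
      have hne : t ≠ A.rounds := by omega
      rw [states_succ, states_succ, ih (by omega)]
      have h1 : A'.contract t = fun s => A.contract t s.1 := by simp [A', hne]
      have h2 : A'.nodeMsg t = fun s => A.nodeMsg t s.1 := by simp [A', hne]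
      have h3 : A'.consensusOp t = A.consensusOp t := by simp [A', hne]
      have h4 : A'.edgeMsg t = fun s => A.edgeMsg t s.1 := by simp [A', hne]
      have h5 : A'.aggregationOp t = A.aggregationOp t := by simp [A', hne]
      have h6 : A'.nodeStep t = fun s x y => (A.nodeStep t s.1 x y, z, z) := by simp [A', hne]
      have h7 : A'.edgeStep t = fun s x => (A.edgeStep t s.1 x, none) := by simp [A', hne]
      unfold roundMap MinorAggAlgorithm.aggregate MinorAggAlgorithm.consensus
        MinorAggAlgorithm.SameSupernode
      rw [h1, h2, h3, h4, h5, h6, h7]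
  have hF : ∀ v, A.nodeOut ((A.states I.N I.nodeIn I.edgeIn A.rounds).1 v) = F I v := (hA I).1
  have hG : ∀ e, A.edgeOut ((A.states I.N I.nodeIn I.edgeIn A.rounds).2 e) = G I e := (hA I).2
  have key : ∀ {M : Type} [CommMonoid M] (e : Message A.bits ≃ M) {ι : Type} (s : Finset ι)
      (g : ι → M), e (@Finset.prod ι _ e.commMonoid s (fun i => e.symm (g i))) = ∏ i ∈ s, g i := by
    intro M _ e ι s g
    let _ := e.commMonoid
    exact (map_prod e.mulEquiv (fun i => e.symm (g i)) s).trans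
      (Finset.prod_congr rfl fun i _ => e.apply_symm_apply (g i))
  have key₂ : ∀ {M : Type} [CommMonoid M] (e : Message A.bits ≃ M) (x y : Message A.bits),
      e (@HMul.hMul _ _ _ (@instHMul _ e.commMonoid.toMul) x y) = e x * e y := by
    intro M _ e x y
    let _ := e.commMonoid
    exact map_mul e.mulEquiv x y
  have h1 : A'.contract A.rounds = fun s => ct (A.edgeOut s.1) := by simp [A']
  have h2 : A'.nodeMsg A.rounds = fun s => e₁.symm (m (A.nodeOut s.1)) := by simp [A']
  have h3 : A'.consensusOp A.rounds = e₁.commMonoid := by simp [A']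
  have h4 : A'.edgeMsg A.rounds = fun s _ _ =>
      (e₂.symm (em (A.edgeOut s.1)).1, e₂.symm (em (A.edgeOut s.1)).2) := by simp [A']
  have h5 : A'.aggregationOp A.rounds = e₂.commMonoid := by simp [A']
  have h6 : A'.nodeStep A.rounds = fun s x y => (s.1, x, y) := by simp [A']
  have h7 : A'.edgeStep A.rounds = fun s x => (s.1, x) := by simp [A']
  obtain ⟨s, hs⟩ : ∃ s, (A.states I.N I.nodeIn I.edgeIn A.rounds).1 = s := ⟨_, rfl⟩
  obtain ⟨σ, hσ⟩ : ∃ σ, (A.states I.N I.nodeIn I.edgeIn A.rounds).2 = σ := ⟨_, rfl⟩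
  rw [hs] at hF
  rw [hσ] at hG
  have hS : A'.SameSupernode I.N A.rounds (fun e => (σ e, none)) =
      Conn I.N (fun e => ct (G I e) = true) := by
    unfold MinorAggAlgorithm.SameSupernode
    rw [h1]
    simp only [hG]
    rfl
  have hc : ∀ v, e₁ (A'.consensus I.N A.rounds (fun v => (s v, z, z)) (fun e => (σ e, none)) v) =
      compProd I.N (fun e => ct (G I e) = true) (fun u => m (F I u)) v := by
    intro v
    unfold MinorAggAlgorithm.consensus
    rw [hS, h2, h3]
    simp only [hF]
    exact key e₁ _ _
  have ha : ∀ v, e₂ (A'.aggregate I.N A.rounds (fun v => (s v, z, z)) (fun e => (σ e, none)) v) =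
      boundaryProd I.N (fun e => ct (G I e) = true) (fun e => em (G I e)) v := by
    intro v
    unfold MinorAggAlgorithm.aggregate
    rw [hS, h4, h5]
    simp only [hG]
    refine (key₂ e₂ _ _).trans ?_
    rw [key, key]
    rfl
  have hfin : A'.states I.N I.nodeIn I.edgeIn A'.rounds =
      roundMap A' I.N A.rounds (fun v => (s v, z, z), fun e => (σ e, none)) := by
    change A'.states I.N I.nodeIn I.edgeIn (A.rounds + 1) = _
    rw [states_succ, hst _ le_rfl, hs, hσ]
  refine ⟨fun v => ?_, fun e => ?_⟩
  · unfold MinorAggAlgorithm.nodeResult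
    beta_reduce
    rw [hfin, ← hc, ← ha, ← hF]
    unfold roundMap
    rw [h6]
  · unfold MinorAggAlgorithm.edgeResult
    beta_reduce
    rw [hfin, ← hc, ← hc, ← hG]
    unfold roundMap
    rw [h7, hS]
    change (A.edgeOut (σ e), Option.map _ (ite _ _ _)) = _
    split_ifs <;> rfl

end Comp

/-! ## Integer-valued rounds -/

/-- Numbers below `2 ^ B`, aggregated by taking the maximum. -/
def MaxMessage (B : ℕ) : Type := Fin (2 ^ B)

/-- The value of a message aggregated by maximum. -/
def MaxMessage.val {B : ℕ} (x : MaxMessage B) : ℕ := Fin.val x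

instance (B : ℕ) : CommMonoid (MaxMessage B) where
  mul x y := max (α := Fin (2 ^ B)) x y
  one := (⟨0, by positivity⟩ : Fin (2 ^ B))
  mul_assoc x y z := max_assoc (α := Fin (2 ^ B)) x y z
  mul_comm x y := max_comm (α := Fin (2 ^ B)) x y
  one_mul x := max_eq_right (α := Fin (2 ^ B)) (Nat.zero_le _)
  mul_one x := max_eq_left (α := Fin (2 ^ B)) (Nat.zero_le _)

theorem MaxMessage.val_mul {B : ℕ} (x y : MaxMessage B) : (x * y).val = max x.val y.val := by
  have h : ∀ a b : Fin (2 ^ B), (max a b).val = max a.val b.val := fun a b =>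
    Fin.val_strictMono.monotone.map_max
  exact h x y

theorem MaxMessage.val_prod {B : ℕ} {ι : Type} (s : Finset ι) (f : ι → MaxMessage B) :
    (∏ i ∈ s, f i).val = s.sup fun i => (f i).val := by
  classical
  induction s using Finset.induction_on with
  | empty => rfl
  | insert a s ha ih => rw [Finset.prod_insert ha, MaxMessage.val_mul, ih, Finset.sup_insert]

/-- A number as a message aggregated by maximum. -/
def toMaxMessage (B x : ℕ) : MaxMessage B :=
  (⟨x % 2 ^ B, Nat.mod_lt _ (by positivity)⟩ : Fin (2 ^ B))

theorem toMaxMessage_val {B x : ℕ} (hx : x < 2 ^ B) : (toMaxMessage B x).val = x :=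
  Nat.mod_eq_of_lt hx

/-- An integer as a message aggregated by addition. -/
def toSumMessage (B : ℕ) (x : ℤ) : Multiplicative (ZMod (2 ^ B)) := Multiplicative.ofAdd (x : ZMod (2 ^ B))

/-- The integer of least absolute value represented by a message. -/
def ofSumMessage {B : ℕ} (x : Multiplicative (ZMod (2 ^ B))) : ℤ := (Multiplicative.toAdd x).valMinAbs

/-- Residues are read back as integers of least absolute value, so only the final total has to be
small; wrap-around in partial sums is harmless. -/
theorem ofSumMessage_toSumMessage {B : ℕ} {x : ℤ} (hx : 2 * |x| < 2 ^ B) :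
    ofSumMessage (toSumMessage B x) = x := by
  have : NeZero (2 ^ B) := ⟨by positivity⟩
  unfold ofSumMessage toSumMessage
  rw [toAdd_ofAdd, ZMod.valMinAbs_spec]
  have h1 := neg_abs_le x
  have h2 := le_abs_self x
  refine ⟨rfl, ?_, ?_⟩ <;> push_cast <;> linarith

theorem toSumMessage_prod {B : ℕ} {ι : Type} (s : Finset ι) (f : ι → ℤ) :
    ∏ i ∈ s, toSumMessage B (f i) = toSumMessage B (∑ i ∈ s, f i) := by
  unfold toSumMessage
  rw [← ofAdd_sum, Int.cast_sum]

theorem toSumMessage_mul {B : ℕ} (x y : ℤ) :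
    toSumMessage B x * toSumMessage B y = toSumMessage B (x + y) := by
  unfold toSumMessage
  rw [← ofAdd_add, Int.cast_add]

/-- Messages as elements of `ZMod (2 ^ B)`. -/
def sumEquiv (B : ℕ) : Message B ≃ Multiplicative (ZMod (2 ^ B)) :=
  haveI : NeZero (2 ^ B) := ⟨by positivity⟩
  (ZMod.finEquiv (2 ^ B)).toEquiv.trans Multiplicative.ofAdd

/-- Messages as numbers aggregated by maximum. -/
def maxEquiv (B : ℕ) : Message B ≃ MaxMessage B := Equiv.refl _

section
variable {V : Type} (N : Network V) [Fintype N.graph.edgeSet] (S : N.graph.edgeSet → Prop)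

open scoped Classical in
/-- The component of `v`. -/
def comp {V : Type} [Fintype V] (N : Network V) (S : N.graph.edgeSet → Prop) (v : V) : Finset V :=
  Finset.univ.filter fun u => Conn N S v u

open scoped Classical in
/-- The edges whose source, but not their target, lies in the component of `v`. -/
def outEdges (v : V) : Finset N.graph.edgeSet :=
  Finset.univ.filter fun e => Conn N S v (N.src e) ∧ ¬ Conn N S v (N.tgt e)

open scoped Classical in
/-- The edges whose target, but not their source, lies in the component of `v`. -/
def inEdges (v : V) : Finset N.graph.edgeSet :=
  Finset.univ.filter fun e => Conn N S v (N.tgt e) ∧ ¬ Conn N S v (N.src e)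

end

section
variable {V : Type} {N : Network V} {S : N.graph.edgeSet → Prop}

theorem mem_comp [Fintype V] {u v : V} : u ∈ comp N S v ↔ Conn N S v u := by simp [comp]

theorem mem_outEdges [Fintype N.graph.edgeSet] {v : V} {e : N.graph.edgeSet} :
    e ∈ outEdges N S v ↔ Conn N S v (N.src e) ∧ ¬ Conn N S v (N.tgt e) := by simp [outEdges]

theorem mem_inEdges [Fintype N.graph.edgeSet] {v : V} {e : N.graph.edgeSet} :
    e ∈ inEdges N S v ↔ Conn N S v (N.tgt e) ∧ ¬ Conn N S v (N.src e) := by simp [inEdges]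

theorem comp_congr [Fintype V] {u v : V} (h : Conn N S u v) : comp N S u = comp N S v := by
  ext x; rw [mem_comp, mem_comp, h.congr_left]

theorem outEdges_congr [Fintype N.graph.edgeSet] {u v : V} (h : Conn N S u v) :
    outEdges N S u = outEdges N S v := by
  ext x; rw [mem_outEdges, mem_outEdges, h.congr_left, h.congr_left]

theorem inEdges_congr [Fintype N.graph.edgeSet] {u v : V} (h : Conn N S u v) :
    inEdges N S u = inEdges N S v := by
  ext x; rw [mem_inEdges, mem_inEdges, h.congr_left, h.congr_left]

end

/-! ### Single rounds with integer messages, and loops -/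

section Comp
variable {c n w B k : ℕ} {X Y : Type} {F : ∀ I : Inst c n w, I.V → X}
  {G : ∀ I : Inst c n w, I.E → Y}

/-- Nodes learn the sum of `m` over their supernode. -/
theorem Comp.nodeSum (h : Comp B k F G) (ct : Y → Prop) (m : X → ℤ)
    (hb : ∀ I v, 2 * |∑ u ∈ comp I.N (fun e => ct (G I e)) v, m (F I u)| < 2 ^ B) :
    Comp B (k + 1)
      (fun I v => (F I v, ∑ u ∈ comp I.N (fun e => ct (G I e)) v, m (F I u))) G := by
  classical
  refine (h.round (sumEquiv B) (maxEquiv B) (fun y => decide (ct y)) (fun x => toSumMessage B (m x))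
    (fun _ => (1, 1))).map (fun x => (x.1, ofSumMessage x.2.1)) Prod.fst (fun I v => ?_)
    (fun I e => rfl)
  refine Prod.ext rfl ?_
  simp only [decide_eq_true_eq, compProd, toSumMessage_prod]
  exact (ofSumMessage_toSumMessage (hb I v)).symm

/-- Nodes learn the maximum of `m` over their supernode. -/
theorem Comp.nodeMax (h : Comp B k F G) (ct : Y → Prop) (m : X → ℕ)
    (hb : ∀ I v, m (F I v) < 2 ^ B) :
    Comp B (k + 1)
      (fun I v => (F I v, (comp I.N (fun e => ct (G I e)) v).sup fun u => m (F I u))) G := by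
  classical
  refine (h.round (maxEquiv B) (maxEquiv B) (fun y => decide (ct y)) (fun x => toMaxMessage B (m x))
    (fun _ => (1, 1))).map (fun x => (x.1, x.2.1.val)) Prod.fst (fun I v => ?_)
    (fun I e => rfl)
  refine Prod.ext rfl ?_
  simp only [decide_eq_true_eq, compProd, MaxMessage.val_prod, toMaxMessage_val (hb I _)]
  rfl

/-- Nodes learn the sum of the messages of the edges leaving their supernode. -/
theorem Comp.boundarySum (h : Comp B k F G) (ct : Y → Prop) (m : Y → ℤ × ℤ)
    (hb : ∀ I v, 2 * |∑ e ∈ outEdges I.N (fun e => ct (G I e)) v, (m (G I e)).1 +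
      ∑ e ∈ inEdges I.N (fun e => ct (G I e)) v, (m (G I e)).2| < 2 ^ B) :
    Comp B (k + 1)
      (fun I v => (F I v, ∑ e ∈ outEdges I.N (fun e => ct (G I e)) v, (m (G I e)).1 +
        ∑ e ∈ inEdges I.N (fun e => ct (G I e)) v, (m (G I e)).2)) G := by
  classical
  refine (h.round (maxEquiv B) (sumEquiv B) (fun y => decide (ct y)) (fun _ => 1)
    (fun y => (toSumMessage B (m y).1, toSumMessage B (m y).2))).map
    (fun x => (x.1, ofSumMessage x.2.2)) Prod.fst (fun I v => ?_) (fun I e => rfl)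
  refine Prod.ext rfl ?_
  simp only [decide_eq_true_eq, boundaryProd, toSumMessage_prod, toSumMessage_mul]
  exact (ofSumMessage_toSumMessage (hb I v)).symm

/-- Nodes learn the maximum of the messages of the edges leaving their supernode. -/
theorem Comp.boundaryMax (h : Comp B k F G) (ct : Y → Prop) (m : Y → ℕ × ℕ)
    (hb : ∀ I e, (m (G I e)).1 < 2 ^ B ∧ (m (G I e)).2 < 2 ^ B) :
    Comp B (k + 1)
      (fun I v => (F I v, max ((outEdges I.N (fun e => ct (G I e)) v).sup fun e => (m (G I e)).1)
        ((inEdges I.N (fun e => ct (G I e)) v).sup fun e => (m (G I e)).2))) G := by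
  classical
  refine (h.round (maxEquiv B) (maxEquiv B) (fun y => decide (ct y)) (fun _ => 1)
    (fun y => (toMaxMessage B (m y).1, toMaxMessage B (m y).2))).map
    (fun x => (x.1, x.2.2.val)) Prod.fst (fun I v => ?_) (fun I e => rfl)
  refine Prod.ext rfl ?_
  simp only [decide_eq_true_eq, boundaryProd, MaxMessage.val_mul, MaxMessage.val_prod,
    toMaxMessage_val (hb I _).1, toMaxMessage_val (hb I _).2]
  rfl

/-- Edges learn a value from each of their ends. -/
theorem Comp.edgeLearn (h : Comp B k F G) (m : X → ℤ)
    (hb : ∀ I v, 2 * |m (F I v)| < 2 ^ B) :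
    Comp B (k + 1) F (fun I e => (G I e, m (F I (I.N.src e)), m (F I (I.N.tgt e)))) := by
  classical
  refine (h.round (sumEquiv B) (maxEquiv B) (fun _ => false) (fun x => toSumMessage B (m x))
    (fun _ => (1, 1))).map Prod.fst
    (fun y => (y.1, ofSumMessage (y.2.getD 1).1, ofSumMessage (y.2.getD 1).2)) (fun I v => rfl)
    (fun I e => ?_)
  -- Nothing is contracted: supernodes are single nodes, a consensus value is the message of the
  -- node itself, and no edge is internal, so the default of `getD` never occurs.
  have hc : ∀ u v, Conn I.N (fun e => false = true) u v ↔ u = v := fun u v =>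
    conn_empty (fun _ => by simp)
  have hp : ∀ u, compProd I.N (fun e => false = true) (fun u => toSumMessage B (m (F I u))) u =
      toSumMessage B (m (F I u)) := by
    intro u
    simp only [compProd, hc, Finset.filter_eq, Finset.mem_univ, if_true, Finset.prod_singleton]
  simp only [hc, src_ne_tgt I.N e, if_false, hp, Option.getD_some,
    ofSumMessage_toSumMessage (hb I _)]

/-- A loop that accumulates a sum at the edges. -/
theorem Comp.edgeLoop {r : ℕ} (term : ℕ → ∀ I : Inst c n w, I.E → ℝ)
    (hstep : ∀ (k : ℕ) (acc : ∀ I : Inst c n w, I.E → ℝ) (j : ℕ),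
      Comp B k F (fun I e => (G I e, acc I e)) →
      Comp B (k + r) F (fun I e => (G I e, acc I e + term j I e)))
    (M k : ℕ) (acc : ∀ I : Inst c n w, I.E → ℝ) (h : Comp B k F (fun I e => (G I e, acc I e))) :
    Comp B (k + M * r) F (fun I e => (G I e, acc I e + ∑ j ∈ Finset.range M, term j I e)) := by
  induction M with
  | zero => simpa using h
  | succ M ih =>
    have := hstep _ _ M ih
    simp only [Finset.sum_range_succ, ← add_assoc]
    exact this.mono (by rw [Nat.succ_mul, add_assoc])

/-- A loop that accumulates a sum at the nodes. -/
theorem Comp.nodeLoop {r : ℕ} (term : ℕ → ∀ I : Inst c n w, I.V → ℝ)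
    (hstep : ∀ (k : ℕ) (acc : ∀ I : Inst c n w, I.V → ℝ) (j : ℕ),
      Comp B k (fun I v => (F I v, acc I v)) G →
      Comp B (k + r) (fun I v => (F I v, acc I v + term j I v)) G)
    (M k : ℕ) (acc : ∀ I : Inst c n w, I.V → ℝ) (h : Comp B k (fun I v => (F I v, acc I v)) G) :
    Comp B (k + M * r) (fun I v => (F I v, acc I v + ∑ j ∈ Finset.range M, term j I v)) G := by
  induction M with
  | zero => simpa using h
  | succ M ih =>
    have := hstep _ _ M ih
    simp only [Finset.sum_range_succ, ← add_assoc]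
    exact this.mono (by rw [Nat.succ_mul, add_assoc])

end Comp

/-! ## Spanning forests by star merges -/

/-- The source (`true`) or the target (`false`) of an edge. -/
def endp {V : Type} (N : Network V) (e : N.graph.edgeSet) : Bool → V
  | true => N.src e
  | false => N.tgt e

/-- The largest identifier in the component of `v`. -/
def leader {V : Type} [Fintype V] (N : Network V) (S : N.graph.edgeSet → Prop) (v : V) : ℕ :=
  (comp N S v).sup N.id

/-- Whether a component with a given leader and size is a head in step `j`; a phase of the algorithm
has a step for every bit of the leader and each of its two values, and a final step. -/
def headRule (b j l s : ℕ) : Prop :=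
  if j % (2 * b + 1) < 2 * b then l.testBit (j % (2 * b + 1) / 2) = decide (j % (2 * b + 1) % 2 = 0)
  else 2 ^ (j / (2 * b + 1) + 1) ≤ s

/-- The component of `v` is a head in step `j`. -/
def IsHead {V : Type} [Fintype V] (N : Network V) (b : ℕ) (S : N.graph.edgeSet → Prop) (j : ℕ)
    (v : V) : Prop :=
  headRule b j (leader N S v) (comp N S v).card

/-- A number that determines an edge. -/
def edgeCode {V : Type} (N : Network V) (K : ℕ) (e : N.graph.edgeSet) : ℕ :=
  N.id (N.src e) * K + N.id (N.tgt e) + 1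

/-- In step `j`, the end `d` of the edge `e` of `H` lies in a tail and the other end in a head. -/
def IsCandidate {V : Type} [Fintype V] (N : Network V) (b : ℕ) (H S : N.graph.edgeSet → Prop)
    (j : ℕ) (d : Bool) (e : N.graph.edgeSet) : Prop :=
  H e ∧ ¬ IsHead N b S j (endp N e d) ∧ IsHead N b S j (endp N e !d)

open scoped Classical in
/-- The message of an edge to the component of its end `d`. -/
def candidateCode {V : Type} [Fintype V] (N : Network V) (b K : ℕ) (H S : N.graph.edgeSet → Prop)
    (j : ℕ) (d : Bool) (e : N.graph.edgeSet) : ℕ :=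
  if IsCandidate N b H S j d e then edgeCode N K e else 0

section
variable {V : Type} [Fintype V] {N : Network V} {b : ℕ} {S S' : N.graph.edgeSet → Prop} {j : ℕ}

theorem comp_mono (hS : ∀ e, S e → S' e) (v : V) : comp N S v ⊆ comp N S' v := fun u hu => by
  rw [mem_comp] at *; exact hu.mono hS

theorem leader_congr {u v : V} (h : Conn N S u v) : leader N S u = leader N S v := by
  rw [leader, comp_congr h, leader]

theorem IsHead.congr {u v : V} (h : Conn N S u v) : IsHead N b S j u ↔ IsHead N b S j v := by
  rw [IsHead, leader_congr h, comp_congr h, IsHead]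

theorem exists_leader (S : N.graph.edgeSet → Prop) (v : V) :
    ∃ u, Conn N S v u ∧ N.id u = leader N S v := by
  obtain ⟨u, hu, h⟩ := Finset.exists_mem_eq_sup (comp N S v) ⟨v, mem_comp.2 (Conn.refl v)⟩ N.id
  exact ⟨u, mem_comp.1 hu, h.symm⟩

/-- Identifiers are distinct, so a leader names its component; different components therefore differ
in some bit of the leader. -/
theorem conn_of_leader_eq {u v : V} (h : leader N S u = leader N S v) : Conn N S u v := by
  obtain ⟨x, hx, hx'⟩ := exists_leader S u
  obtain ⟨y, hy, hy'⟩ := exists_leader S v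
  have : x = y := N.id_injective (by rw [hx', hy', h])
  subst this
  exact hx.trans hy.symm

theorem IsCandidate.not_conn {H : N.graph.edgeSet → Prop} {d : Bool} {e : N.graph.edgeSet} (h : IsCandidate N b H S j d e) :
    ¬ Conn N S (endp N e d) (endp N e !d) := fun hc => h.2.1 ((IsHead.congr hc).2 h.2.2)

/-- The two identifiers are digits in base `K`. The added one in the code keeps `0` free for "no
candidate". -/
theorem edgeCode_injective {V : Type} {N : Network V} {K : ℕ} (hid : ∀ v, N.id v < K) : Function.Injective (edgeCode N K) := by
  intro e e' h
  have h1 : N.id (N.tgt e) + K * N.id (N.src e) = N.id (N.tgt e') + K * N.id (N.src e') := by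
    unfold edgeCode at h; linarith
  have hK : 0 < K := (Nat.zero_le _).trans_lt (hid (N.src e))
  have hs : N.src e = N.src e' := N.id_injective (by
    have := congrArg (· / K) h1
    simpa [Nat.add_mul_div_left _ _ hK, Nat.div_eq_of_lt (hid _)] using this)
  have ht : N.tgt e = N.tgt e' := N.id_injective (by rw [hs] at h1; omega)
  exact Subtype.ext (by rw [N.ends, N.ends, hs, ht])

end

/-! ### Picks of the tails, and doubling of the components -/

section Forest
variable {V : Type} [Fintype V] (N : Network V) [Fintype N.graph.edgeSet]

/-- The largest code of a candidate edge of the component of `v`. -/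
def best (b K : ℕ) (H S : N.graph.edgeSet → Prop) (j : ℕ) (v : V) : ℕ :=
  max ((outEdges N S v).sup (candidateCode N b K H S j true))
    ((inEdges N S v).sup (candidateCode N b K H S j false))

/-- In step `j`, the tail that contains the end `d` of `e` picks the edge `e`. -/
def Picked (b K : ℕ) (H S : N.graph.edgeSet → Prop) (j : ℕ) (d : Bool) (e : N.graph.edgeSet) : Prop :=
  IsCandidate N b H S j d e ∧ best N b K H S j (endp N e d) = edgeCode N K e

/-- The edges chosen in the first `j` steps. -/
def chosen (b K : ℕ) (H : N.graph.edgeSet → Prop) : ℕ → N.graph.edgeSet → Prop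
  | 0 => fun _ => False
  | j + 1 => fun e => chosen b K H j e ∨ ∃ d, Picked N b K H (chosen b K H j) j d e

variable {N} {b K : ℕ} {H S S' : N.graph.edgeSet → Prop} {j : ℕ}

theorem best_congr {u v : V} (h : Conn N S u v) : best N b K H S j u = best N b K H S j v := by
  rw [best, outEdges_congr h, inEdges_congr h, best]

theorem IsCandidate.le_best {d : Bool} {e : N.graph.edgeSet} (h : IsCandidate N b H S j d e) :
    edgeCode N K e ≤ best N b K H S j (endp N e d) := by
  have hn := h.not_conn
  cases d with
  | true =>
    refine le_max_of_le_left (le_trans (le_of_eq ?_)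
      (Finset.le_sup (mem_outEdges.2 ⟨Conn.refl _, hn⟩)))
    rw [candidateCode, if_pos h]
  | false =>
    refine le_max_of_le_right (le_trans (le_of_eq ?_)
      (Finset.le_sup (mem_inEdges.2 ⟨Conn.refl _, hn⟩)))
    rw [candidateCode, if_pos h]

/-- A positive maximum is attained, and not by the value `0` of a non-candidate, so the attaining
edge is a candidate and is picked. -/
theorem exists_picked {v : V} (h : 0 < best N b K H S j v) :
    ∃ d e, Conn N S v (endp N e d) ∧ Picked N b K H S j d e := by
  have key : ∀ (d : Bool) (s : Finset N.graph.edgeSet), (∀ e ∈ s, Conn N S v (endp N e d)) →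
      best N b K H S j v = s.sup (candidateCode N b K H S j d) →
      ∃ d e, Conn N S v (endp N e d) ∧ Picked N b K H S j d e := by
    intro d s hs hb
    have hne : s.Nonempty := by
      rw [Finset.nonempty_iff_ne_empty]
      rintro rfl
      simp only [Finset.sup_empty, bot_eq_zero] at hb
      omega
    obtain ⟨e, he, h'⟩ := Finset.exists_mem_eq_sup s hne (candidateCode N b K H S j d)
    rw [h', candidateCode] at hb
    split_ifs at hb with hc
    · exact ⟨d, e, hs e he, hc, by rw [← best_congr (hs e he), hb]⟩
    · omega
  rcases max_choice ((outEdges N S v).sup (candidateCode N b K H S j true))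
    ((inEdges N S v).sup (candidateCode N b K H S j false)) with h' | h'
  · exact key true _ (fun e he => (mem_outEdges.1 he).1) h'
  · exact key false _ (fun e he => (mem_inEdges.1 he).1) h'

/-- A tail picks at most one edge. -/
theorem Picked.unique (hid : ∀ v, N.id v < K) {d d' : Bool} {e e' : N.graph.edgeSet}
    (h : Picked N b K H S j d e) (h' : Picked N b K H S j d' e')
    (hc : Conn N S (endp N e d) (endp N e' d')) : e = e' :=
  edgeCode_injective hid (by rw [← h.2, ← h'.2, best_congr hc])

/-- The picking end lies in a tail and the other end in a head, so no edge is picked from both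
sides. -/
theorem Picked.dir {d d' : Bool} {e : N.graph.edgeSet} (h : Picked N b K H S j d e)
    (h' : Picked N b K H S j d' e) : d = d' := by
  by_contra hne
  have : d' = !d := by cases d <;> cases d' <;> simp_all
  subst this
  exact h'.1.2.1 h.1.2.2

theorem chosen_mono {i j : ℕ} (hij : i ≤ j) (e : N.graph.edgeSet) (h : chosen N b K H i e) :
    chosen N b K H j e := by
  induction j, hij using Nat.le_induction with
  | base => exact h
  | succ j _ ih => exact Or.inl ih

theorem chosen_subset (j : ℕ) (e : N.graph.edgeSet) (h : chosen N b K H j e) : H e := by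
  induction j with
  | zero => exact h.elim
  | succ j ih =>
    rcases h with h | ⟨d, h⟩
    · exact ih h
    · exact h.1.1

/-- Some edge of `H` leaves the component of `v`. -/
def Incomplete {V : Type} (N : Network V) (H S : N.graph.edgeSet → Prop) (v : V) : Prop :=
  ∃ e d, H e ∧ Conn N S v (endp N e d) ∧ ¬ Conn N S v (endp N e !d)

/-- A component that grows absorbs another one across an edge of `H`. This edge makes both of the
old components incomplete, and they are disjoint. -/
theorem card_comp_of_grows (hS : ∀ e, S e → S' e) (hS' : ∀ e, S' e → H e) {m : ℕ}
    (hm : ∀ v, Incomplete N H S v → m ≤ (comp N S v).card) {u v : V} (h : Conn N S' v u)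
    (h' : ¬ Conn N S v u) : 2 * m ≤ (comp N S' v).card := by
  classical
  obtain ⟨e, d, he, h1, h2, h3⟩ : ∃ e d, S' e ∧ Conn N S v (endp N e d) ∧
      ¬ Conn N S v (endp N e !d) ∧ Conn N S' v (endp N e !d) := by
    by_contra! hcon
    refine h' ((Conn.iff_of_edges (p := fun x => Conn N S v x) (fun e he => ?_) h).1 (Conn.refl v))
    have ht := hcon e true he
    have hf := hcon e false he
    simp only [endp, Bool.not_true, Bool.not_false] at ht hf
    constructor
    · intro hs
      by_contra hn
      exact ht hs hn ((hs.mono hS).trans (Conn.edge he))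
    · intro hs
      by_contra hn
      exact hf hs hn ((hs.mono hS).trans (Conn.edge he).symm)
  have hv := hm v ⟨e, d, hS' e he, h1, h2⟩
  have hb := hm (endp N e !d) ⟨e, !d, hS' e he, Conn.refl _, fun hc => h2 (by
    rw [Bool.not_not] at hc; exact h1.trans hc.symm)⟩
  have hdisj : Disjoint (comp N S v) (comp N S (endp N e !d)) := by
    rw [Finset.disjoint_left]
    intro x hx hx'
    rw [mem_comp] at hx hx'
    exact h2 (hx.trans hx'.symm)
  have hsub : comp N S v ∪ comp N S (endp N e !d) ⊆ comp N S' v := by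
    refine Finset.union_subset (comp_mono hS v) ?_
    rw [comp_congr h3]
    exact comp_mono hS _
  have := Finset.card_le_card hsub
  rw [Finset.card_union_of_disjoint hdisj] at this
  omega

/-- The edge `e` only shows that the tail has a candidate; the edge it picks may be another one, but
every pick leads out of the component. -/
theorem exists_grows {v : V} {e : N.graph.edgeSet} {d : Bool} (he : H e)
    (hv : Conn N (chosen N b K H j) v (endp N e d))
    (hf : ¬ IsHead N b (chosen N b K H j) j v)
    (hh : IsHead N b (chosen N b K H j) j (endp N e !d)) :
    ∃ u, Conn N (chosen N b K H (j + 1)) v u ∧ ¬ Conn N (chosen N b K H j) v u := by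
  have hc : IsCandidate N b H (chosen N b K H j) j d e := ⟨he, fun h => hf ((IsHead.congr hv).2 h), hh⟩
  obtain ⟨d', e', h1, h2⟩ := exists_picked (v := v)
    (lt_of_lt_of_le (Nat.succ_pos _) ((hc.le_best (K := K)).trans_eq (best_congr hv).symm))
  refine ⟨endp N e' !d', ?_, fun h => h2.1.not_conn (h1.symm.trans h)⟩
  have hch : chosen N b K H (j + 1) e' := Or.inr ⟨d', h2⟩
  refine (h1.mono (chosen_mono (Nat.le_succ j))).trans ?_
  cases d'
  · exact (Conn.edge hch).symm
  · exact Conn.edge hch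

/-- After `p` phases, incomplete components have at least `2 ^ p` nodes. -/
theorem card_comp_of_incomplete (hid : ∀ v, N.id v < 2 ^ b) (p : ℕ) :
    ∀ v, Incomplete N H (chosen N b K H (p * (2 * b + 1))) v →
      2 ^ p ≤ (comp N (chosen N b K H (p * (2 * b + 1))) v).card := by
  induction p with
  | zero => exact fun v _ => Finset.card_pos.2 ⟨v, mem_comp.2 (Conn.refl v)⟩
  | succ p ih =>
    set s := p * (2 * b + 1) with hs
    have hs' : (p + 1) * (2 * b + 1) = s + (2 * b + 1) := by rw [hs]; ring
    rw [hs']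
    -- A component of fewer than `2 ^ (p + 1)` nodes has not changed since the start of the phase: a
    -- merger would have united components that were incomplete then, of at least `2 ^ p` nodes
    -- each.
    have stable : ∀ j w, s ≤ j → Incomplete N H (chosen N b K H j) w →
        (comp N (chosen N b K H j) w).card < 2 ^ (p + 1) →
        ∀ i, s ≤ i → i ≤ j → comp N (chosen N b K H i) w = comp N (chosen N b K H j) w := by
      intro j w hj _ hc i hi hij
      refine Finset.Subset.antisymm (comp_mono (chosen_mono hij) w) fun u hu => ?_
      rw [mem_comp] at hu ⊢
      by_contra hn
      have := card_comp_of_grows (chosen_mono hj) (chosen_subset j) ih hu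
        fun h => hn (h.mono (chosen_mono hi))
      rw [pow_succ] at hc
      omega
    intro v hv
    by_contra! hlt
    obtain ⟨e, d, he, h1, h2⟩ := id hv
    have hst := stable _ v (by omega) hv hlt
    have hconn : ∀ i, s ≤ i → i ≤ s + (2 * b + 1) → ∀ u,
        (Conn N (chosen N b K H i) v u ↔ Conn N (chosen N b K H (s + (2 * b + 1))) v u) := by
      intro i hi hi' u
      rw [← mem_comp, hst i hi hi', mem_comp]
    -- The component of `v` does not grow in this phase, so it is never a tail next to a head.
    have head : ∀ i, s ≤ i → i < s + (2 * b + 1) →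
        IsHead N b (chosen N b K H i) i (endp N e !d) → IsHead N b (chosen N b K H i) i v := by
      intro i hi hi' hh
      by_contra hf
      obtain ⟨u, hu, hu'⟩ := exists_grows he ((hconn i hi hi'.le _).2 h1) hf hh
      exact hu' ((hconn i hi hi'.le u).2 ((hconn (i + 1) (by omega) hi' u).1 hu))
    have hmod : ∀ q < 2 * b + 1, (s + q) % (2 * b + 1) = q := fun q hq => by
      rw [hs, Nat.add_comm, Nat.add_mul_mod_self_right, Nat.mod_eq_of_lt hq]
    have hdiv : (s + 2 * b) / (2 * b + 1) = p := by
      rw [hs, Nat.add_comm, Nat.add_mul_div_right _ _ (by omega), Nat.div_eq_of_lt (by omega), zero_add]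
    -- A large neighbour would be a head in the final step of the phase, which goes by size, while
    -- the small component of `v` would be a tail.
    have hb1 : (comp N (chosen N b K H (s + 2 * b)) (endp N e !d)).card < 2 ^ (p + 1) := by
      by_contra! hge
      have := head (s + 2 * b) (by omega) (by omega) (by
        rw [IsHead, headRule, hmod _ (by omega), if_neg (lt_irrefl _), hdiv]; exact hge)
      rw [IsHead, headRule, hmod _ (by omega), if_neg (lt_irrefl _), hdiv, hst _ (by omega) (by omega)]
        at this
      omega
    -- Hence the neighbour, too, is frozen during the bit steps, and both leaders keep the values
    -- they had at the start.
    have hst' := stable (s + 2 * b) (endp N e !d) (by omega) ⟨e, !d, he, Conn.refl _, fun hc => h2 (by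
      rw [Bool.not_not] at hc
      exact h1.trans (hc.mono (chosen_mono (by omega))).symm)⟩ hb1
    have hld : ∀ i, s ≤ i → i ≤ s + 2 * b →
        leader N (chosen N b K H i) v = leader N (chosen N b K H s) v ∧
        leader N (chosen N b K H i) (endp N e !d) = leader N (chosen N b K H s) (endp N e !d) := by
      intro i hi hi'
      simp only [leader]
      rw [hst i hi (by omega), hst s le_rfl (by omega), hst' i hi hi', hst' s le_rfl (by omega)]
      exact ⟨rfl, rfl⟩
    have hne : leader N (chosen N b K H s) v ≠ leader N (chosen N b K H s) (endp N e !d) := fun h =>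
      h2 ((conn_of_leader_eq h).mono (chosen_mono (by omega)))
    have hlt' : ∀ x, leader N (chosen N b K H s) x < 2 ^ b := fun x => by
      obtain ⟨y, -, hy⟩ := exists_leader (chosen N b K H s) x
      rw [← hy]; exact hid y
    obtain ⟨q, hq⟩ : ∃ q, (leader N (chosen N b K H s) v).testBit q ≠
        (leader N (chosen N b K H s) (endp N e !d)).testBit q := by
      by_contra! h
      exact hne (Nat.eq_of_testBit_eq h)
    have hqb : q < b := by
      by_contra! h
      refine hq ?_
      rw [Nat.testBit_lt_two_pow ((hlt' _).trans_le (Nat.pow_le_pow_right (by omega) h)),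
        Nat.testBit_lt_two_pow ((hlt' _).trans_le (Nat.pow_le_pow_right (by omega) h))]
    -- The parity `r` selects the step of bit `q` in which the neighbour is a head. By `head` the
    -- leader of `v` then has the same bit, against the choice of `q`.
    have fin : ∀ r < 2, (leader N (chosen N b K H s) (endp N e !d)).testBit q = decide (r = 0) →
        False := by
      intro r hr h
      have h3 : (2 * q + r) / 2 = q := by omega
      have h4 : (2 * q + r) % 2 = r := by omega
      have hh := head (s + (2 * q + r)) (by omega) (by omega) (by
        rw [IsHead, headRule, hmod _ (by omega), if_pos (by omega), (hld _ (by omega) (by omega)).2,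
          h3, h4, h])
      rw [IsHead, headRule, hmod _ (by omega), if_pos (by omega), (hld _ (by omega) (by omega)).1,
          h3, h4] at hh
      exact hq (hh.trans h.symm)
    rcases hB : (leader N (chosen N b K H s) (endp N e !d)).testBit q with _ | _
    · exact fin 1 (by omega) (by simp [hB])
    · exact fin 0 (by omega) (by simp [hB])

/-- The number of steps after which all components are complete. -/
def numSteps (n b : ℕ) : ℕ := (Nat.log 2 n + 1) * (2 * b + 1)

/-- After `Nat.log 2 n + 1` phases an incomplete component would have more than `n` nodes. -/
theorem conn_of_allowed (hid : ∀ v, N.id v < 2 ^ b) {n : ℕ} (hn : Fintype.card V = n)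
    {e : N.graph.edgeSet} (he : H e) :
    Conn N (chosen N b K H (numSteps n b)) (N.src e) (N.tgt e) := by
  by_contra h
  have h1 := card_comp_of_incomplete (K := K) (H := H) hid (Nat.log 2 n + 1) (N.src e)
    ⟨e, true, he, Conn.refl _, h⟩
  have h2 := Finset.card_le_univ (comp N (chosen N b K H (numSteps n b)) (N.src e))
  rw [hn] at h2
  have h3 : n < 2 ^ (Nat.log 2 n + 1) := Nat.lt_pow_succ_log_self (by omega) n
  exact absurd (h1.trans h2) (by omega)

theorem conn_chosen_iff (hid : ∀ v, N.id v < 2 ^ b) {n : ℕ} (hn : Fintype.card V = n) {u v : V} :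
    Conn N (chosen N b K H (numSteps n b)) u v ↔ Conn N H u v := by
  refine ⟨Conn.mono (chosen_subset _), fun h => ?_⟩
  exact (Conn.iff_of_edges (p := fun x => Conn N (chosen N b K H (numSteps n b)) u x)
    (fun e he => (conn_of_allowed hid hn he).congr_right) h).1 (Conn.refl u)

/-- All edges are chosen if every edge of `H` is a bridge of `H`. -/
theorem chosen_of_bridge (hid : ∀ v, N.id v < 2 ^ b) {n : ℕ} (hn : Fintype.card V = n)
    {e : N.graph.edgeSet} (he : H e)
    (hbr : ¬ Conn N (fun e' => H e' ∧ e' ≠ e) (N.src e) (N.tgt e)) :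
    chosen N b K H (numSteps n b) e := by
  by_contra hcon
  refine hbr ((conn_of_allowed (K := K) hid hn he).mono fun e' he' => ⟨chosen_subset _ _ he', ?_⟩)
  rintro rfl
  exact hcon he'

end Forest

/-! ## Flows along walks -/

section WalkFlow
variable {V : Type} (N : Network V)

/-- The graph formed by a set of edges. -/
def edgeGraph (S : N.graph.edgeSet → Prop) : SimpleGraph V :=
  SimpleGraph.fromRel fun u v => ∃ e, S e ∧ N.src e = u ∧ N.tgt e = v

open scoped Classical in
/-- The unit flow from `u` to `v` along the edge between them. -/
def stepFlow (u v : V) (e : N.graph.edgeSet) : ℤ :=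
  (if N.src e = u ∧ N.tgt e = v then 1 else 0) - if N.src e = v ∧ N.tgt e = u then 1 else 0

/-- The unit flow along a walk. -/
def walkFlow {G : SimpleGraph V} : ∀ {u v : V}, G.Walk u v → N.graph.edgeSet → ℤ
  | _, _, .nil => fun _ => 0
  | _, _, .cons (u := u) (v := v) _ p => fun e => stepFlow N u v e + walkFlow p e

variable {N} {S : N.graph.edgeSet → Prop} {u v : V}

theorem edge_ext {e e' : N.graph.edgeSet} (hs : N.src e = N.src e') (ht : N.tgt e = N.tgt e') :
    e = e' := Subtype.ext (by rw [N.ends, N.ends, hs, ht])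

theorem edge_ext_swap {e e' : N.graph.edgeSet} (hs : N.src e = N.tgt e') (ht : N.tgt e = N.src e') :
    e = e' := Subtype.ext (by rw [N.ends, N.ends, hs, ht, Sym2.eq_swap])

-- The graph is simple, so a pair of neighbours determines one edge; the orientation only decides
-- the sign.
open scoped Classical in
theorem exists_stepFlow_eq (h : (edgeGraph N S).Adj u v) :
    ∃ e₀, ∃ d : Bool, S e₀ ∧ endp N e₀ d = u ∧ (endp N e₀ !d) = v ∧
      ∀ e, stepFlow N u v e = if e = e₀ then (if d then 1 else -1) else 0 := by
  rw [edgeGraph, SimpleGraph.fromRel_adj] at h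
  obtain ⟨hne, ⟨e, he, rfl, rfl⟩ | ⟨e, he, rfl, rfl⟩⟩ := h
  · refine ⟨e, true, he, rfl, rfl, fun e' => ?_⟩
    unfold stepFlow
    by_cases h : e' = e
    · subst h
      simp [src_ne_tgt]
    · rw [if_neg (fun h' => h (edge_ext h'.1 h'.2)), if_neg (fun h' => h (edge_ext_swap h'.1 h'.2)),
        if_neg h, sub_zero]
  · refine ⟨e, false, he, rfl, rfl, fun e' => ?_⟩
    unfold stepFlow
    by_cases h : e' = e
    · subst h
      simp [src_ne_tgt]
    · rw [if_neg (fun h' => h (edge_ext_swap h'.1 h'.2)), if_neg (fun h' => h (edge_ext h'.1 h'.2)),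
        if_neg h, sub_zero]

theorem walkFlow_cons {G : SimpleGraph V} {x : V} (h : G.Adj u v) (p : G.Walk v x)
    (e : N.graph.edgeSet) :
    walkFlow N (SimpleGraph.Walk.cons h p) e = stepFlow N u v e + walkFlow N p e := rfl

theorem walkFlow_eq_zero (p : (edgeGraph N S).Walk u v) {e : N.graph.edgeSet} (he : ¬ S e) :
    walkFlow N p e = 0 := by
  classical
  induction p with
  | nil => rfl
  | cons h p ih =>
    obtain ⟨e₀, d, he₀, -, -, h'⟩ := exists_stepFlow_eq h
    rw [walkFlow_cons, ih, h', if_neg (by rintro rfl; exact he he₀), add_zero]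

theorem abs_walkFlow_le (p : (edgeGraph N S).Walk u v) (e : N.graph.edgeSet) :
    |walkFlow N p e| ≤ p.length := by
  classical
  induction p with
  | nil => simp [walkFlow]
  | cons h p ih =>
    obtain ⟨e₀, d, he₀, -, -, h'⟩ := exists_stepFlow_eq h
    rw [walkFlow_cons, h']
    refine (abs_add_le _ _).trans ?_
    rw [SimpleGraph.Walk.length_cons]
    push_cast
    have : |if e = e₀ then (if d = true then (1 : ℤ) else -1) else 0| ≤ 1 := by
      split_ifs <;> simp
    linarith

/-- The sum telescopes along the walk. Indicators as `π` give the net inflows of a path flow;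
potentials with differences `f` give the sum of `f` along the path. -/
theorem sum_walkFlow_mul {R : Type} [CommRing R] [Fintype N.graph.edgeSet]
    (p : (edgeGraph N S).Walk u v) (g : N.graph.edgeSet → R) (π : V → R)
    (hg : ∀ e, S e → g e = π (N.tgt e) - π (N.src e)) :
    ∑ e, (walkFlow N p e : R) * g e = π v - π u := by
  classical
  induction p with
  | nil => simp [walkFlow]
  | cons h p ih =>
    obtain ⟨e₀, d, he₀, h1, h2, h'⟩ := exists_stepFlow_eq h
    simp only [walkFlow, h', Int.cast_add, add_mul, Finset.sum_add_distrib, ih]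
    rw [Finset.sum_eq_single e₀ (fun e _ hne => by simp [hne])
      (fun h => absurd (Finset.mem_univ _) h), if_pos rfl, hg e₀ he₀]
    cases d
    · simp only [endp, Bool.not_false] at h1 h2
      rw [h1, h2]; simp
    · simp only [endp, Bool.not_true] at h1 h2
      rw [h1, h2]; simp

theorem sum_len_mul_abs_walkFlow_le [Fintype N.graph.edgeSet] (p : (edgeGraph N S).Walk u v) :
    ∑ e : N.graph.edgeSet, N.len e * |walkFlow N p e| ≤ walkLen N.len p := by
  classical
  induction p with
  | nil => simp [walkFlow, walkLen]
  | cons h p ih =>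
    rename_i a b c
    obtain ⟨e₀, d, he₀, h1, h2, h'⟩ := exists_stepFlow_eq h
    have hl : walkLen N.len (SimpleGraph.Walk.cons h p) = N.len s(a, b) + walkLen N.len p := by
      simp [walkLen]
    have he : (e₀ : Sym2 V) = s(a, b) := by
      rw [N.ends, ← h1, ← h2]
      cases d
      · exact Sym2.eq_swap
      · rfl
    rw [hl]
    push_cast
    calc ∑ e : N.graph.edgeSet, (N.len e : ℤ) * |walkFlow N (SimpleGraph.Walk.cons h p) e|
        ≤ ∑ e : N.graph.edgeSet, ((if e = e₀ then (N.len e : ℤ) else 0) +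
            (N.len e : ℤ) * |walkFlow N p e|) := by
          refine Finset.sum_le_sum fun e _ => ?_
          rw [walkFlow_cons, h']
          have h3 : |if e = e₀ then (if d = true then (1 : ℤ) else -1) else 0| =
              if e = e₀ then 1 else 0 := by
            split_ifs <;> simp
          calc _ ≤ (N.len e : ℤ) * (|if e = e₀ then (if d = true then (1 : ℤ) else -1) else 0| +
                  |walkFlow N p e|) := by gcongr; exact abs_add_le _ _
            _ = _ := by rw [h3]; split_ifs <;> ring
      _ ≤ _ := by
          rw [Finset.sum_add_distrib, Finset.sum_ite_eq' Finset.univ e₀, if_pos (Finset.mem_univ _), he]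
          linarith

theorem edgeGraph_adj {e : N.graph.edgeSet} (he : S e) :
    (edgeGraph N S).Adj (N.src e) (N.tgt e) := by
  rw [edgeGraph, SimpleGraph.fromRel_adj]
  exact ⟨src_ne_tgt N e, Or.inl ⟨e, he, rfl, rfl⟩⟩

theorem Conn.reachable (h : Conn N S u v) : (edgeGraph N S).Reachable u v :=
  (Conn.iff_of_edges (p := fun x => (edgeGraph N S).Reachable u x) (fun _ he =>
    ⟨fun h => h.trans (edgeGraph_adj he).reachable,
      fun h => h.trans (edgeGraph_adj he).symm.reachable⟩) h).1 (SimpleGraph.Reachable.refl u)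

/-- A path repeats no edge, so its edge list is, up to order, a sublist of that of the walk. -/
theorem walkLen_bypass_le [DecidableEq V] {G : SimpleGraph V} (len : Sym2 V → ℕ) (p : G.Walk u v) :
    walkLen len p.bypass ≤ walkLen len p := by
  unfold walkLen
  have h1 := p.edges_bypass_subset_edges
  have h2 : p.bypass.edges.Nodup := p.bypass_isPath.isTrail.edges_nodup
  obtain ⟨l, hl, hl'⟩ := h2.subperm h1
  rw [← (hl.map len).sum_eq]
  exact (hl'.map len).sum_le_sum fun _ _ => Nat.zero_le _

end WalkFlow

/-! ## Roots and unit flows in forests -/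

open scoped Classical in
/-- The net inflow at `v`. -/
def netInflow {R V : Type} [CommRing R] (N : Network V) [Fintype N.graph.edgeSet]
    (g : N.graph.edgeSet → R) (v : V) : R :=
  ∑ e, g e * ((if N.tgt e = v then 1 else 0) - if N.src e = v then 1 else 0)

theorem netInflow_sum {R ι V : Type} [CommRing R] {N : Network V} [Fintype N.graph.edgeSet] (s : Finset ι)
    (g : ι → N.graph.edgeSet → R) (x : ι → R) (u : V) :
    netInflow N (fun e => ∑ i ∈ s, g i e * x i) u = ∑ i ∈ s, x i * netInflow N (g i) u := by
  unfold netInflow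
  simp only [Finset.sum_mul, Finset.mul_sum]
  rw [Finset.sum_comm]
  exact Finset.sum_congr rfl fun i _ => Finset.sum_congr rfl fun e _ => by ring

section Root
variable {V : Type} [Fintype V] (N : Network V)

/-- The node with the largest identifier in the component of `v`. -/
def root (S : N.graph.edgeSet → Prop) (v : V) : V := (exists_leader S v).choose

variable {N} {S : N.graph.edgeSet → Prop} {u v : V}

theorem conn_root (v : V) : Conn N S v (root N S v) := (exists_leader S v).choose_spec.1

theorem id_root (v : V) : N.id (root N S v) = leader N S v := (exists_leader S v).choose_spec.2

theorem root_congr (h : Conn N S u v) : root N S u = root N S v :=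
  N.id_injective (by rw [id_root, id_root, leader_congr h])

theorem root_eq_self_iff : root N S u = u ↔ N.id u = leader N S u := by
  rw [← id_root, N.id_injective.eq_iff, eq_comm]

theorem root_eq_iff : root N S v = u ↔ Conn N S u v ∧ N.id u = leader N S u := by
  constructor
  · rintro rfl
    exact ⟨(conn_root v).symm, by rw [id_root, leader_congr (conn_root v)]⟩
  · rintro ⟨h, h'⟩
    rw [← root_congr h, root_eq_self_iff.2 h']

variable (N) in
/-- `g` is the unit flow along a path of length at most `D` from the root of `v` in `H` to `v`, all
of whose edges are in `S`. -/
def IsUnitFlow (H S : N.graph.edgeSet → Prop) (D : ℝ) (v : V) (g : N.graph.edgeSet → ℤ) : Prop :=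
  ∃ p : (edgeGraph N S).Walk (root N H v) v, p.IsPath ∧ (walkLen N.len p : ℝ) ≤ D ∧ g = walkFlow N p

variable {H : N.graph.edgeSet → Prop} {D : ℝ} {T : V → N.graph.edgeSet → ℤ}

theorem abs_le_of_isUnitFlow {g : N.graph.edgeSet → ℤ} (h : IsUnitFlow N H S D v g)
    (e : N.graph.edgeSet) : |g e| ≤ Fintype.card V := by
  obtain ⟨p, hp, -, rfl⟩ := h
  exact (abs_walkFlow_le p e).trans (by exact_mod_cast hp.length_lt.le)

theorem cost_le_of_isUnitFlow [Fintype N.graph.edgeSet] {g : N.graph.edgeSet → ℤ}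
    (h : IsUnitFlow N H S D v g) : ∑ e : N.graph.edgeSet, (N.len e : ℝ) * |(g e : ℝ)| ≤ D := by
  obtain ⟨p, -, hD, rfl⟩ := h
  refine le_trans ?_ hD
  exact_mod_cast sum_len_mul_abs_walkFlow_le p

open scoped Classical in
theorem netInflow_of_isUnitFlow {R : Type} [CommRing R] [Fintype N.graph.edgeSet]
    {g : N.graph.edgeSet → ℤ} (h : IsUnitFlow N H S D v g) (u : V) :
    netInflow N (fun e => (g e : R)) u =
      (if v = u then 1 else 0) - if root N H v = u then 1 else 0 := by
  obtain ⟨p, -, -, rfl⟩ := h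
  exact sum_walkFlow_mul p _ (fun x => if x = u then 1 else 0) fun e _ => rfl

open scoped Classical in
/-- A sum of unit flows moves all the demand of a component to its root. -/
theorem netInflow_treeFlow [Fintype N.graph.edgeSet] (hT : ∀ v, IsUnitFlow N H S D v (T v))
    (x : V → ℤ) (u : V) :
    netInflow N (fun e => ∑ v, T v e * x v) u =
      x u - if N.id u = leader N H u then ∑ v ∈ comp N H u, x v else 0 := by
  have h := netInflow_sum (N := N) (R := ℤ) Finset.univ T x u
  rw [h]
  have h' : ∀ v, netInflow N (T v) u = (if v = u then 1 else 0) - if root N H v = u then 1 else 0 :=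
    fun v => by simpa using netInflow_of_isUnitFlow (R := ℤ) (hT v) u
  simp only [h', mul_sub, Finset.sum_sub_distrib, mul_ite, mul_one, mul_zero, root_eq_iff]
  rw [Finset.sum_ite_eq' Finset.univ u, if_pos (Finset.mem_univ _)]
  congr 1
  split_ifs with hu
  · simp only [hu, and_true, comp, Finset.sum_filter]
  · simp [hu]

end Root

/-! ## Flows and potentials along the star merges -/

section Steps
variable {V : Type} [Fintype V] {N : Network V} [Fintype N.graph.edgeSet] {b K : ℕ}
  {H : N.graph.edgeSet → Prop} {j : ℕ}

/-- Edges inside the component contribute with both signs and cancel; the cut remains. -/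
theorem sum_comp_netInflow (S : N.graph.edgeSet → Prop) (g : N.graph.edgeSet → ℤ) (v : V) :
    ∑ u ∈ comp N S v, netInflow N g u = ∑ e ∈ inEdges N S v, g e - ∑ e ∈ outEdges N S v, g e := by
  classical
  unfold netInflow
  rw [Finset.sum_comm]
  simp only [← Finset.mul_sum, Finset.sum_sub_distrib, Finset.sum_ite_eq, inEdges, outEdges,
    Finset.sum_filter, mem_comp]
  rw [← Finset.sum_sub_distrib]
  refine Finset.sum_congr rfl fun e _ => ?_
  by_cases h1 : Conn N S v (N.tgt e) <;> by_cases h2 : Conn N S v (N.src e) <;> simp [h1, h2]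

/-- The flow on an edge picked in step `j` is determined by the demands and the flow on the edges
chosen later. -/
theorem flow_of_picked (hid : ∀ v, N.id v < K) {g : N.graph.edgeSet → ℤ} {g' : N.graph.edgeSet → ℤ}
    (hg' : ∀ e, ¬ chosen N b K H (j + 1) e → g' e = g e)
    (hg'' : ∀ e, chosen N b K H (j + 1) e → g' e = 0) {d : Bool} {e : N.graph.edgeSet}
    (he : Picked N b K H (chosen N b K H j) j d e) :
    g e = (if d then -1 else 1) * (∑ u ∈ comp N (chosen N b K H j) (endp N e d), netInflow N g u -
      (∑ e' ∈ outEdges N (chosen N b K H j) (endp N e d), -g' e' +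
        ∑ e' ∈ inEdges N (chosen N b K H j) (endp N e d), g' e')) := by
  classical
  set S := chosen N b K H j
  -- Among the edges leaving this tail, only `e` is chosen by the end of step `j`: edges chosen
  -- earlier are internal, a tail picks one edge, and an edge picked from its far side would make
  -- this component a head. All other flow across the cut is thus contained in `g'`.
  have key : ∀ (d' : Bool) (e' : N.graph.edgeSet), Conn N S (endp N e d) (endp N e' d') →
      ¬ Conn N S (endp N e d) (endp N e' !d') → g e' = g' e' + if e' = e then g e' else 0 := by
    intro d' e' h1 h2
    have hS : ¬ S e' := fun h => h2 (h1.trans (by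
      cases d'
      · exact (Conn.edge h).symm
      · exact Conn.edge h))
    by_cases hc : chosen N b K H (j + 1) e'
    · obtain h | ⟨d'', h⟩ := hc
      · exact absurd h hS
      · by_cases hd : d'' = d'
        · subst hd
          rw [← he.unique hid h h1, if_pos rfl, hg'' _ (Or.inr ⟨d, he⟩), zero_add]
        · have hd : d'' = !d' := by cases d' <;> cases d'' <;> simp_all
          subst hd
          have := h.1.2.2
          rw [Bool.not_not] at this
          exact absurd ((IsHead.congr h1).2 this) he.1.2.1
    · rw [hg' e' hc, if_neg, add_zero]
      rintro rfl
      exact hc (Or.inr ⟨d, he⟩)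
  rw [sum_comp_netInflow, Finset.sum_neg_distrib,
    Finset.sum_congr rfl (fun e' he' => key true e' (mem_outEdges.1 he').1 (mem_outEdges.1 he').2),
    Finset.sum_congr rfl (fun e' he' => key false e' (mem_inEdges.1 he').1 (mem_inEdges.1 he').2),
    Finset.sum_add_distrib, Finset.sum_add_distrib, Finset.sum_ite_eq', Finset.sum_ite_eq']
  have hn := he.1.not_conn
  cases d
  · simp only [endp, Bool.not_false] at hn
    simp [mem_outEdges, mem_inEdges, endp, hn, Conn.refl]
    ring
  · simp only [endp, Bool.not_true] at hn
    simp [mem_outEdges, mem_inEdges, endp, hn, Conn.refl]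
    ring

open scoped Classical in
/-- The amount by which the potential of the component of the end `d` of `e` has to be raised for `e`
to be tight, if this component picks `e`. -/
def shiftMessage (b K : ℕ) (H S : N.graph.edgeSet → Prop) (j : ℕ) (f : N.graph.edgeSet → ℤ)
    (π : V → ℤ) (d : Bool) (e : N.graph.edgeSet) : ℤ :=
  if Picked N b K H S j d e then π (endp N e !d) - π (endp N e d) - (if d then 1 else -1) * f e else 0

/-- The total shift of the component of `v`. -/
def shift (b K : ℕ) (H S : N.graph.edgeSet → Prop) (j : ℕ) (f : N.graph.edgeSet → ℤ) (π : V → ℤ)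
    (v : V) : ℤ :=
  ∑ e ∈ outEdges N S v, shiftMessage b K H S j f π true e +
    ∑ e ∈ inEdges N S v, shiftMessage b K H S j f π false e

/-- Node potentials with differences `f` along all edges chosen in the first `j` steps. -/
def pot (b K : ℕ) (H : N.graph.edgeSet → Prop) (f : N.graph.edgeSet → ℤ) : ℕ → V → ℤ
  | 0 => fun _ => 0
  | j + 1 => fun v => pot b K H f j v + shift b K H (chosen N b K H j) j f (pot b K H f j) v

variable {S : N.graph.edgeSet → Prop} {f : N.graph.edgeSet → ℤ} {π : V → ℤ}

theorem shift_congr {u v : V} (h : Conn N S u v) : shift b K H S j f π u = shift b K H S j f π v := by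
  rw [shift, outEdges_congr h, inEdges_congr h, shift]

theorem shift_of_isHead {v : V} (hv : IsHead N b S j v) : shift b K H S j f π v = 0 := by
  have key : ∀ d e, Conn N S v (endp N e d) → shiftMessage b K H S j f π d e = 0 := by
    intro d e h
    rw [shiftMessage, if_neg]
    intro hp
    exact hp.1.2.1 ((IsHead.congr h).1 hv)
  rw [shift, Finset.sum_eq_zero (fun e he => key true e (mem_outEdges.1 he).1),
    Finset.sum_eq_zero (fun e he => key false e (mem_inEdges.1 he).1), add_zero]

theorem shift_of_picked (hid : ∀ v, N.id v < K) {d : Bool} {e : N.graph.edgeSet}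
    (he : Picked N b K H S j d e) :
    shift b K H S j f π (endp N e d) = shiftMessage b K H S j f π d e := by
  have key : ∀ d' e', Conn N S (endp N e d) (endp N e' d') → ¬ (e' = e ∧ d' = d) →
      shiftMessage b K H S j f π d' e' = 0 := by
    intro d' e' h hne
    rw [shiftMessage, if_neg]
    intro hp
    obtain rfl := he.unique hid hp h
    exact hne ⟨rfl, hp.dir he⟩
  have hn := he.1.not_conn
  cases d
  · rw [shift, Finset.sum_eq_zero (fun e he => key true e (mem_outEdges.1 he).1 (by simp)),
      zero_add, Finset.sum_eq_single e (fun e' h hne => key false e' (mem_inEdges.1 h).1 (by simp [hne]))]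
    intro h
    exact absurd (mem_inEdges.2 ⟨Conn.refl _, hn⟩) h
  · rw [shift, Finset.sum_eq_zero (fun e he => key false e (mem_inEdges.1 he).1 (by simp)),
      add_zero, Finset.sum_eq_single e (fun e' h hne => key true e' (mem_outEdges.1 h).1 (by simp [hne]))]
    intro h
    exact absurd (mem_outEdges.2 ⟨Conn.refl _, hn⟩) h

theorem shift_eq (hid : ∀ v, N.id v < K) (v : V) : shift b K H S j f π v = 0 ∨
    ∃ d e, shift b K H S j f π v = π (endp N e !d) - π (endp N e d) - (if d then 1 else -1) * f e := by
  by_cases h : ∃ d e, Conn N S v (endp N e d) ∧ Picked N b K H S j d e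
  · obtain ⟨d, e, h, he⟩ := h
    refine Or.inr ⟨d, e, ?_⟩
    rw [shift_congr h, shift_of_picked hid he, shiftMessage, if_pos he]
  · push Not at h
    left
    have key : ∀ d e, Conn N S v (endp N e d) → shiftMessage b K H S j f π d e = 0 := by
      intro d e hc
      rw [shiftMessage, if_neg (h d e hc)]
    rw [shift, Finset.sum_eq_zero (fun e he => key true e (mem_outEdges.1 he).1),
      Finset.sum_eq_zero (fun e he => key false e (mem_inEdges.1 he).1), add_zero]

/-- Shifts are constant on components, so old differences survive. On a new edge the tail moves by
just the missing amount, while the head at the other end stays put. -/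
theorem pot_sub (hid : ∀ v, N.id v < K) (j : ℕ) (e : N.graph.edgeSet) (he : chosen N b K H j e) :
    pot b K H f j (N.tgt e) - pot b K H f j (N.src e) = f e := by
  induction j with
  | zero => exact he.elim
  | succ j ih =>
    simp only [pot]
    rcases he with he | ⟨d, he⟩
    · rw [shift_congr (Conn.edge he)]
      linarith [ih he]
    · have h1 := shift_of_picked (f := f) (π := pot b K H f j) hid he
      have h2 := shift_of_isHead (K := K) (H := H) (f := f) (π := pot b K H f j) he.1.2.2
      rw [shiftMessage, if_pos he] at h1
      cases d
      · simp only [endp, Bool.not_false] at h1 h2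
        rw [h1, h2, if_neg Bool.false_ne_true]; ring
      · simp only [endp, Bool.not_true] at h1 h2
        rw [h1, h2, if_pos trivial]; ring

/-- A shift is a difference of two potentials corrected by `f e`, so a bound `X` becomes at most `3
X + M`. The growth `4 ^ j` is affordable because it costs only two bits per step. -/
theorem abs_pot_le (hid : ∀ v, N.id v < K) {M : ℤ} (hM : 0 ≤ M) (hf : ∀ e, |f e| ≤ M) (j : ℕ) (v : V) :
    |pot b K H f j v| ≤ (4 ^ j - 1) * M := by
  induction j generalizing v with
  | zero => simp [pot]
  | succ j ih =>
    have h1 := abs_le.1 (ih v)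
    have hX : (0 : ℤ) ≤ (4 ^ j - 1) * M := (abs_nonneg _).trans (ih v)
    have hs : (4 ^ (j + 1) - 1) * M = 4 * ((4 ^ j - 1) * M) + 3 * M := by ring
    rw [hs]
    simp only [pot]
    rcases shift_eq (b := b) (H := H) (S := chosen N b K H j) (j := j) (f := f)
      (π := pot b K H f j) hid v with h | ⟨d, e, h⟩
    · rw [h, add_zero]
      linarith [ih v]
    · rw [h]
      have h2 := abs_le.1 (ih (endp N e d))
      have h3 := abs_le.1 (ih (endp N e !d))
      have h5 := abs_le.1 (hf e)
      rw [abs_le]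
      rcases d with _ | _ <;> simp only [Bool.false_eq_true, if_false, if_true] <;> constructor <;>
        linarith

end Steps

/-! ## Forest algorithms in the Minor-Aggregation model -/

theorem Inst.edgeCode_lt {c n w : ℕ} (I : Inst c n w) (e : I.E) :
    edgeCode I.N (n ^ c) e ≤ n ^ c * n ^ c := by
  have h1 := I.id_lt (I.N.src e)
  have h2 := I.id_lt (I.N.tgt e)
  unfold edgeCode
  have := Nat.mul_le_mul_right (n ^ c) (Nat.succ_le_of_lt h1)
  rw [Nat.succ_mul] at this
  omega

theorem Inst.card_E_le {c n w : ℕ} (I : Inst c n w) : Fintype.card I.E ≤ n ^ 2 := by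
  have h : Function.Injective fun e : I.E => (I.N.src e, I.N.tgt e) := fun e e' h =>
    edge_ext (Prod.ext_iff.1 h).1 (Prod.ext_iff.1 h).2
  have := Fintype.card_le_of_injective _ h
  rwa [Fintype.card_prod, I.card_eq, ← pow_two] at this

theorem abs_sum_le_card_mul {ι : Type} (s : Finset ι) {m : ℕ} (hs : s.card ≤ m) {M : ℤ}
    (hM : 0 ≤ M) {f : ι → ℤ} (hf : ∀ i ∈ s, |f i| ≤ M) : |∑ i ∈ s, f i| ≤ m * M :=
  calc |∑ i ∈ s, f i| ≤ ∑ i ∈ s, |f i| := Finset.abs_sum_le_sum_abs _ _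
    _ ≤ ∑ _i ∈ s, M := Finset.sum_le_sum hf
    _ = s.card * M := by rw [Finset.sum_const, nsmul_eq_mul]
    _ ≤ m * M := by gcongr

section
variable {c n w B k b : ℕ} {X Y : Type} {F : ∀ I : Inst c n w, I.V → X}
  {G : ∀ I : Inst c n w, I.E → Y}

theorem Inst.card_le {c n w : ℕ} (I : Inst c n w) (s : Finset I.V) : s.card ≤ n :=
  (Finset.card_le_univ s).trans I.card_eq.le

theorem Inst.card_edges_le {c n w : ℕ} (I : Inst c n w) (s : Finset I.E) : s.card ≤ n ^ 2 :=
  (Finset.card_le_univ s).trans I.card_E_le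

open scoped Classical in
/-- The picks of a step of star merges can be computed in five rounds. -/
theorem Comp.picked (h : Comp B k F G) (hB : 2 * (n ^ c * n ^ c + n + 1) < 2 ^ B)
    (idX : X → ℕ) (hidX : ∀ I v, idX (F I v) = I.N.id v)
    (code : Y → ℕ) (hcode : ∀ I e, code (G I e) = edgeCode I.N (n ^ c) e)
    (H S : Y → Prop) (j : ℕ) :
    Comp B (k + 5) F (fun I e => (G I e,
      Picked I.N b (n ^ c) (fun e => H (G I e)) (fun e => S (G I e)) j true e,
      Picked I.N b (n ^ c) (fun e => H (G I e)) (fun e => S (G I e)) j false e)) := by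
  have hid : ∀ I v, idX (F I v) < 2 ^ B := fun I v => by
    have h1 := I.id_lt v
    have h2 : n ^ c ≤ n ^ c * n ^ c := Nat.le_mul_self _
    rw [hidX]; omega
  -- One round each for the leader, the size, the head status told to the edges, the best candidate,
  -- and the best code told to the edges.
  have h1 := h.nodeMax S idX hid
  have h2 := h1.nodeSum S (fun _ => 1) (fun I v => by
    have hc : ((comp I.N (fun e => S (G I e)) v).card : ℤ) ≤ n := by exact_mod_cast I.card_le _
    have hB' : (2 : ℤ) * (n ^ c * n ^ c + n + 1) < 2 ^ B := by exact_mod_cast hB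
    have hp : (0 : ℤ) ≤ (n : ℤ) ^ c * n ^ c := by positivity
    rw [Finset.sum_const, nsmul_eq_mul, mul_one, abs_of_nonneg (by positivity)]
    linarith)
  have h3 := h2.edgeLearn (fun x => if headRule b j x.1.2 x.2.toNat then 1 else 0) (fun I v => by
    have hB' : (2 : ℤ) * (n ^ c * n ^ c + n + 1) < 2 ^ B := by exact_mod_cast hB
    have hp : (0 : ℤ) ≤ (n : ℤ) ^ c * n ^ c := by positivity
    have hp' : (0 : ℤ) ≤ n := by positivity
    have hc : (0 : ℤ) < n := by
      have : 0 < Fintype.card I.V := Fintype.card_pos_iff.2 ⟨v⟩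
      rw [I.card_eq] at this
      exact_mod_cast this
    split_ifs <;> norm_num
    all_goals linarith)
  have hhead : ∀ (I : Inst c n w) v, ((if headRule b j
      ((comp I.N (fun e => S (G I e)) v).sup fun u => idX (F I u))
      (∑ _u ∈ comp I.N (fun e => S (G I e)) v, (1 : ℤ)).toNat then (1 : ℤ) else 0) = 1) =
      IsHead I.N b (fun e => S (G I e)) j v := by
    intro I v
    simp only [hidX, Finset.sum_const, nsmul_eq_mul, mul_one, Int.toNat_natCast]
    rw [IsHead, leader]
    exact propext ⟨fun h => by by_contra hn; rw [if_neg hn] at h; exact zero_ne_one h,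
      fun h => if_pos h⟩
  let cc : Bool → Y × ℤ × ℤ → ℕ := fun d y =>
    if H y.1 ∧ ¬ ((if d then y.2.1 else y.2.2) = 1) ∧ (if d then y.2.2 else y.2.1) = 1
    then code y.1 else 0
  have hcc : ∀ (I : Inst c n w) d e, cc d (G I e,
      (if headRule b j ((comp I.N (fun e => S (G I e)) (I.N.src e)).sup fun u => idX (F I u))
        (∑ _u ∈ comp I.N (fun e => S (G I e)) (I.N.src e), (1 : ℤ)).toNat then (1 : ℤ) else 0),
      (if headRule b j ((comp I.N (fun e => S (G I e)) (I.N.tgt e)).sup fun u => idX (F I u))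
        (∑ _u ∈ comp I.N (fun e => S (G I e)) (I.N.tgt e), (1 : ℤ)).toNat then (1 : ℤ) else 0)) =
      candidateCode I.N b (n ^ c) (fun e => H (G I e)) (fun e => S (G I e)) j d e := by
    intro I d e
    unfold candidateCode IsCandidate
    cases d <;> simp only [cc, hcode, endp, Bool.not_true, Bool.not_false, if_true, if_false, hhead,
      Bool.false_eq_true]
  have hlt : ∀ (I : Inst c n w) S' d e, candidateCode I.N b (n ^ c) (fun e => H (G I e)) S' j d e <
      n ^ c * n ^ c + 1 := by
    intro I S' d e
    have := I.edgeCode_lt e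
    unfold candidateCode
    split_ifs <;> omega
  have h4 := h3.boundaryMax (fun y => S y.1) (fun y => (cc true y, cc false y)) (fun I e => by
    simp only [hcc]
    have h1 := hlt I (fun e => S (G I e)) true e
    have h2 := hlt I (fun e => S (G I e)) false e
    constructor <;> omega)
  simp only [hcc] at h4
  have hbest : ∀ (I : Inst c n w) v,
      max ((outEdges I.N (fun e => S (G I e)) v).sup fun e =>
        candidateCode I.N b (n ^ c) (fun e => H (G I e)) (fun e => S (G I e)) j true e)
        ((inEdges I.N (fun e => S (G I e)) v).sup fun e =>
        candidateCode I.N b (n ^ c) (fun e => H (G I e)) (fun e => S (G I e)) j false e) =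
      best I.N b (n ^ c) (fun e => H (G I e)) (fun e => S (G I e)) j v := fun I v => rfl
  simp only [hbest] at h4
  have hble : ∀ (I : Inst c n w) v,
      best I.N b (n ^ c) (fun e => H (G I e)) (fun e => S (G I e)) j v ≤ n ^ c * n ^ c := by
    intro I v
    refine max_le ?_ ?_ <;> exact Finset.sup_le fun e _ => Nat.lt_succ_iff.1 (hlt I _ _ e)
  have h5 := h4.edgeLearn (fun x => (x.2 : ℤ)) (fun I v => by
    have := hble I v
    rw [abs_of_nonneg (by positivity)]
    exact_mod_cast (by omega))
  refine h5.map (fun x => x.1.1.1) (fun y => (y.1.1,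
    (H y.1.1 ∧ ¬ (y.1.2.1 = 1) ∧ y.1.2.2 = 1) ∧ y.2.1 = code y.1.1,
    (H y.1.1 ∧ ¬ (y.1.2.2 = 1) ∧ y.1.2.1 = 1) ∧ y.2.2 = code y.1.1)) (fun I v => rfl) (fun I e => ?_)
  simp only [hhead, hcode, Picked, IsCandidate, endp, Bool.not_true, Bool.not_false, Nat.cast_inj]

/-- The edges chosen in the first `j` steps can be computed in `5 * j` rounds. -/
theorem Comp.chosen (h : Comp B k F G) (hB : 2 * (n ^ c * n ^ c + n + 1) < 2 ^ B)
    (idX : X → ℕ) (hidX : ∀ I v, idX (F I v) = I.N.id v)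
    (code : Y → ℕ) (hcode : ∀ I e, code (G I e) = edgeCode I.N (n ^ c) e)
    (H : Y → Prop) (j : ℕ) :
    Comp B (k + 5 * j) F (fun I e => (G I e,
      MinorAgg.chosen I.N b (n ^ c) (fun e => H (G I e)) j e)) := by
  induction j with
  | zero => exact h.map id (fun y => (y, False)) (fun _ _ => rfl) (fun _ _ => rfl)
  | succ j ih =>
    refine (ih.picked (b := b) hB idX hidX (fun y => code y.1) hcode (fun y => H y.1) (fun y => y.2) j).map
      id (fun y => (y.1.1, y.1.2 ∨ (y.2.1 ∨ y.2.2))) (fun _ _ => rfl) (fun I e => ?_)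
    simp only [MinorAgg.chosen, Bool.exists_bool, or_comm]

/-- The edges chosen in the first `j` steps and the picks of step `j`. -/
theorem Comp.chosenPicked (h : Comp B k F G) (hB : 2 * (n ^ c * n ^ c + n + 1) < 2 ^ B)
    (idX : X → ℕ) (hidX : ∀ I v, idX (F I v) = I.N.id v)
    (code : Y → ℕ) (hcode : ∀ I e, code (G I e) = edgeCode I.N (n ^ c) e)
    (H : Y → Prop) {j J : ℕ} (hj : j ≤ J) :
    Comp B (k + 5 * J + 5) F (fun I e => (G I e,
      MinorAgg.chosen I.N b (n ^ c) (fun e => H (G I e)) j e,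
      Picked I.N b (n ^ c) (fun e => H (G I e))
        (MinorAgg.chosen I.N b (n ^ c) (fun e => H (G I e)) j) j true e,
      Picked I.N b (n ^ c) (fun e => H (G I e))
        (MinorAgg.chosen I.N b (n ^ c) (fun e => H (G I e)) j) j false e)) :=
  (((h.chosen (b := b) hB idX hidX code hcode H j).picked (b := b) hB idX hidX (fun y => code y.1)
    hcode (fun y => H y.1) (fun y => y.2) j).map id (fun y => (y.1.1, y.1.2, y.2))
    (fun _ _ => rfl) (fun _ _ => rfl)).mono (by omega)

open scoped Classical in
/-- Routing the demands `x` to the roots of the components of `H`: a flow `g` supported on the chosen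
edges can be computed from its net inflows. -/
theorem Comp.treeFlow (h : Comp B k F G) (hB : 2 * (n ^ c * n ^ c + n + 1) < 2 ^ B)
    (idX : X → ℕ) (hidX : ∀ I v, idX (F I v) = I.N.id v)
    (code : Y → ℕ) (hcode : ∀ I e, code (G I e) = edgeCode I.N (n ^ c) e)
    (H : Y → Prop) (x : X → ℤ) {M : ℤ} (hM : 0 ≤ M) (hMB : 10 * n ^ 2 * M < 2 ^ B)
    (hx : ∀ I v, |x (F I v)| ≤ M) (J : ℕ) (g : ∀ I : Inst c n w, I.E → ℤ)
    (hg : ∀ I e, ¬ MinorAgg.chosen I.N b (n ^ c) (fun e => H (G I e)) J e → g I e = 0)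
    (hgM : ∀ I e, |g I e| ≤ M)
    (hgx : ∀ I v, netInflow I.N (g I) v = x (F I v) -
      if I.N.id v = leader I.N (fun e => H (G I e)) v then
        ∑ u ∈ comp I.N (fun e => H (G I e)) v, x (F I u) else 0) :
    Comp B (k + 2 + J * (5 * J + 8)) F (fun I e => (G I e, g I e)) := by
  have hsq : (n : ℤ) ≤ (n : ℤ) ^ 2 := by exact_mod_cast Nat.le_self_pow two_ne_zero n
  have hnM : (n : ℤ) * M ≤ (n : ℤ) ^ 2 * M := mul_le_mul_of_nonneg_right hsq hM
  have hn0 : (0 : ℤ) ≤ n * M := by positivity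
  have hsum : ∀ (I : Inst c n w) S v, |∑ u ∈ comp I.N S v, x (F I u)| ≤ n * M := fun I S v =>
    abs_sum_le_card_mul _ (I.card_le _) hM fun u _ => hx I u
  have hid : ∀ I v, idX (F I v) < 2 ^ B := fun I v => by
    have h1 := I.id_lt v
    have h2 : n ^ c ≤ n ^ c * n ^ c := Nat.le_mul_self _
    rw [hidX]; omega
  have h1 := (h.nodeMax H idX hid).nodeSum H (fun y => x y.1) (fun I v => by
    have := hsum I (fun e => H (G I e)) v
    linarith)
  -- Off the edges chosen in `J` steps the flow vanishes, so zero everywhere is a correct start. The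
  -- net inflows follow from the total and the leader of the component.
  have h2 : Comp B (k + 2) (fun I v => (F I v, netInflow I.N (g I) v))
      (fun I e => (G I e, if MinorAgg.chosen I.N b (n ^ c) (fun e => H (G I e)) (J - 0) e
        then 0 else g I e)) := by
    refine h1.map (fun y => (y.1.1, x y.1.1 - if idX y.1.1 = y.1.2 then y.2 else 0))
      (fun y => (y, 0)) (fun I v => ?_) (fun I e => ?_)
    · simp only [hgx, hidX]; rfl
    · refine Prod.ext rfl ?_
      simp only [Nat.sub_zero]
      split_ifs with h
      · rfl
      · exact hg I e h
  -- The merges are undone from the last to the first: after `t` of them the flow is known outside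
  -- `chosen (J - t)`. Each recomputes the earlier merges from scratch, which makes the number of
  -- rounds quadratic in `J`.
  have key : ∀ t ≤ J, Comp B (k + 2 + t * (5 * J + 8)) (fun I v => (F I v, netInflow I.N (g I) v))
      (fun I e => (G I e, if MinorAgg.chosen I.N b (n ^ c) (fun e => H (G I e)) (J - t) e
        then 0 else g I e)) := by
    intro t
    induction t with
    | zero => intro _; simpa using h2
    | succ t ih =>
      intro ht
      obtain ⟨j, rfl⟩ : ∃ j, J = j + (t + 1) := ⟨J - (t + 1), by omega⟩
      have e1 : j + (t + 1) - t = j + 1 := by omega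
      have e2 : j + (t + 1) - (t + 1) = j := by omega
      have h3 := ih (by omega)
      rw [e1] at h3
      have h4 := h3.chosenPicked (b := b) hB (fun y => idX y.1) hidX (fun y => code y.1) hcode
        (fun y => H y.1) (j := j) (J := j + (t + 1)) (by omega)
      have hnet : ∀ I v, |netInflow I.N (g I) v| ≤ M + n * M := by
        intro I v
        rw [hgx]
        refine (abs_sub _ _).trans ?_
        refine add_le_add (hx I v) ?_
        split_ifs
        · exact hsum I _ v
        · simpa using hn0
      have hM0 : (0 : ℤ) ≤ M + n * M := by positivity
      have hn1 : ∀ (I : Inst c n w), I.V → (1 : ℤ) ≤ n := fun I v => by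
        have : 0 < Fintype.card I.V := Fintype.card_pos_iff.2 ⟨v⟩
        rw [I.card_eq] at this
        exact_mod_cast this
      have hd : ∀ (I : Inst c n w) S v, |∑ u ∈ comp I.N S v, netInflow I.N (g I) u| ≤
          2 * (n ^ 2 * M) := by
        intro I S v
        refine (abs_sum_le_card_mul _ (I.card_le _) hM0 fun u _ => hnet I u).trans ?_
        have h' : (n : ℤ) * (M + n * M) = n * M + n ^ 2 * M := by ring
        linarith
      have h5 := h4.nodeSum (fun y => y.2.1) (fun y => y.2) (fun I v => by
        have := hd I (fun e => MinorAgg.chosen I.N b (n ^ c) (fun e => H (G I e)) j e) v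
        have : (0 : ℤ) ≤ n ^ 2 * M := by positivity
        linarith)
      have hgc : ∀ (I : Inst c n w) (j : ℕ) (e : I.E),
          |if MinorAgg.chosen I.N b (n ^ c) (fun e => H (G I e)) j e then 0 else g I e| ≤ M := by
        intro I j e
        split_ifs
        · simpa using hM
        · exact hgM I e
      have hout : ∀ (I : Inst c n w) (s : Finset I.E), |∑ e ∈ s,
          -(if MinorAgg.chosen I.N b (n ^ c) (fun e => H (G I e)) (j + 1) e then 0 else g I e)| ≤
          n ^ 2 * M := by
        intro I s
        have := abs_sum_le_card_mul s (I.card_edges_le s) hM (f := fun e =>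
          -(if MinorAgg.chosen I.N b (n ^ c) (fun e => H (G I e)) (j + 1) e then 0 else g I e))
          fun e _ => by rw [abs_neg]; exact hgc I _ e
        exact_mod_cast this
      have hin : ∀ (I : Inst c n w) (s : Finset I.E), |∑ e ∈ s,
          (if MinorAgg.chosen I.N b (n ^ c) (fun e => H (G I e)) (j + 1) e then 0 else g I e)| ≤
          n ^ 2 * M := by
        intro I s
        have := abs_sum_le_card_mul s (I.card_edges_le s) hM fun e _ => hgc I (j + 1) e
        exact_mod_cast this
      have hp : (0 : ℤ) ≤ n ^ 2 * M := by positivity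
      have h6 := h5.boundarySum (fun y => y.2.1) (fun y => (-y.1.2, y.1.2)) (fun I v => by
        have h7 := (abs_add_le _ _).trans (add_le_add (hout I (outEdges I.N (fun e =>
          MinorAgg.chosen I.N b (n ^ c) (fun e => H (G I e)) j e) v)) (hin I (inEdges I.N (fun e =>
          MinorAgg.chosen I.N b (n ^ c) (fun e => H (G I e)) j e) v)))
        linarith)
      have h7 := h6.edgeLearn (fun y => y.1.2 - y.2) (fun I v => by
        have h7 := (abs_add_le _ _).trans (add_le_add (hout I (outEdges I.N (fun e =>
          MinorAgg.chosen I.N b (n ^ c) (fun e => H (G I e)) j e) v)) (hin I (inEdges I.N (fun e =>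
          MinorAgg.chosen I.N b (n ^ c) (fun e => H (G I e)) j e) v)))
        have h8 := (abs_sub _ _).trans (add_le_add
          (hd I (fun e => MinorAgg.chosen I.N b (n ^ c) (fun e => H (G I e)) j e) v) h7)
        rcases hp.eq_or_lt with h0 | h0
        · have : (0 : ℤ) < 2 ^ B := by positivity
          linarith
        · linarith)
      refine (h7.map (fun y => y.1.1) (fun y => (y.1.1.1, if y.1.2.1 then 0 else
        if y.1.2.2.1 then -y.2.1 else if y.1.2.2.2 then y.2.2 else y.1.1.2)) (fun _ _ => rfl)
        (fun I e => ?_)).mono ?_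
      · refine Prod.ext rfl ?_
        simp only [e2]
        split_ifs with c1 c2 c3 c4
        · rfl
        · rw [flow_of_picked I.id_lt (g := g I) (g' := fun e =>
            if MinorAgg.chosen I.N b (n ^ c) (fun e => H (G I e)) (j + 1) e then 0 else g I e)
            (fun e he => if_neg he) (fun e he => if_pos he) c2, if_pos rfl, neg_one_mul]
          rfl
        · rw [flow_of_picked I.id_lt (g := g I) (g' := fun e =>
            if MinorAgg.chosen I.N b (n ^ c) (fun e => H (G I e)) (j + 1) e then 0 else g I e)
            (fun e he => if_neg he) (fun e he => if_pos he) c3, if_neg Bool.false_ne_true, one_mul]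
          rfl
        · obtain c4 | ⟨_ | _, c4⟩ := c4
          · exact absurd c4 c1
          · exact absurd c4 c3
          · exact absurd c4 c2
        · rfl
      · rw [Nat.succ_mul t]; omega
  refine (key J le_rfl).map Prod.fst id (fun _ _ => rfl) (fun I e => ?_)
  simp [MinorAgg.chosen]

/-- Potentials with differences `f` along the chosen edges. -/
theorem Comp.pot (h : Comp B k F G) (hB : 2 * (n ^ c * n ^ c + n + 1) < 2 ^ B)
    (idX : X → ℕ) (hidX : ∀ I v, idX (F I v) = I.N.id v)
    (code : Y → ℕ) (hcode : ∀ I e, code (G I e) = edgeCode I.N (n ^ c) e)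
    (H : Y → Prop) (f : Y → ℤ) {M : ℤ} (hM : 0 ≤ M) {J : ℕ} (hMB : 8 * 4 ^ J * M < 2 ^ B)
    (hf : ∀ I e, |f (G I e)| ≤ M) (j : ℕ) (hj : j ≤ J) :
    Comp B (k + j * (5 * J + 7)) (fun I v => (F I v,
      MinorAgg.pot b (n ^ c) (fun e => H (G I e)) (fun e => f (G I e)) j v)) G := by
  classical
  induction j with
  | zero =>
    exact (h.map (fun x => (x, 0)) id (fun _ _ => rfl) (fun _ _ => rfl)).mono (Nat.le_add_right _ _)
  | succ j ih =>
    have hpot : ∀ (I : Inst c n w) i v, i ≤ J →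
        |MinorAgg.pot b (n ^ c) (fun e => H (G I e)) (fun e => f (G I e)) i v| ≤ (4 ^ J - 1) * M := by
      intro I i v hi
      refine (abs_pot_le I.id_lt hM (hf I) i v).trans ?_
      gcongr
      norm_num
    have hp : (0 : ℤ) ≤ 4 ^ J * M := by positivity
    have h0 : (0 : ℤ) < 2 ^ B := by positivity
    have h1 := (ih (by omega)).chosenPicked (b := b) hB (fun y => idX y.1) hidX code hcode H (j := j)
      (J := J) (by omega)
    have h2 := h1.edgeLearn (fun y => y.2) (fun I v => by
      have := hpot I j v (by omega)
      linarith)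
    have hsh : ∀ (I : Inst c n w) v,
        ∑ e ∈ outEdges I.N (fun e => MinorAgg.chosen I.N b (n ^ c) (fun e => H (G I e)) j e) v,
        (if Picked I.N b (n ^ c) (fun e => H (G I e))
          (MinorAgg.chosen I.N b (n ^ c) (fun e => H (G I e)) j) j true e then
          MinorAgg.pot b (n ^ c) (fun e => H (G I e)) (fun e => f (G I e)) j (I.N.tgt e) -
          MinorAgg.pot b (n ^ c) (fun e => H (G I e)) (fun e => f (G I e)) j (I.N.src e) - f (G I e)
          else 0) +
        ∑ e ∈ inEdges I.N (fun e => MinorAgg.chosen I.N b (n ^ c) (fun e => H (G I e)) j e) v,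
        (if Picked I.N b (n ^ c) (fun e => H (G I e))
          (MinorAgg.chosen I.N b (n ^ c) (fun e => H (G I e)) j) j false e then
          MinorAgg.pot b (n ^ c) (fun e => H (G I e)) (fun e => f (G I e)) j (I.N.src e) -
          MinorAgg.pot b (n ^ c) (fun e => H (G I e)) (fun e => f (G I e)) j (I.N.tgt e) + f (G I e)
          else 0) = shift b (n ^ c) (fun e => H (G I e))
          (MinorAgg.chosen I.N b (n ^ c) (fun e => H (G I e)) j) j (fun e => f (G I e))
          (MinorAgg.pot b (n ^ c) (fun e => H (G I e)) (fun e => f (G I e)) j) v := by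
      intro I v
      unfold shift shiftMessage
      simp only [endp, Bool.not_true, Bool.not_false, if_true, Bool.false_eq_true, if_false, one_mul,
        neg_one_mul, sub_neg_eq_add]
    have h3 := h2.boundarySum (fun y => y.1.2.1) (fun y =>
      (if y.1.2.2.1 then y.2.2 - y.2.1 - f y.1.1 else 0,
        if y.1.2.2.2 then y.2.1 - y.2.2 + f y.1.1 else 0)) (fun I v => by
      simp only [hsh]
      have e1 := hpot I (j + 1) v hj
      have e2 := hpot I j v (by omega)
      simp only [MinorAgg.pot] at e1
      rw [abs_le] at e1 e2
      -- The shift is the difference of two consecutive potentials, both of which are bounded.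
      have e3 : |shift b (n ^ c) (fun e => H (G I e))
          (MinorAgg.chosen I.N b (n ^ c) (fun e => H (G I e)) j) j (fun e => f (G I e))
          (MinorAgg.pot b (n ^ c) (fun e => H (G I e)) (fun e => f (G I e)) j) v| ≤
          2 * ((4 ^ J - 1) * M) := by
        rw [abs_le]; constructor <;> linarith [e1.1, e1.2, e2.1, e2.2]
      linarith)
    simp only [hsh] at h3
    refine (h3.map (fun y => (y.1.1, y.1.2 + y.2)) (fun y => y.1.1) (fun _ _ => rfl)
      (fun _ _ => rfl)).mono ?_
    rw [Nat.succ_mul j]; omega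

open scoped Classical in
/-- The value of `m` at the root of the component of every node. -/
theorem Comp.atRoot (h : Comp B k F G) (hB : 2 * (n ^ c * n ^ c + n + 1) < 2 ^ B)
    (idX : X → ℕ) (hidX : ∀ I v, idX (F I v) = I.N.id v) (H : Y → Prop) (m : X → ℤ)
    (hm : ∀ I v, 2 * |m (F I v)| < 2 ^ B) :
    Comp B (k + 2) (fun I v => (F I v, m (F I (root I.N (fun e => H (G I e)) v)))) G := by
  have hid : ∀ I v, idX (F I v) < 2 ^ B := fun I v => by
    have h1 := I.id_lt v
    have h2 : n ^ c ≤ n ^ c * n ^ c := Nat.le_mul_self _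
    rw [hidX]; omega
  -- Only the root carries the identifier of the leader, so the sum over a component of `m`, masked
  -- in this way, broadcasts the value at the root.
  have hsum : ∀ (I : Inst c n w) v, ∑ u ∈ comp I.N (fun e => H (G I e)) v,
      (if idX (F I u) = (comp I.N (fun e => H (G I e)) u).sup (fun u => idX (F I u))
        then m (F I u) else 0) = m (F I (root I.N (fun e => H (G I e)) v)) := by
    intro I v
    simp only [hidX]
    rw [Finset.sum_eq_single (root I.N (fun e => H (G I e)) v)]
    · rw [if_pos]
      exact (id_root v).trans (leader_congr (conn_root v))
    · intro u hu hne
      rw [if_neg]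
      intro hu'
      exact hne (root_eq_iff.2 ⟨(mem_comp.1 hu).symm, hu'⟩).symm
    · intro hn
      exact absurd (mem_comp.2 (conn_root v)) hn
  have h1 := (h.nodeMax H idX hid).nodeSum H (fun y => if idX y.1 = y.2 then m y.1 else 0)
    (fun I v => by simp only [hsum]; exact hm I _)
  simp only [hsum] at h1
  exact h1.map (fun y => (y.1.1, y.2)) id (fun _ _ => rfl) (fun _ _ => rfl)

end

/-! ## The layers of the routing -/

/-- The number of edge sets in a layer. -/
def numSets (c n : ℕ) : ℕ := c * (Nat.log 2 n + 1) + 1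

/-- The number of bits of the identifiers. -/
def idBits (c n : ℕ) : ℕ := c * (Nat.log 2 n + 1)

/-- The number of layers. -/
def numLayers (c n : ℕ) : ℕ := (c + 2) * (Nat.log 2 n + 1)

/-- The common denominator of the weights of layer `i`. -/
def rho (n i : ℕ) : ℕ := ⌊scaleD n (i - 1)⌋₊

/-- From its knowledge, a node can tell whether `D_i` is a scale. -/
def KnowsScale (c n i : ℕ) (x : NodeKnowledge) : Prop := ∃ t < numSets c n, x.cluster i t ≠ none

/-- The truncated integer potential of a node in clustering `t` of scale `i`. -/
def psi (n i t : ℕ) (x : NodeKnowledge) : ℕ :=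
  (x.cluster i t).elim 0 fun q => ⌊q.potential⌋₊ - rho n i

/-- The cumulative truncated potentials, up to `rho n i`. -/
def cumPsi (n i t : ℕ) (x : NodeKnowledge) : ℕ := min (rho n i) (∑ s ∈ Finset.range t, psi n i s x)

open scoped Classical in
/-- The weight of a node in set `t` of layer `i`. -/
def weight (c n i t : ℕ) (x : NodeKnowledge) : ℕ :=
  if KnowsScale c n i x then cumPsi n i (t + 1) x - cumPsi n i t x
  else if t = 0 then rho n i else 0

open scoped Classical in
/-- What a node tells its edges about set `t` of layer `i`: the identifier of its parent plus one, `0`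
if it has no parent and `-1` if the layer has no clusters. -/
def linkMessage (c n i t : ℕ) (x : NodeKnowledge) : ℤ :=
  if KnowsScale c n i x then
    (x.cluster i t).elim 0 fun q => if q.centerId = x.id then 0 else (q.parentId : ℤ) + 1
  else -1

/-- Whether an edge belongs to a set of layer `i`, from the messages of its ends. -/
def IsLayerEdge (i : ℕ) (x : EdgeKnowledge) (p q : ℤ) : Prop :=
  if i = 0 then x.len = 0 else p = -1 ∨ p = (x.tgtId : ℤ) + 1 ∨ q = (x.srcId : ℤ) + 1

/-- The edges of set `t` of layer `i`: the edges of length zero for `i = 0`, the edges of the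
cluster trees of clustering `t` if `D_i` is a scale, and all edges otherwise. -/
def layer {V : Type} [Fintype V] {N : Network V} (S : DistanceStructures N) (c n i t : ℕ)
    (e : N.graph.edgeSet) : Prop :=
  IsLayerEdge i (edgeKnowledge N e) (linkMessage c n i t (nodeKnowledge S (N.src e)))
    (linkMessage c n i t (nodeKnowledge S (N.tgt e)))

/-- The parameters of a network and its distance structures are within the bounds. -/
structure Admissible {V : Type} [Fintype V] {N : Network V} (S : DistanceStructures N) (c n : ℕ) :
    Prop where
  card_eq : Fintype.card V = n
  two_le : 2 ≤ n
  len_le : ∀ e ∈ N.graph.edgeSet, N.len e ≤ n ^ c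
  id_lt : ∀ v, N.id v < n ^ c
  num_le : ∀ i hi, (S i hi).numClusterings ≤ c * (Nat.log 2 n + 1)

theorem one_le_tau {n : ℕ} (hn : 2 ≤ n) : 1 ≤ tau n := by
  refine one_le_pow₀ ?_
  rw [Real.le_logb_iff_rpow_le (by norm_num) (by positivity), Real.rpow_one]
  exact_mod_cast hn

theorem one_le_scaleD {n : ℕ} (hn : 2 ≤ n) (i : ℕ) : 1 ≤ scaleD n i :=
  one_le_pow₀ (by linarith [one_le_tau hn])

theorem scaleD_mono {n : ℕ} (hn : 2 ≤ n) {i j : ℕ} (h : i ≤ j) : scaleD n i ≤ scaleD n j :=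
  pow_le_pow_right₀ (by linarith [one_le_tau hn]) h

theorem scaleD_succ (n i : ℕ) : scaleD n (i + 1) = scaleD n i * (8 * tau n) := pow_succ _ _

theorem rho_pos {n : ℕ} (hn : 2 ≤ n) (i : ℕ) : 0 < rho n i := by
  rw [rho, Nat.floor_pos]; exact one_le_scaleD hn _

theorem rho_mono {n : ℕ} (hn : 2 ≤ n) {i j : ℕ} (h : i ≤ j) : rho n i ≤ rho n j :=
  Nat.floor_le_floor (scaleD_mono hn (by omega))

theorem rho_le {n : ℕ} (hn : 2 ≤ n) (i : ℕ) : (rho n i : ℝ) ≤ scaleD n (i - 1) :=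
  Nat.floor_le (by linarith [one_le_scaleD hn (i - 1)])

theorem lt_rho_add_one (n i : ℕ) : scaleD n (i - 1) < rho n i + 1 := Nat.lt_floor_add_one _

theorem exists_edge_of_adj {V : Type} (N : Network V) {u v : V} (h : N.graph.Adj u v) :
    ∃ (e : N.graph.edgeSet) (d : Bool), endp N e d = u ∧ (endp N e !d) = v ∧ (e : Sym2 V) = s(u, v) := by
  let e : N.graph.edgeSet := ⟨s(u, v), h⟩
  have h' : s(u, v) = s(N.src e, N.tgt e) := N.ends e
  rw [Sym2.eq_iff] at h'
  rcases h' with ⟨h1, h2⟩ | ⟨h1, h2⟩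
  · exact ⟨e, true, h1.symm, h2.symm, rfl⟩
  · exact ⟨e, false, h1.symm, h2.symm, rfl⟩

theorem adj_endp {V : Type} (N : Network V) (e : N.graph.edgeSet) (d : Bool) :
    N.graph.Adj (endp N e d) (endp N e !d) := by
  have h : N.graph.Adj (N.src e) (N.tgt e) := by
    have := e.2
    rwa [N.ends e, SimpleGraph.mem_edgeSet] at this
  cases d
  · exact h.symm
  · exact h

theorem coe_eq_endp {V : Type} (N : Network V) (e : N.graph.edgeSet) (d : Bool) :
    (e : Sym2 V) = s(endp N e d, endp N e !d) := by
  cases d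
  · rw [N.ends e]; exact Sym2.eq_swap
  · exact N.ends e

theorem edge_ext_endp {V : Type} {N : Network V} {e e' : N.graph.edgeSet} {d d' : Bool}
    (h : endp N e d = endp N e' d') (h' : (endp N e !d) = endp N e' !d') : e = e' :=
  Subtype.ext (by rw [coe_eq_endp N e d, coe_eq_endp N e' d', h, h'])

theorem wdist_self {V : Type} (G : SimpleGraph V) (len : Sym2 V → ℕ) (v : V) :
    wdist G len v v = 0 :=
  le_antisymm ((iInf_le _ SimpleGraph.Walk.nil).trans (by simp [walkLen])) zero_le

section Knowledge
variable {V : Type} {N : Network V} {D r : ℝ} (S : DistanceStructure N D r) {t : ℕ} {v : V}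

theorem knowledge_eq_some {ht : t < S.numClusterings} {K : Cluster N D r}
    (hK : K ∈ S.clustering ⟨t, ht⟩) (hv : v ∈ K.verts) :
    S.knowledge t v = some ⟨N.id K.center, N.id (K.parent v), K.potential v⟩ := by
  have h : ∃ ht : t < S.numClusterings, ∃ K ∈ S.clustering ⟨t, ht⟩, v ∈ K.verts := ⟨ht, K, hK, hv⟩
  have hc : h.choose_spec.choose = K := by
    by_contra hne
    exact Set.disjoint_left.1 (S.disjoint _ h.choose_spec.choose_spec.1 hK hne)
      h.choose_spec.choose_spec.2 hv
  rw [DistanceStructure.knowledge, dif_pos h, hc]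

theorem knowledge_eq_none (h : ∀ ht, ∀ K ∈ S.clustering ⟨t, ht⟩, v ∉ K.verts) :
    S.knowledge t v = none := by
  rw [DistanceStructure.knowledge, dif_neg]
  rintro ⟨ht, K, hK, hv⟩
  exact h ht K hK hv

end Knowledge

/-! ### Cluster trees as edge sets of the layers -/

section Layer
variable {V : Type} [Fintype V] {N : Network V} {S : DistanceStructures N} {c n i t : ℕ}

/-- At a scale every node is clustered at least once, by the cluster covering the ball around it; at
other indices nothing is stored. So the node needs no knowledge of the largest edge length. -/
theorem knowsScale_iff (hS : Admissible S c n) (v : V) :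
    KnowsScale c n i (nodeKnowledge S v) ↔ N.IsScale i := by
  constructor
  · rintro ⟨t, -, h⟩
    by_contra hi
    simp [nodeKnowledge, hi] at h
  · intro hi
    obtain ⟨t, K, hK, hv⟩ := (S i hi).cover v
    refine ⟨t, by have := t.2; have := hS.num_le i hi; unfold numSets; omega, ?_⟩
    have hvK : v ∈ K.verts := hv (by
      rw [Set.mem_ofPred_eq, wdist_self]
      exact zero_le)
    simp only [nodeKnowledge, hi, dif_pos]
    rw [knowledge_eq_some _ hK hvK]
    exact Option.some_ne_none _

/-- The clustering `t` of scale `i`. -/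
def clusters (S : DistanceStructures N) (i t : ℕ) (hi : N.IsScale i) :
    Set (Cluster N (scaleD (Fintype.card V) i) (scaleD (Fintype.card V) i / tau (Fintype.card V))) :=
  {K | ∃ ht, K ∈ (S i hi).clustering ⟨t, ht⟩}

theorem cluster_unique {hi : N.IsScale i} {K K' : Cluster N (scaleD (Fintype.card V) i)
    (scaleD (Fintype.card V) i / tau (Fintype.card V))} (hK : K ∈ clusters S i t hi)
    (hK' : K' ∈ clusters S i t hi) {v : V} (hv : v ∈ K.verts) (hv' : v ∈ K'.verts) : K = K' := by
  obtain ⟨ht, hK⟩ := hK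
  obtain ⟨_, hK'⟩ := hK'
  by_contra hne
  exact Set.disjoint_left.1 ((S i hi).disjoint _ hK hK' hne) hv hv'

theorem cluster_eq_some {hi : N.IsScale i} {K : Cluster N (scaleD (Fintype.card V) i)
    (scaleD (Fintype.card V) i / tau (Fintype.card V))} (hK : K ∈ clusters S i t hi)
    {v : V} (hv : v ∈ K.verts) : (nodeKnowledge S v).cluster i t =
      some ⟨N.id K.center, N.id (K.parent v), K.potential v⟩ := by
  obtain ⟨ht, hK⟩ := hK
  simp only [nodeKnowledge, hi, dif_pos]
  exact knowledge_eq_some _ hK hv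

theorem cluster_eq_none {hi : N.IsScale i} {v : V} (h : ∀ K ∈ clusters S i t hi, v ∉ K.verts) :
    (nodeKnowledge S v).cluster i t = none := by
  simp only [nodeKnowledge, hi, dif_pos]
  exact knowledge_eq_none _ fun ht K hK => h K ⟨ht, hK⟩

theorem psi_eq {hi : N.IsScale i} {K : Cluster N (scaleD (Fintype.card V) i)
    (scaleD (Fintype.card V) i / tau (Fintype.card V))} (hK : K ∈ clusters S i t hi)
    {v : V} (hv : v ∈ K.verts) : psi n i t (nodeKnowledge S v) = ⌊K.potential v⌋₊ - rho n i := by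
  rw [psi, cluster_eq_some hK hv]; rfl

theorem psi_eq_zero {hi : N.IsScale i} {v : V} (h : ∀ K ∈ clusters S i t hi, v ∉ K.verts) :
    psi n i t (nodeKnowledge S v) = 0 := by
  rw [psi, cluster_eq_none h]; rfl

theorem layer_zero (e : N.graph.edgeSet) : layer S c n 0 t e ↔ N.len e = 0 := by
  simp [layer, IsLayerEdge, edgeKnowledge]

theorem layer_of_not_isScale (hS : Admissible S c n) (hi : i ≠ 0) (h : ¬ N.IsScale i)
    (e : N.graph.edgeSet) : layer S c n i t e := by
  simp [layer, IsLayerEdge, linkMessage, knowsScale_iff hS, h, hi]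

theorem linkMessage_eq (hS : Admissible S c n) (hi : N.IsScale i) {K : Cluster N
    (scaleD (Fintype.card V) i) (scaleD (Fintype.card V) i / tau (Fintype.card V))}
    (hK : K ∈ clusters S i t hi) {v : V} (hv : v ∈ K.verts) {m : ℕ} :
    linkMessage c n i t (nodeKnowledge S v) = (m : ℤ) + 1 ↔ v ≠ K.center ∧ N.id (K.parent v) = m := by
  rw [linkMessage, if_pos ((knowsScale_iff hS v).2 hi), cluster_eq_some hK hv]
  change (if N.id K.center = N.id v then (0 : ℤ) else (N.id (K.parent v) : ℤ) + 1) = m + 1 ↔ _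
  by_cases h : K.center = v
  · rw [if_pos (congrArg _ h)]
    constructor
    · intro h'; omega
    · rintro ⟨h', -⟩; exact absurd h.symm h'
  · rw [if_neg fun h' => h (N.id_injective h')]
    constructor
    · intro h'; exact ⟨fun h' => h h'.symm, by omega⟩
    · rintro ⟨-, h'⟩; rw [h']

theorem layer_iff (hS : Admissible S c n) (hi : N.IsScale i) (e : N.graph.edgeSet) :
    layer S c n i t e ↔ ∃ K ∈ clusters S i t hi, ∃ d, endp N e d ∈ K.verts ∧
      endp N e d ≠ K.center ∧ K.parent (endp N e d) = endp N e !d := by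
  have hi0 : i ≠ 0 := by have := hi.1; omega
  have key : ∀ v u, linkMessage c n i t (nodeKnowledge S v) = (N.id u : ℤ) + 1 ↔
      ∃ K ∈ clusters S i t hi, v ∈ K.verts ∧ v ≠ K.center ∧ K.parent v = u := by
    intro v u
    by_cases h : ∃ K ∈ clusters S i t hi, v ∈ K.verts
    · obtain ⟨K, hK, hv⟩ := h
      rw [linkMessage_eq hS hi hK hv, N.id_injective.eq_iff]
      constructor
      · exact fun h => ⟨K, hK, hv, h⟩
      · rintro ⟨K', hK', hv', h⟩
        rwa [cluster_unique hK hK' hv hv']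
    · push Not at h
      rw [linkMessage, if_pos ((knowsScale_iff hS v).2 hi), cluster_eq_none h]
      simp only [Option.elim_none]
      constructor
      · intro h'; omega
      · rintro ⟨K, hK, hv, -⟩; exact absurd hv (h K hK)
  have hneg : ∀ v, linkMessage c n i t (nodeKnowledge S v) ≠ -1 := by
    intro v
    rw [linkMessage, if_pos ((knowsScale_iff hS v).2 hi)]
    rcases (nodeKnowledge S v).cluster i t with _ | q
    · simp
    · simp only [Option.elim_some]; split_ifs <;> omega
  rw [layer, IsLayerEdge, if_neg hi0]
  simp only [hneg, false_or]
  simp only [edgeKnowledge, key, Bool.exists_bool, endp, Bool.not_false, Bool.not_true]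
  constructor
  · rintro (⟨K, hK, h⟩ | ⟨K, hK, h⟩)
    · exact ⟨K, hK, Or.inr h⟩
    · exact ⟨K, hK, Or.inl h⟩
  · rintro ⟨K, hK, h | h⟩
    · exact Or.inr ⟨K, hK, h⟩
    · exact Or.inl ⟨K, hK, h⟩

theorem layer_parent (hS : Admissible S c n) {hi : N.IsScale i} {K : Cluster N
    (scaleD (Fintype.card V) i) (scaleD (Fintype.card V) i / tau (Fintype.card V))}
    (hK : K ∈ clusters S i t hi) {v : V} (hv : v ∈ K.verts) (hc : v ≠ K.center) :
    ∃ e d, layer S c n i t e ∧ endp N e d = v ∧ (endp N e !d) = K.parent v := by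
  obtain ⟨e, d, h1, h2, -⟩ := exists_edge_of_adj N (K.parent_adj v hv hc)
  exact ⟨e, d, (layer_iff hS hi e).2 ⟨K, hK, d, h1 ▸ hv, h1 ▸ hc, by rw [h1, h2]⟩, h1, h2⟩

theorem Conn.endp {V : Type} {N : Network V} {H : N.graph.edgeSet → Prop} {e : N.graph.edgeSet}
    (he : H e) (d : Bool) : Conn N H (endp N e d) (endp N e !d) := by
  cases d
  · exact (Conn.edge he).symm
  · exact Conn.edge he

theorem conn_center (hS : Admissible S c n) {hi : N.IsScale i} {K : Cluster N
    (scaleD (Fintype.card V) i) (scaleD (Fintype.card V) i / tau (Fintype.card V))}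
    (hK : K ∈ clusters S i t hi) {v : V} (hv : v ∈ K.verts) :
    Conn N (layer S c n i t) v K.center := by
  obtain ⟨k, hk⟩ := K.parent_reach v hv
  induction k generalizing v with
  | zero => rw [← hk]; exact Conn.refl _
  | succ k ih =>
    by_cases hc : v = K.center
    · rw [hc]; exact Conn.refl _
    · obtain ⟨e, d, he, h1, h2⟩ := layer_parent hS hK hv hc
      have h3 := Conn.endp he d
      rw [h1, h2] at h3
      exact h3.trans (ih (K.parent_mem v hv) hk)

theorem conn_of_mem (hS : Admissible S c n) {hi : N.IsScale i} {K : Cluster N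
    (scaleD (Fintype.card V) i) (scaleD (Fintype.card V) i / tau (Fintype.card V))}
    (hK : K ∈ clusters S i t hi) {u v : V} (hu : u ∈ K.verts) (hv : v ∈ K.verts) :
    Conn N (layer S c n i t) u v := (conn_center hS hK hu).trans (conn_center hS hK hv).symm

theorem iff_of_endp {V : Type} {N : Network V} {e : N.graph.edgeSet} {p : V → Prop} {d : Bool}
    (h : p (endp N e d) ↔ p (endp N e !d)) : p (N.src e) ↔ p (N.tgt e) := by
  cases d
  · exact h.symm
  · exact h

/-- Each layer edge stays inside the cluster whose tree it belongs to, and the clusters of one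
clustering are disjoint. Together with `conn_of_mem`, clusters are exactly the components meeting
them. -/
theorem mem_of_conn (hS : Admissible S c n) {hi : N.IsScale i} {K : Cluster N
    (scaleD (Fintype.card V) i) (scaleD (Fintype.card V) i / tau (Fintype.card V))}
    (hK : K ∈ clusters S i t hi) {u v : V} (hu : u ∈ K.verts) (h : Conn N (layer S c n i t) u v) :
    v ∈ K.verts := by
  refine (Conn.iff_of_edges (p := fun x => x ∈ K.verts) (fun e he => ?_) h).1 hu
  obtain ⟨K', hK', d, h1, h2, h3⟩ := (layer_iff hS hi e).1 he
  have h4 := K'.parent_mem _ h1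
  rw [h3] at h4
  refine iff_of_endp (p := fun x => x ∈ K.verts) (d := d) ⟨fun h => ?_, fun h => ?_⟩
  · rwa [cluster_unique hK hK' h h1]
  · rwa [cluster_unique hK hK' h h4]

/-- The edges of the cluster trees are bridges. -/
theorem layer_bridge (hS : Admissible S c n) (hi : N.IsScale i) {e : N.graph.edgeSet}
    (he : layer S c n i t e) :
    ¬ Conn N (fun e' => layer S c n i t e' ∧ e' ≠ e) (N.src e) (N.tgt e) := by
  obtain ⟨K, hK, d, h1, h2, h3⟩ := (layer_iff hS hi e).1 he
  intro hcon
  -- Being a descendant of the lower end of `e` is preserved by all other edges of the layer, so a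
  -- connection avoiding `e` would make the parent a descendant of its child.
  let p : V → Prop := fun x => x ∈ K.verts ∧ ∃ k, K.parent^[k] x = endp N e d
  have hp : p (endp N e d) ↔ p (endp N e !d) := by
    have := Conn.iff_of_edges (p := p) (fun e' he' => ?_) hcon
    · cases d
      · exact this.symm
      · exact this
    obtain ⟨K', hK', d', h1', h2', h3'⟩ := (layer_iff hS hi e').1 he'.1
    refine iff_of_endp (p := p) (d := d') ?_
    rw [← h3']
    by_cases hKK : K' = K
    · subst hKK
      constructor
      · rintro ⟨-, k, hk⟩
        refine ⟨K'.parent_mem _ h1', ?_⟩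
        cases k with
        | zero =>
          refine absurd (edge_ext_endp hk ?_) he'.2
          rw [← h3, ← h3']
          exact congrArg _ hk
        | succ k => exact ⟨k, hk⟩
      · rintro ⟨-, k, hk⟩
        exact ⟨h1', k + 1, hk⟩
    · constructor
      · rintro ⟨h, -⟩
        exact absurd (cluster_unique hK' hK h1' h) hKK
      · rintro ⟨h, -⟩
        exact absurd (cluster_unique hK' hK (K'.parent_mem _ h1') h) hKK
  rw [← h3] at hp
  obtain ⟨-, k, hk⟩ := hp.1 ⟨h1, 0, rfl⟩
  -- The lower end would then be periodic under `parent`; but its iterates reach the center, which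
  -- is fixed, so it would be the center.
  have hk' : K.parent^[k + 1] (endp N e d) = endp N e d := hk
  obtain ⟨m, hm⟩ := K.parent_reach _ h1
  have hfix : ∀ q, K.parent^[q] K.center = K.center := fun q =>
    Function.iterate_fixed K.parent_center q
  have h5 : K.parent^[(k + 1) * m] (endp N e d) = endp N e d := by
    rw [Function.iterate_mul]
    exact Function.iterate_fixed hk' m
  have h6 : (k + 1) * m = k * m + m := by ring
  rw [h6, Function.iterate_add_apply, hm, hfix] at h5
  exact h2 h5.symm

theorem Admissible.id_lt_two_pow (hS : Admissible S c n) (v : V) : N.id v < 2 ^ idBits c n := by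
  refine (hS.id_lt v).trans_le ?_
  rw [idBits, mul_comm, pow_mul]
  exact Nat.pow_le_pow_left (Nat.lt_pow_succ_log_self (by omega) n).le c

/-- A bound for the lengths of the paths in layer `i`. -/
def layerDiam (n i : ℕ) : ℝ := if i = 0 then 0 else scaleD n i

theorem layerDiam_le {n : ℕ} (hn : 2 ≤ n) (i : ℕ) : layerDiam n i ≤ scaleD n i := by
  unfold layerDiam
  split_ifs
  · linarith [one_le_scaleD hn i]
  · exact le_rfl

end Layer

/-! ## Properties of the layers -/

section WalkLen
variable {V : Type} {N : Network V} {S : N.graph.edgeSet → Prop} {u v : V}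

theorem exists_edge_of_edgeGraph_adj (h : (edgeGraph N S).Adj u v) :
    ∃ e d, S e ∧ endp N e d = u ∧ (endp N e !d) = v := by
  classical
  obtain ⟨e, d, he, h1, h2, -⟩ := exists_stepFlow_eq h
  exact ⟨e, d, he, h1, h2⟩

theorem walkLen_cons {G : SimpleGraph V} {x : V} (len : Sym2 V → ℕ) (h : G.Adj u v) (p : G.Walk v x) :
    walkLen len (SimpleGraph.Walk.cons h p) = len s(u, v) + walkLen len p := by
  simp [walkLen]

theorem walkLen_le_length_mul (p : (edgeGraph N S).Walk u v) {m : ℝ}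
    (hm : ∀ e, S e → (N.len e : ℝ) ≤ m) : (walkLen N.len p : ℝ) ≤ p.length * m := by
  induction p with
  | nil => simp [walkLen]
  | cons h p ih =>
    obtain ⟨e, d, he, h1, h2⟩ := exists_edge_of_edgeGraph_adj h
    have h3 := hm e he
    rw [coe_eq_endp N e d, h1, h2] at h3
    rw [walkLen_cons, SimpleGraph.Walk.length_cons]
    push_cast
    linarith

theorem sub_le_walkLen (p : (edgeGraph N S).Walk u v) {φ : V → ℝ}
    (hφ : ∀ u v, N.graph.Adj u v → |φ u - φ v| ≤ (N.len s(u, v) : ℝ)) :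
    φ v - φ u ≤ walkLen N.len p := by
  induction p with
  | nil => simp [walkLen]
  | cons h p ih =>
    obtain ⟨e, d, he, h1, h2⟩ := exists_edge_of_edgeGraph_adj h
    have h3 := adj_endp N e d
    rw [h1, h2] at h3
    have h4 := (abs_le.1 (hφ _ _ h3)).1
    rw [walkLen_cons]
    push_cast
    linarith

/-- Walk lengths are integers: if all exceeded `D`, the infimum would be at least `⌊D⌋ + 1`, which
is more than `D`. -/
theorem exists_walk_of_wdist_le {G : SimpleGraph V} {len : Sym2 V → ℕ} {D : ℝ} (hD : 0 ≤ D)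
    (h : wdist G len u v ≤ ENNReal.ofReal D) : ∃ p : G.Walk u v, (walkLen len p : ℝ) ≤ D := by
  by_contra! hcon
  have h1 : ((⌊D⌋₊ + 1 : ℕ) : ℝ≥0∞) ≤ wdist G len u v := by
    refine le_iInf fun p => ?_
    have := (Nat.floor_lt hD).2 (hcon p)
    exact_mod_cast this
  have h2 : ENNReal.ofReal D < ((⌊D⌋₊ + 1 : ℕ) : ℝ≥0∞) := by
    rw [ENNReal.ofReal_lt_natCast (Nat.succ_ne_zero _)]
    exact_mod_cast Nat.lt_floor_add_one D
  exact absurd (h1.trans h) (not_le.2 h2)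

theorem conn_of_forall (hS : ∀ e, S e) (u v : V) : Conn N S u v := by
  obtain ⟨p⟩ := N.connected.preconnected u v
  induction p with
  | nil => exact Conn.refl _
  | cons h p ih =>
    obtain ⟨e, d, h1, h2, -⟩ := exists_edge_of_adj N h
    have h3 := Conn.endp (hS e) d
    rw [h1, h2] at h3
    exact h3.trans ih

end WalkLen

/-! ### Short forest paths, and the weights -/

section Layer
variable {V : Type} [Fintype V] {N : Network V} {S : DistanceStructures N} {c n i t : ℕ}

/-- The spanning forest of set `t` of layer `i`. -/
def forest [Fintype N.graph.edgeSet] (S : DistanceStructures N) (c n i t : ℕ) :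
    N.graph.edgeSet → Prop :=
  chosen N (idBits c n) (n ^ c) (layer S c n i t) (numSteps n (idBits c n))

/-- In layer `0` every path has length zero, at a scale the forest contains the cluster trees, and
beyond the scales every path is short. -/
theorem exists_isUnitFlow [Fintype N.graph.edgeSet] (hS : Admissible S c n) (i t : ℕ) (v : V) :
    ∃ g, IsUnitFlow N (layer S c n i t) (forest S c n i t) (layerDiam n i) v g := by
  classical
  suffices h : ∃ p : (edgeGraph N (forest S c n i t)).Walk (root N (layer S c n i t) v) v,
      p.IsPath ∧ (walkLen N.len p : ℝ) ≤ layerDiam n i by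
    obtain ⟨p, hp, hp'⟩ := h
    exact ⟨_, p, hp, hp', rfl⟩
  have hconn : Conn N (forest S c n i t) (root N (layer S c n i t) v) v :=
    (conn_chosen_iff hS.id_lt_two_pow hS.card_eq).2 (conn_root v).symm
  obtain ⟨p⟩ := hconn.reachable
  have hn : (0 : ℝ) < n := by have := hS.two_le; exact_mod_cast (by omega)
  have hlen : ∀ e, forest S c n i t e → layer S c n i t e := chosen_subset _
  by_cases hi0 : i = 0
  · subst hi0
    refine ⟨p.bypass, p.bypass_isPath, ?_⟩
    have := walkLen_le_length_mul p.bypass (m := 0) fun e he => by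
      rw [(layer_zero e).1 (hlen e he), Nat.cast_zero]
    simpa [layerDiam] using this
  by_cases hi : N.IsScale i
  · by_cases hK : ∃ K ∈ clusters S i t hi, v ∈ K.verts
    · obtain ⟨K, hK, hv⟩ := hK
      have hr := mem_of_conn hS hK hv (conn_root (S := layer S c n i t) v)
      obtain ⟨q, hq⟩ := exists_walk_of_wdist_le (by
        rw [hS.card_eq]; linarith [one_le_scaleD hS.two_le i]) (K.tree_diam _ hr _ hv)
      -- Tree edges are bridges of the layer, so the merges choose all of them and the short tree
      -- path survives in the forest.
      have hle : parentGraph K.verts K.center K.parent ≤ edgeGraph N (forest S c n i t) := by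
        have key : ∀ x y, x ∈ K.verts ∧ x ≠ K.center ∧ y = K.parent x →
            (edgeGraph N (forest S c n i t)).Adj x y := by
          rintro x y ⟨hx, hc, rfl⟩
          obtain ⟨e, d, he, h1, h2⟩ := layer_parent hS hK hx hc
          have h3 := edgeGraph_adj (chosen_of_bridge (K := n ^ c) hS.id_lt_two_pow hS.card_eq he
            (layer_bridge hS hi he))
          rw [← h2, ← h1]
          cases d
          · exact h3.symm
          · exact h3
        intro x y hxy
        rw [parentGraph, SimpleGraph.fromRel_adj] at hxy
        rcases hxy.2 with h | h
        · exact key x y h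
        · exact (key y x h).symm
      refine ⟨(q.mapLe hle).bypass, SimpleGraph.Walk.bypass_isPath _, ?_⟩
      have h1 : (walkLen N.len (q.mapLe hle) : ℝ) = walkLen N.len q := by
        rw [walkLen, SimpleGraph.Walk.edges_mapLe_eq_edges, walkLen]
      rw [layerDiam, if_neg hi0]
      have h2 : scaleD (Fintype.card V) i = scaleD n i := by rw [hS.card_eq]
      exact ((le_trans (by exact_mod_cast walkLen_bypass_le N.len (q.mapLe hle)) h1.le).trans
        hq).trans h2.le
    · push Not at hK
      -- An unclustered node meets no edge of the layer and is its own root.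
      have hr : v = root N (layer S c n i t) v := by
        refine (Conn.iff_of_edges (p := fun x => v = x) (fun e he => ?_)
          (conn_root (S := layer S c n i t) v)).1 rfl
        obtain ⟨K, hK', d, h1, -, h3⟩ := (layer_iff hS hi e).1 he
        refine iff_of_endp (p := fun x => v = x) (d := d) ⟨?_, ?_⟩
        · rintro rfl; exact absurd h1 (hK K hK')
        · rintro rfl; exact absurd (h3 ▸ K.parent_mem _ h1) (hK K hK')
      rw [← hr]
      refine ⟨.nil, SimpleGraph.Walk.IsPath.nil, ?_⟩
      rw [layerDiam, if_neg hi0]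
      simpa [walkLen] using (zero_le_one.trans (one_le_scaleD hS.two_le i))
  · refine ⟨p.bypass, p.bypass_isPath, ?_⟩
    -- A longer edge would make `D_i` a scale; a path has fewer than `n` edges.
    have h1 := walkLen_le_length_mul p.bypass (m := scaleD n i / n ^ 2) fun e he => by
      by_contra! hlt
      rw [div_lt_iff₀ (by positivity)] at hlt
      refine hi ⟨by omega, e, e.2, ?_⟩
      rw [hS.card_eq]
      linarith
    have h2 : (p.bypass.length : ℝ) ≤ n := by
      have := p.bypass_isPath.length_lt
      rw [hS.card_eq] at this
      exact_mod_cast this.le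
    have hD : 0 ≤ scaleD n i := zero_le_one.trans (one_le_scaleD hS.two_le i)
    have hn1 : (1 : ℝ) ≤ n := by have := hS.two_le; exact_mod_cast (by omega)
    rw [layerDiam, if_neg hi0]
    calc _ ≤ _ := h1
      _ ≤ n * (scaleD n i / n ^ 2) := by gcongr
      _ = scaleD n i / n := by field_simp
      _ ≤ _ := div_le_self hD hn1

theorem cumPsi_mono (x : NodeKnowledge) : Monotone fun t => cumPsi n i t x := fun _ _ h =>
  min_le_min le_rfl (Finset.sum_le_sum_of_subset (Finset.range_subset_range.2 h))

theorem cumPsi_succ_le (x : NodeKnowledge) : cumPsi n i (t + 1) x ≤ cumPsi n i t x + psi n i t x := by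
  unfold cumPsi
  rw [Finset.sum_range_succ]
  omega

theorem weight_le_psi {x : NodeKnowledge} (h : KnowsScale c n i x) :
    weight c n i t x ≤ psi n i t x := by
  rw [weight, if_pos h]
  have := cumPsi_succ_le (n := n) (i := i) (t := t) x
  omega

theorem weight_le_rho (x : NodeKnowledge) : weight c n i t x ≤ rho n i := by
  unfold weight cumPsi
  split_ifs <;> omega

/-- The weights are increments of a sum capped at `rho n i`, and the cluster that covers the ball of
`v` alone reaches the cap. -/
theorem sum_weight (hS : Admissible S c n) (v : V) :
    ∑ t ∈ Finset.range (numSets c n), weight c n i t (nodeKnowledge S v) = rho n i := by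
  by_cases hi : N.IsScale i
  · simp only [weight, if_pos ((knowsScale_iff hS v).2 hi)]
    rw [Finset.sum_range_tsub (cumPsi_mono _)]
    obtain ⟨t, K, hK, hv⟩ := (S i hi).cover v
    have ht : t.1 < numSets c n := by
      have := t.2; have := hS.num_le i hi; unfold numSets; omega
    have hvK : v ∈ K.verts := hv (by
      rw [Set.mem_ofPred_eq, wdist_self]
      exact zero_le)
    have h1 := K.isPotential.large v (le_iInf₂ fun u hu => by
      by_contra! h
      exact hu (hv h.le))
    have h2 : rho n i ≤ psi n i t (nodeKnowledge S v) := by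
      rw [psi_eq (hi := hi) ⟨t.2, hK⟩ hvK]
      -- Half the covering radius is `D_i / (2 τ) = 4 D_{i-1}`, which leaves at least `rho n i`
      -- after the truncation.
      have h3 : 2 * rho n i ≤ ⌊K.potential v⌋₊ := by
        rw [Nat.le_floor_iff (K.isPotential.nonneg v)]
        refine le_trans ?_ h1
        rw [hS.card_eq]
        have h4 : scaleD n i = scaleD n (i - 1) * (8 * tau n) := by
          obtain ⟨j, rfl⟩ := Nat.exists_eq_succ_of_ne_zero (show i ≠ 0 by have := hi.1; omega)
          exact scaleD_succ n j
        have h5 := one_le_tau hS.two_le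
        have h6 : scaleD n i / tau n = 8 * scaleD n (i - 1) := by rw [h4]; field_simp
        rw [h6]
        have h7 := rho_le hS.two_le i
        have h8 := one_le_scaleD hS.two_le (i - 1)
        push_cast
        linarith
      omega
    have h3 : psi n i t (nodeKnowledge S v) ≤
        ∑ s ∈ Finset.range (numSets c n), psi n i s (nodeKnowledge S v) :=
      Finset.single_le_sum (f := fun s => psi n i s (nodeKnowledge S v)) (fun _ _ => Nat.zero_le _)
        (Finset.mem_range.2 ht)
    simp only [cumPsi, Finset.range_zero, Finset.sum_empty]
    omega
  · simp only [weight, if_neg (mt (knowsScale_iff hS v).1 hi)]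
    have h0 : 0 < numSets c n := Nat.succ_pos _
    -- Set `0` exists even for `c = 0`, owing to the added one in `numSets`.
    rw [Finset.sum_ite_eq', if_pos (Finset.mem_range.2 h0)]

theorem exists_of_psi_ne_zero {hi : N.IsScale i} {v : V} (h : psi n i t (nodeKnowledge S v) ≠ 0) :
    ∃ K ∈ clusters S i t hi, v ∈ K.verts := by
  by_contra! hcon
  exact h (psi_eq_zero hcon)

/-- Nodes of positive weight in the next layer lie there in the same component as their roots. -/
theorem conn_root_of_weight_ne_zero [Fintype N.graph.edgeSet] (hS : Admissible S c n) {t' : ℕ} {v : V}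
    (h : weight c n (i + 1) t' (nodeKnowledge S v) ≠ 0) :
    Conn N (layer S c n (i + 1) t') (root N (layer S c n i t) v) v := by
  by_cases hi : N.IsScale (i + 1)
  · have hpsi : psi n (i + 1) t' (nodeKnowledge S v) ≠ 0 := by
      have := weight_le_psi (t := t') ((knowsScale_iff hS v).2 hi)
      omega
    obtain ⟨K, hK, hv⟩ := exists_of_psi_ne_zero (hi := hi) hpsi
    rw [psi_eq hK hv] at hpsi
    obtain ⟨-, p, -, hp, -⟩ := exists_isUnitFlow hS i t v
    have h1 := sub_le_walkLen p K.isPotential.lipschitz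
    -- The potential at `v` is at least `⌊D_i⌋ + 1`, hence above `D_i`, and a path of length at most
    -- `D_i` cannot bring it down to zero.
    have h2 : ((rho n (i + 1) + 1 : ℕ) : ℝ) ≤ K.potential v :=
      (Nat.le_floor_iff (K.isPotential.nonneg v)).1 (by omega)
    have h3 := lt_rho_add_one n (i + 1)
    have h4 := layerDiam_le hS.two_le i
    rw [Nat.add_sub_cancel] at h3
    push_cast at h2
    refine conn_of_mem hS hK ?_ hv
    by_contra hr
    have h5 := K.isPotential.zero _ hr
    linarith
  · exact conn_of_forall (layer_of_not_isScale hS (Nat.succ_ne_zero i) hi) _ _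

theorem psi_le_of_not_mem {hi : N.IsScale i} {K : Cluster N (scaleD (Fintype.card V) i)
    (scaleD (Fintype.card V) i / tau (Fintype.card V))} (hK : K ∈ clusters S i t hi) {u v : V}
    (h : N.graph.Adj u v) (hu : u ∈ K.verts) (hv : v ∉ K.verts) :
    psi n i t (nodeKnowledge S u) ≤ N.len s(u, v) := by
  rw [psi_eq hK hu]
  have h1 := K.isPotential.lipschitz u v h
  rw [K.isPotential.zero v hv, sub_zero, abs_of_nonneg (K.isPotential.nonneg u)] at h1
  have := Nat.floor_le_floor h1
  rw [Nat.floor_natCast] at this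
  omega

/-- Lengths are integers, so rounding down preserves the Lipschitz bound inside a cluster. At its
border the potential itself is at most the edge length. -/
theorem psi_le_add (hi : N.IsScale i) {u v : V} (h : N.graph.Adj u v) :
    psi n i t (nodeKnowledge S u) ≤ psi n i t (nodeKnowledge S v) + N.len s(u, v) := by
  by_cases hu : ∃ K ∈ clusters S i t hi, u ∈ K.verts
  · obtain ⟨K, hK, hu⟩ := hu
    by_cases hv : v ∈ K.verts
    · rw [psi_eq hK hu, psi_eq hK hv]
      have h1 := (abs_le.1 (K.isPotential.lipschitz u v h)).2
      have h2 : ⌊K.potential u⌋₊ ≤ ⌊K.potential v⌋₊ + N.len s(u, v) := by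
        rw [← Nat.floor_add_natCast (K.isPotential.nonneg v)]
        exact Nat.floor_le_floor (by linarith)
      omega
    · have := psi_le_of_not_mem (n := n) hK h hu hv
      omega
  · push Not at hu
    rw [psi_eq_zero hu]
    exact Nat.zero_le _

theorem cumPsi_le_add (hi : N.IsScale i) {u v : V} (h : N.graph.Adj u v) (t : ℕ) :
    cumPsi n i t (nodeKnowledge S u) ≤ cumPsi n i t (nodeKnowledge S v) + t * N.len s(u, v) := by
  have : ∑ s ∈ Finset.range t, psi n i s (nodeKnowledge S u) ≤
      ∑ s ∈ Finset.range t, psi n i s (nodeKnowledge S v) + t * N.len s(u, v) := by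
    calc _ ≤ ∑ s ∈ Finset.range t, (psi n i s (nodeKnowledge S v) + N.len s(u, v)) :=
          Finset.sum_le_sum fun s _ => psi_le_add hi h
      _ = _ := by rw [Finset.sum_add_distrib, Finset.sum_const, Finset.card_range, smul_eq_mul]
  unfold cumPsi
  omega

/-- A weight is a difference of two cumulative sums, each with at most `numSets c n` terms that
change by at most the edge length. -/
theorem weight_le_add (hS : Admissible S c n) {u v : V} (h : N.graph.Adj u v)
    (ht : t < numSets c n) : weight c n i t (nodeKnowledge S u) ≤
      weight c n i t (nodeKnowledge S v) + 2 * numSets c n * N.len s(u, v) := by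
  by_cases hi : N.IsScale i
  · rw [weight, weight, if_pos ((knowsScale_iff hS u).2 hi), if_pos ((knowsScale_iff hS v).2 hi)]
    have h1 := cumPsi_le_add (S := S) (n := n) hi h (t + 1)
    have h2 := cumPsi_le_add (S := S) (n := n) hi h.symm t
    rw [Sym2.eq_swap] at h2
    have h3 := cumPsi_mono (n := n) (i := i) (nodeKnowledge S v) (Nat.le_succ t)
    have h4 : (t + 1) * N.len s(u, v) + t * N.len s(u, v) ≤ 2 * numSets c n * N.len s(u, v) := by
      rw [← Nat.add_mul]
      exact Nat.mul_le_mul_right _ (by omega)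
    simp only [Nat.succ_eq_add_one] at h3
    omega
  · rw [weight, weight, if_neg (mt (knowsScale_iff hS u).1 hi),
      if_neg (mt (knowsScale_iff hS v).1 hi)]
    exact Nat.le_add_right _ _

/-- At a scale, `v` lies outside any cluster of `u`, where the potential is zero. In layer `0` the
edge has positive integer length and weights are at most `rho n 0 = 1`. Every other layer is
connected. -/
theorem weight_le_of_not_conn (hS : Admissible S c n) {u v : V} (h : N.graph.Adj u v)
    (hc : ¬ Conn N (layer S c n i t) u v) : weight c n i t (nodeKnowledge S u) ≤ N.len s(u, v) := by
  by_cases hi : N.IsScale i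
  · refine (weight_le_psi ((knowsScale_iff hS u).2 hi)).trans ?_
    by_cases hu : ∃ K ∈ clusters S i t hi, u ∈ K.verts
    · obtain ⟨K, hK, hu⟩ := hu
      exact psi_le_of_not_mem hK h hu fun hv => hc (conn_of_mem hS hK hu hv)
    · push Not at hu
      rw [psi_eq_zero hu]
      exact Nat.zero_le _
  · by_cases hi0 : i = 0
    · subst hi0
      refine (weight_le_rho _).trans ?_
      have h1 : rho n 0 = 1 := by simp [rho, scaleD]
      rw [h1]
      by_contra! h0
      obtain ⟨e, d, h1, h2, h3⟩ := exists_edge_of_adj N h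
      have h4 := Conn.endp (H := layer S c n 0 t) (e := e) ((layer_zero e).2 (by rw [h3]; omega)) d
      rw [h1, h2] at h4
      exact hc h4
    · exact absurd (conn_of_forall (layer_of_not_isScale hS hi0 hi) u v) hc

/-- Since `8 τ ≥ 2`, this many factors exceed `n ^ (c + 2)`, which is at least `n²` times any
length. -/
theorem not_isScale_numLayers (hS : Admissible S c n) : ¬ N.IsScale (numLayers c n) := by
  rintro ⟨-, e, he, h⟩
  rw [hS.card_eq] at h
  have h1 : (N.len e : ℝ) ≤ (n : ℝ) ^ c := by exact_mod_cast hS.len_le e he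
  have h2 : (n : ℝ) < 2 ^ (Nat.log 2 n + 1) := by
    exact_mod_cast Nat.lt_pow_succ_log_self (by omega) n
  have h3 : (2 : ℝ) ^ numLayers c n ≤ scaleD n (numLayers c n) :=
    pow_le_pow_left₀ (by norm_num) (by linarith [one_le_tau hS.two_le]) _
  have h4 : (n : ℝ) ^ 2 * (n : ℝ) ^ c < 2 ^ numLayers c n := by
    rw [← pow_add, numLayers, mul_comm (c + 2), pow_mul, add_comm 2 c]
    exact pow_lt_pow_left₀ h2 (by positivity) (by omega)
  have h5 : (n : ℝ) ^ 2 * (N.len e : ℝ) ≤ (n : ℝ) ^ 2 * (n : ℝ) ^ c := by gcongr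
  linarith

end Layer

/-! ## The oblivious routing -/

section Linear
variable {V : Type} {N : Network V} [Fintype N.graph.edgeSet]

theorem netInflow_add (f g : N.graph.edgeSet → ℝ) (u : V) :
    netInflow N (fun e => f e + g e) u = netInflow N f u + netInflow N g u := by
  simp only [netInflow, add_mul, Finset.sum_add_distrib]

theorem netInflow_const_mul (a : ℝ) (f : N.graph.edgeSet → ℝ) (u : V) :
    netInflow N (fun e => a * f e) u = a * netInflow N f u := by
  simp only [netInflow, Finset.mul_sum, mul_assoc]

theorem netInflow_finset_sum {ι : Type} (s : Finset ι) (f : ι → N.graph.edgeSet → ℝ) (u : V) :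
    netInflow N (fun e => ∑ i ∈ s, f i e) u = ∑ i ∈ s, netInflow N (f i) u := by
  simpa using netInflow_sum (R := ℝ) s f (fun _ => 1) u

theorem routes_iff (f : N.graph.edgeSet → ℝ) (b : V → ℝ) :
    N.Routes f b ↔ ∀ v, netInflow N f v = b v := by
  classical
  unfold Network.Routes netInflow
  refine forall_congr' fun v => ?_
  rw [← Finset.sum_sub_distrib]
  have : ∀ e, ((if N.tgt e = v then f e else 0) - if N.src e = v then f e else 0) =
      f e * ((if N.tgt e = v then 1 else 0) - if N.src e = v then 1 else 0) := by
    intro e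
    split_ifs <;> simp
  rw [← Finset.sum_congr rfl fun e _ => this e]

/-- A linear routing that stretches every edge by at most `α` is `α`-competitive. -/
theorem isObliviousRouting_of_stretch [Fintype V] {α : ℝ} {R : Matrix N.graph.edgeSet V ℝ}
    (hR : ∀ b : V → ℝ, ∑ v, b v = 0 → N.Routes (R.mulVec b) b)
    (hα : ∀ e₀, N.cost (fun e => R e (N.tgt e₀) - R e (N.src e₀)) ≤ α * N.len e₀) :
    N.IsObliviousRouting α R := by
  classical
  refine fun b hb => ⟨hR b hb, fun f hf => ?_⟩
  rw [routes_iff] at hf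
  -- As `b` is the net inflow of `f`, the vector `R b` combines the column differences along edges
  -- with coefficients `f`.
  have h1 : ∀ e, R.mulVec b e = ∑ e₀, f e₀ * (R e (N.tgt e₀) - R e (N.src e₀)) := by
    intro e
    simp only [Matrix.mulVec, dotProduct, ← hf, netInflow, Finset.mul_sum]
    rw [Finset.sum_comm]
    refine Finset.sum_congr rfl fun e₀ _ => ?_
    have : ∀ v, R e v * (f e₀ * ((if N.tgt e₀ = v then 1 else 0) - if N.src e₀ = v then 1 else 0)) =
        (if N.tgt e₀ = v then f e₀ * R e v else 0) - if N.src e₀ = v then f e₀ * R e v else 0 := by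
      intro v; split_ifs <;> ring
    simp only [this, Finset.sum_sub_distrib, Finset.sum_ite_eq, Finset.mem_univ, if_true]
    ring
  unfold Network.cost at hα ⊢
  calc ∑ e : N.graph.edgeSet, (N.len e : ℝ) * |R.mulVec b e|
      ≤ ∑ e : N.graph.edgeSet, (N.len e : ℝ) *
          ∑ e₀, |f e₀| * |R e (N.tgt e₀) - R e (N.src e₀)| := by
        refine Finset.sum_le_sum fun e _ => mul_le_mul_of_nonneg_left ?_ (Nat.cast_nonneg _)
        rw [h1]
        exact (Finset.abs_sum_le_sum_abs _ _).trans_eq (Finset.sum_congr rfl fun _ _ => abs_mul _ _)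
    _ = ∑ e₀, |f e₀| * ∑ e : N.graph.edgeSet, (N.len e : ℝ) * |R e (N.tgt e₀) - R e (N.src e₀)| := by
        simp only [Finset.mul_sum]
        rw [Finset.sum_comm]
        exact Finset.sum_congr rfl fun _ _ => Finset.sum_congr rfl fun _ _ => by ring
    _ ≤ ∑ e₀ : N.graph.edgeSet, |f e₀| * (α * N.len e₀) :=
        Finset.sum_le_sum fun e₀ _ => mul_le_mul_of_nonneg_left (hα e₀) (abs_nonneg _)
    _ = _ := by rw [Finset.mul_sum]; exact Finset.sum_congr rfl fun _ _ => by ring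

end Linear

/-- The fraction of the demand of a node that moves from set `t` of layer `i` to set `t'` of the next
layer. -/
def coef (c n i t t' : ℕ) (x : NodeKnowledge) : ℝ :=
  (weight c n i t x : ℝ) * weight c n (i + 1) t' x / (rho n i * rho n (i + 1))

section Coef
variable {V : Type} [Fintype V] {N : Network V} {S : DistanceStructures N} {c n i t : ℕ}

theorem sum_weight_div (hS : Admissible S c n) (i : ℕ) (v : V) :
    ∑ t ∈ Finset.range (numSets c n), (weight c n i t (nodeKnowledge S v) : ℝ) / rho n i = 1 := by
  have := rho_pos hS.two_le i
  rw [← Finset.sum_div, ← Nat.cast_sum, sum_weight hS, div_self (by positivity)]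

theorem coef_nonneg (t' : ℕ) (x : NodeKnowledge) : 0 ≤ coef c n i t t' x := by
  unfold coef; positivity

theorem abs_weight_sub_le (hS : Admissible S c n) (i : ℕ) {t : ℕ} (ht : t < numSets c n) {u v : V}
    (h : N.graph.Adj u v) :
    |(weight c n i t (nodeKnowledge S v) : ℝ) - weight c n i t (nodeKnowledge S u)| ≤
      2 * numSets c n * N.len s(u, v) := by
  have h1 := weight_le_add (i := i) hS h ht
  have h2 := weight_le_add (i := i) hS h.symm ht
  rw [Sym2.eq_swap] at h2
  rw [abs_sub_le_iff]
  constructor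
  · rw [sub_le_iff_le_add']; exact_mod_cast h2
  · rw [sub_le_iff_le_add']; exact_mod_cast h1

/-- A product rule for two weights. The bound keeps the smaller denominator `rho n i`, since it has
to cover the change in both layers. -/
theorem coef_change_le (hS : Admissible S c n) (i : ℕ) {t t' : ℕ} (ht : t < numSets c n)
    (ht' : t' < numSets c n) {u v : V} (h : N.graph.Adj u v) :
    |coef c n i t t' (nodeKnowledge S v) - coef c n i t t' (nodeKnowledge S u)| ≤
      4 * numSets c n * N.len s(u, v) / rho n i := by
  have h1 := abs_weight_sub_le hS i ht h
  have h2 := abs_weight_sub_le hS (i + 1) ht' h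
  have r1 : (0 : ℝ) < rho n i := by exact_mod_cast rho_pos hS.two_le i
  have r2 : (0 : ℝ) < rho n (i + 1) := by exact_mod_cast rho_pos hS.two_le (i + 1)
  have r3 : (rho n i : ℝ) ≤ rho n (i + 1) := by exact_mod_cast rho_mono hS.two_le (Nat.le_succ i)
  have w1 : (weight c n i t (nodeKnowledge S v) : ℝ) ≤ rho n i := by exact_mod_cast weight_le_rho _
  have w2 : (weight c n (i + 1) t' (nodeKnowledge S u) : ℝ) ≤ rho n (i + 1) := by
    exact_mod_cast weight_le_rho _
  have hl : (0 : ℝ) ≤ 2 * numSets c n * N.len s(u, v) := by positivity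
  unfold coef
  rw [← sub_div, abs_div, abs_of_pos (mul_pos r1 r2), div_le_div_iff₀ (mul_pos r1 r2) r1]
  set a := (weight c n i t (nodeKnowledge S v) : ℝ)
  set a' := (weight c n i t (nodeKnowledge S u) : ℝ)
  set b := (weight c n (i + 1) t' (nodeKnowledge S v) : ℝ)
  set b' := (weight c n (i + 1) t' (nodeKnowledge S u) : ℝ)
  set l := (2 * numSets c n * N.len s(u, v) : ℝ) with hl'
  have ha : 0 ≤ a := Nat.cast_nonneg _
  have hb : 0 ≤ b' := Nat.cast_nonneg _
  have key : |a * b - a' * b'| ≤ 2 * l * rho n (i + 1) := by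
    have e : a * b - a' * b' = a * (b - b') + b' * (a - a') := by ring
    rw [e]
    refine (abs_add_le _ _).trans ?_
    rw [abs_mul, abs_mul, abs_of_nonneg ha, abs_of_nonneg hb]
    have e1 : a * |b - b'| ≤ rho n (i + 1) * l :=
      mul_le_mul (w1.trans r3) h2 (abs_nonneg _) r2.le
    have e2 : b' * |a - a'| ≤ rho n (i + 1) * l := mul_le_mul w2 h1 (abs_nonneg _) r2.le
    linarith
  calc _ ≤ 2 * l * rho n (i + 1) * rho n i := mul_le_mul_of_nonneg_right key r1.le
    _ = _ := by rw [hl']; ring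

theorem coef_le_of_not_conn (hS : Admissible S c n) (i : ℕ) {t : ℕ} (t' : ℕ) {u v : V}
    (h : N.graph.Adj u v) (hc : ¬ Conn N (layer S c n i t) u v) :
    coef c n i t t' (nodeKnowledge S u) ≤ N.len s(u, v) / rho n i := by
  have r1 : (0 : ℝ) < rho n i := by exact_mod_cast rho_pos hS.two_le i
  have r2 : (0 : ℝ) < rho n (i + 1) := by exact_mod_cast rho_pos hS.two_le (i + 1)
  have w1 : (weight c n i t (nodeKnowledge S u) : ℝ) ≤ N.len s(u, v) := by
    exact_mod_cast weight_le_of_not_conn hS h hc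
  have w2 : (weight c n (i + 1) t' (nodeKnowledge S u) : ℝ) ≤ rho n (i + 1) := by
    exact_mod_cast weight_le_rho _
  unfold coef
  rw [mul_div_mul_comm]
  calc _ ≤ (N.len s(u, v) : ℝ) / rho n i * 1 := by
        gcongr
        exact div_le_one_of_le₀ w2 r2.le
    _ = _ := mul_one _

end Coef

/-! ### Feasibility and stretch of the routing -/

section Routing
variable {V : Type} [Fintype V] {N : Network V} [Fintype N.graph.edgeSet] {S : DistanceStructures N}
  {c n i t : ℕ}

/-- The unit flow to `v` from its root in set `t` of layer `i`. -/
def unitFlow (S : DistanceStructures N) (c n i t : ℕ) (v : V) : N.graph.edgeSet → ℤ :=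
  Classical.epsilon (IsUnitFlow N (layer S c n i t) (forest S c n i t) (layerDiam n i) v)

theorem isUnitFlow_unitFlow (hS : Admissible S c n) (i t : ℕ) (v : V) :
    IsUnitFlow N (layer S c n i t) (forest S c n i t) (layerDiam n i) v (unitFlow S c n i t v) :=
  Classical.epsilon_spec (exists_isUnitFlow hS i t v)

/-- The part of the routing that moves demand from set `t` of layer `i` to set `t'` of the next
layer. -/
def routingPart (S : DistanceStructures N) (c n i t t' : ℕ) : Matrix N.graph.edgeSet V ℝ := fun e v =>
  coef c n i t t' (nodeKnowledge S v) *
    (unitFlow S c n (i + 1) t' (root N (layer S c n i t) v) e : ℝ)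

/-- The oblivious routing given by distance structures. -/
def routing (S : DistanceStructures N) (c n : ℕ) : Matrix N.graph.edgeSet V ℝ := fun e v =>
  unitFlow S c n 0 0 v e + ∑ i ∈ Finset.range (numLayers c n), ∑ t ∈ Finset.range (numSets c n),
    ∑ t' ∈ Finset.range (numSets c n), routingPart S c n i t t' e v

-- The contributions of consecutive layers telescope, and what remains is a unit from a root shared
-- by all nodes. That root cancels against demands of sum zero.
open scoped Classical in
theorem netInflow_routing (hS : Admissible S c n) :
    ∃ r, ∀ v u, netInflow N (fun e => routing S c n e v) u =
      (if v = u then 1 else 0) - if r = u then 1 else 0 := by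
  obtain ⟨v₀⟩ : Nonempty V := N.connected.nonempty
  refine ⟨root N (layer S c n (numLayers c n) 0) v₀, fun v u => ?_⟩
  have hunit : ∀ i t v, netInflow N (fun e => (unitFlow S c n i t v e : ℝ)) u =
      (if v = u then 1 else 0) - if root N (layer S c n i t) v = u then 1 else 0 := fun i t v => by
    convert netInflow_of_isUnitFlow (R := ℝ) (isUnitFlow_unitFlow hS i t v) u
  -- `A i` is the share at `u` of the unit of `v` spread over its roots in layer `i`.
  let A : ℕ → ℝ := fun i => ∑ t ∈ Finset.range (numSets c n),
    (weight c n i t (nodeKnowledge S v) : ℝ) / rho n i *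
      if root N (layer S c n i t) v = u then 1 else 0
  have hA : ∀ i, ¬ N.IsScale i → A i = if root N (layer S c n i 0) v = u then 1 else 0 := by
    intro i hi
    have h1 : ∀ t, weight c n i t (nodeKnowledge S v) = if t = 0 then rho n i else 0 := fun t => by
      rw [weight, if_neg (mt (knowsScale_iff hS v).1 hi)]
    have h2 := rho_pos hS.two_le i
    have h3 : (0 : ℕ) ∈ Finset.range (numSets c n) := Finset.mem_range.2 (Nat.succ_pos _)
    simp only [A, h1]
    rw [Finset.sum_eq_single_of_mem 0 h3 fun t _ ht => by simp [ht], if_pos rfl,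
      div_self (by positivity), one_mul]
  have hpart : ∀ i, ∑ t ∈ Finset.range (numSets c n), ∑ t' ∈ Finset.range (numSets c n),
      netInflow N (fun e => routingPart S c n i t t' e v) u = A i - A (i + 1) := by
    intro i
    have h1 : ∀ t t', netInflow N (fun e => routingPart S c n i t t' e v) u =
        ((weight c n i t (nodeKnowledge S v) : ℝ) / rho n i *
          if root N (layer S c n i t) v = u then 1 else 0) *
            ((weight c n (i + 1) t' (nodeKnowledge S v) : ℝ) / rho n (i + 1)) -
        ((weight c n i t (nodeKnowledge S v) : ℝ) / rho n i) *
          ((weight c n (i + 1) t' (nodeKnowledge S v) : ℝ) / rho n (i + 1) *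
            if root N (layer S c n (i + 1) t') v = u then 1 else 0) := by
      intro t t'
      unfold routingPart
      rw [netInflow_const_mul, hunit, coef, mul_div_mul_comm]
      -- Without weight nothing moves; with weight, the root of `v` in layer `i` has the same root
      -- in the next set as `v` itself.
      by_cases hw : weight c n (i + 1) t' (nodeKnowledge S v) = 0
      · simp [hw]
      · rw [root_congr (conn_root_of_weight_ne_zero hS hw)]
        ring
    simp only [h1, Finset.sum_sub_distrib, ← Finset.mul_sum, ← Finset.sum_mul]
    rw [sum_weight_div hS, sum_weight_div hS, mul_one, one_mul]
  unfold routing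
  rw [netInflow_add, netInflow_finset_sum]
  simp only [netInflow_finset_sum, hpart]
  rw [Finset.sum_range_sub', hunit, hA 0 (fun h => absurd h.1 (by norm_num)),
    hA _ (not_isScale_numLayers hS)]
  have hI : numLayers c n ≠ 0 := by unfold numLayers; positivity
  rw [root_congr (conn_of_forall (layer_of_not_isScale hS hI (not_isScale_numLayers hS)) v v₀)]
  ring

theorem routes_routing (hS : Admissible S c n) {b : V → ℝ} (hb : ∑ v, b v = 0) :
    N.Routes ((routing S c n).mulVec b) b := by
  classical
  obtain ⟨r, hr⟩ := netInflow_routing hS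
  rw [routes_iff]
  intro u
  have h := netInflow_sum (R := ℝ) Finset.univ (fun v e => routing S c n e v) b u
  refine Eq.trans ?_ (h.trans ?_)
  · rfl
  · simp only [hr, mul_sub, Finset.sum_sub_distrib, mul_ite, mul_one, mul_zero]
    rw [Finset.sum_ite_eq' Finset.univ u, if_pos (Finset.mem_univ _)]
    split_ifs
    · rw [hb, sub_zero]
    · simp

/-- The competitive ratio of the routing. -/
def ratio (c n : ℕ) : ℝ := numLayers c n * (numSets c n) ^ 3 * (8 * (8 * tau n) ^ 2)

/-- At most two scales separate `D_{i+1}` from `D_{i-1}` (only one if `i = 0`, by truncated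
subtraction), and rounding down to `rho n i` loses at most a factor two. -/
theorem scaleD_succ_le (hn : 2 ≤ n) (i : ℕ) : scaleD n (i + 1) ≤ 2 * (8 * tau n) ^ 2 * rho n i := by
  have h1 := one_le_tau hn
  have h2 : scaleD n (i + 1) ≤ (8 * tau n) ^ 2 * scaleD n (i - 1) := by
    unfold scaleD
    rw [← pow_add]
    exact pow_le_pow_right₀ (by linarith) (by omega)
  have h3 := lt_rho_add_one n i
  have h4 : (1 : ℝ) ≤ rho n i := by exact_mod_cast rho_pos hn i
  have h5 : scaleD n (i - 1) ≤ 2 * rho n i := by linarith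
  calc _ ≤ _ := h2
    _ ≤ (8 * tau n) ^ 2 * (2 * rho n i) := by gcongr
    _ = _ := by ring

/-- Connected ends share the root and hence the path, so only the change of the coefficient is paid.
Otherwise two unrelated paths are paid in full, but both coefficients are small. -/
theorem cost_routingPart_le (hS : Admissible S c n) (i : ℕ) {t t' : ℕ} (ht : t < numSets c n)
    (ht' : t' < numSets c n) {u v : V} (h : N.graph.Adj u v) :
    N.cost (fun e => routingPart S c n i t t' e v - routingPart S c n i t t' e u) ≤
      numSets c n * (8 * (8 * tau n) ^ 2) * N.len s(u, v) := by
  have r1 : (0 : ℝ) < rho n i := by exact_mod_cast rho_pos hS.two_le i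
  have hk : (1 : ℝ) ≤ numSets c n := by exact_mod_cast Nat.succ_pos _
  have hD : (0 : ℝ) ≤ scaleD n (i + 1) := zero_le_one.trans (one_le_scaleD hS.two_le _)
  have hcost : ∀ x, ∑ e : N.graph.edgeSet, (N.len e : ℝ) * |(unitFlow S c n (i + 1) t' x e : ℝ)| ≤
      scaleD n (i + 1) := fun x =>
    (cost_le_of_isUnitFlow (isUnitFlow_unitFlow hS (i + 1) t' x)).trans (layerDiam_le hS.two_le _)
  suffices hX : N.cost (fun e => routingPart S c n i t t' e v - routingPart S c n i t t' e u) ≤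
      4 * numSets c n * N.len s(u, v) / rho n i * scaleD n (i + 1) by
    refine hX.trans ?_
    calc _ ≤ 4 * numSets c n * N.len s(u, v) / rho n i * (2 * (8 * tau n) ^ 2 * rho n i) := by
          gcongr
          exact scaleD_succ_le hS.two_le i
      _ = _ := by field_simp; ring
  unfold Network.cost routingPart
  by_cases hc : Conn N (layer S c n i t) u v
  · rw [root_congr hc]
    calc _ = |coef c n i t t' (nodeKnowledge S v) - coef c n i t t' (nodeKnowledge S u)| *
          ∑ e : N.graph.edgeSet, (N.len e : ℝ) *
            |(unitFlow S c n (i + 1) t' (root N (layer S c n i t) v) e : ℝ)| := by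
          rw [Finset.mul_sum]
          refine Finset.sum_congr rfl fun e _ => ?_
          beta_reduce
          rw [← sub_mul, abs_mul]; ring
      _ ≤ _ := mul_le_mul (coef_change_le hS i ht ht' h) (hcost _)
          (Finset.sum_nonneg fun _ _ => by positivity) (by positivity)
  · have h1 := coef_le_of_not_conn (i := i) hS t' h hc
    have h2 := coef_le_of_not_conn (i := i) hS t' h.symm fun h' => hc h'.symm
    rw [Sym2.eq_swap] at h2
    calc _ ≤ ∑ e : N.graph.edgeSet,
          (coef c n i t t' (nodeKnowledge S v) * ((N.len e : ℝ) *
            |(unitFlow S c n (i + 1) t' (root N (layer S c n i t) v) e : ℝ)|) +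
          coef c n i t t' (nodeKnowledge S u) * ((N.len e : ℝ) *
            |(unitFlow S c n (i + 1) t' (root N (layer S c n i t) u) e : ℝ)|)) := by
          refine Finset.sum_le_sum fun e _ => ?_
          refine (mul_le_mul_of_nonneg_left (abs_sub _ _) (Nat.cast_nonneg _)).trans_eq ?_
          rw [abs_mul, abs_mul, abs_of_nonneg (coef_nonneg _ _), abs_of_nonneg (coef_nonneg _ _)]
          ring
      _ ≤ N.len s(u, v) / rho n i * scaleD n (i + 1) + N.len s(u, v) / rho n i * scaleD n (i + 1) := by
          rw [Finset.sum_add_distrib, ← Finset.mul_sum, ← Finset.mul_sum]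
          exact add_le_add
            (mul_le_mul h2 (hcost _) (Finset.sum_nonneg fun _ _ => by positivity) (by positivity))
            (mul_le_mul h1 (hcost _) (Finset.sum_nonneg fun _ _ => by positivity) (by positivity))
      _ = 2 * 1 * N.len s(u, v) / rho n i * scaleD n (i + 1) := by ring
      _ ≤ _ := by gcongr; norm_num

theorem unitFlow_zero_cost (hS : Admissible S c n) (t : ℕ) (v : V) (e : N.graph.edgeSet) :
    (N.len e : ℝ) * |(unitFlow S c n 0 t v e : ℝ)| = 0 := by
  have h1 := cost_le_of_isUnitFlow (isUnitFlow_unitFlow hS 0 t v)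
  rw [layerDiam, if_pos rfl] at h1
  have h2 := Finset.single_le_sum (f := fun e : N.graph.edgeSet =>
    (N.len e : ℝ) * |(unitFlow S c n 0 t v e : ℝ)|) (fun _ _ => by positivity) (Finset.mem_univ e)
  exact le_antisymm (h2.trans h1) (by positivity)

theorem cost_routing_le (hS : Admissible S c n) {u v : V} (h : N.graph.Adj u v) :
    N.cost (fun e => routing S c n e v - routing S c n e u) ≤ ratio c n * N.len s(u, v) := by
  have hsum : ∀ {ι : Type} (s : Finset ι) (g : ι → N.graph.edgeSet → ℝ),
      N.cost (fun e => ∑ i ∈ s, g i e) ≤ ∑ i ∈ s, N.cost (g i) := by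
    intro ι s g
    unfold Network.cost
    rw [Finset.sum_comm]
    refine Finset.sum_le_sum fun e _ => ?_
    rw [← Finset.mul_sum]
    exact mul_le_mul_of_nonneg_left (Finset.abs_sum_le_sum_abs _ _) (Nat.cast_nonneg _)
  calc _ ≤ N.cost (fun e => ∑ i ∈ Finset.range (numLayers c n), ∑ t ∈ Finset.range (numSets c n),
        ∑ t' ∈ Finset.range (numSets c n),
          (routingPart S c n i t t' e v - routingPart S c n i t t' e u)) := by
        unfold Network.cost
        refine Finset.sum_le_sum fun e _ => ?_
        have h1 := unitFlow_zero_cost hS 0 u e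
        have h2 := unitFlow_zero_cost hS 0 v e
        simp only [routing, Finset.sum_sub_distrib]
        set x := ∑ i ∈ Finset.range (numLayers c n), ∑ t ∈ Finset.range (numSets c n),
          ∑ t' ∈ Finset.range (numSets c n), routingPart S c n i t t' e v
        set y := ∑ i ∈ Finset.range (numLayers c n), ∑ t ∈ Finset.range (numSets c n),
          ∑ t' ∈ Finset.range (numSets c n), routingPart S c n i t t' e u
        have h3 : |(unitFlow S c n 0 0 v e : ℝ) + x - (unitFlow S c n 0 0 u e + y)| ≤
            |(unitFlow S c n 0 0 v e : ℝ)| + |(unitFlow S c n 0 0 u e : ℝ)| + |x - y| := by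
          have e1 : (unitFlow S c n 0 0 v e : ℝ) + x - (unitFlow S c n 0 0 u e + y) =
            ((unitFlow S c n 0 0 v e : ℝ) - unitFlow S c n 0 0 u e) + (x - y) := by ring
          rw [e1]
          exact (abs_add_le _ _).trans (add_le_add_left (abs_sub _ _) _)
        refine (mul_le_mul_of_nonneg_left h3 (Nat.cast_nonneg _)).trans ?_
        rw [mul_add, mul_add, h1, h2, zero_add, zero_add]
    _ ≤ ∑ i ∈ Finset.range (numLayers c n), ∑ t ∈ Finset.range (numSets c n),
        ∑ t' ∈ Finset.range (numSets c n),
          N.cost (fun e => routingPart S c n i t t' e v - routingPart S c n i t t' e u) :=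
        (hsum _ _).trans (Finset.sum_le_sum fun i _ => (hsum _ _).trans
          (Finset.sum_le_sum fun t _ => hsum _ _))
    _ ≤ ∑ i ∈ Finset.range (numLayers c n), ∑ t ∈ Finset.range (numSets c n),
        ∑ t' ∈ Finset.range (numSets c n),
          numSets c n * (8 * (8 * tau n) ^ 2) * N.len s(u, v) :=
        Finset.sum_le_sum fun i _ => Finset.sum_le_sum fun t ht => Finset.sum_le_sum fun t' ht' =>
          cost_routingPart_le hS i (Finset.mem_range.1 ht) (Finset.mem_range.1 ht') h
    _ = _ := by
        simp only [Finset.sum_const, Finset.card_range, nsmul_eq_mul, ratio]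
        ring

theorem isObliviousRouting_routing (hS : Admissible S c n) :
    N.IsObliviousRouting (ratio c n) (routing S c n) := by
  refine isObliviousRouting_of_stretch (fun b hb => routes_routing hS hb) fun e₀ => ?_
  have h := cost_routing_le hS (adj_endp N e₀ true)
  rwa [← coe_eq_endp] at h

end Routing

/-! ## Evaluation of the routing and of its transpose -/

/-- The number of rounds of the forest algorithms, up to a constant. -/
def forestRounds (c n : ℕ) : ℕ :=
  numSteps n (idBits c n) * (5 * numSteps n (idBits c n) + 8)

theorem abs_linkMessage_le {V : Type} [Fintype V] {N : Network V} (S : DistanceStructures N)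
    {c n : ℕ} (hid : ∀ v, N.id v < n ^ c) (i t : ℕ) (v : V) :
    |linkMessage c n i t (nodeKnowledge S v)| ≤ n ^ c := by
  have h1 : ∀ v, (N.id v : ℤ) + 1 ≤ (n : ℤ) ^ c := fun v => by exact_mod_cast hid v
  have h0 : (0 : ℤ) ≤ N.id v := by positivity
  have h2 := h1 v
  unfold linkMessage nodeKnowledge DistanceStructure.knowledge
  dsimp only
  split_ifs with _ _ h
  · rw [Option.elim_some]
    split_ifs
    · rw [abs_zero]; linarith
    · rw [abs_of_nonneg (by positivity)]
      exact h1 _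
  · simp only [Option.elim_none, abs_zero]; linarith
  · simp only [Option.elim_none, abs_zero]; linarith
  · rw [abs_neg, abs_one]; linarith

-- Evaluating at roots is adjoint to collecting values at roots. Thus the demands of a component can
-- be summed at its root before being routed in the next layer.
open scoped Classical in
theorem sum_root_mul {R V : Type} [CommRing R] [Fintype V] {N : Network V}
    (H : N.graph.edgeSet → Prop) (φ y : V → R) :
    ∑ v, φ (root N H v) * y v =
      ∑ u, φ u * if N.id u = leader N H u then ∑ v ∈ comp N H u, y v else 0 := by
  rw [← Finset.sum_fiberwise Finset.univ (root N H)]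
  refine Finset.sum_congr rfl fun u _ => ?_
  rw [Finset.sum_congr rfl fun v hv => by rw [(Finset.mem_filter.1 hv).2], ← Finset.mul_sum]
  congr 1
  split_ifs with h
  · refine Finset.sum_congr (Finset.ext fun v => ?_) fun _ _ => rfl
    simp [mem_comp, root_eq_iff, h]
  · refine Finset.sum_eq_zero fun v hv => ?_
    exact absurd (root_eq_iff.1 (Finset.mem_filter.1 hv).2).2 h

theorem Inst.admissible {c n w : ℕ} (I : Inst c n w) (hn : 2 ≤ n) : Admissible I.S c n :=
  ⟨I.card_eq, hn, I.len_le, I.id_lt, I.num_le⟩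

section
variable {c n w B k : ℕ} {X Y : Type} {F : ∀ I : Inst c n w, I.V → X}
  {G : ∀ I : Inst c n w, I.E → Y}

theorem Comp.layer (h : Comp B k F G) (hB : 2 * (n ^ c * n ^ c + n + 1) < 2 ^ B)
    (kn : X → NodeKnowledge) (hkn : ∀ I v, kn (F I v) = nodeKnowledge I.S v)
    (ek : Y → EdgeKnowledge) (hek : ∀ I e, ek (G I e) = edgeKnowledge I.N e) (i t : ℕ) :
    Comp B (k + 1) F (fun I e => (G I e, MinorAgg.layer I.S c n i t e)) := by
  refine (h.edgeLearn (fun x => linkMessage c n i t (kn x)) (fun I v => ?_)).map id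
    (fun y => (y.1, IsLayerEdge i (ek y.1) y.2.1 y.2.2)) (fun _ _ => rfl) (fun I e => ?_)
  · rw [hkn]
    have h1 := abs_linkMessage_le I.S I.id_lt i t v
    have h2 : (2 : ℤ) * (n ^ c * n ^ c + n + 1) < 2 ^ B := by exact_mod_cast hB
    have h3 : (n : ℤ) ^ c ≤ n ^ c * n ^ c := by exact_mod_cast Nat.le_mul_self _
    have h4 : (0 : ℤ) ≤ n := by positivity
    linarith
  · simp only [hkn, hek]; rfl

theorem abs_sum_unitFlow_mul_le (I : Inst c n w) (hn : 2 ≤ n) (i t : ℕ) {x : I.V → ℤ} {M : ℤ}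
    (hx : ∀ v, |x v| ≤ M) (e : I.E) :
    |∑ v, unitFlow I.S c n i t v e * x v| ≤ n ^ 2 * M := by
  have h : ∀ v, |unitFlow I.S c n i t v e * x v| ≤ n * M := fun v => by
    rw [abs_mul]
    have := abs_le_of_isUnitFlow (isUnitFlow_unitFlow (I.admissible hn) i t v) e
    rw [I.card_eq] at this
    exact mul_le_mul this (hx v) (abs_nonneg _) (by positivity)
  rcases isEmpty_or_nonempty I.V with hV | ⟨⟨v⟩⟩
  · exact hV.elim (I.N.src e)
  · have := abs_sum_le_card_mul Finset.univ (I.card_le _) ((abs_nonneg _).trans (h v))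
      fun v _ => h v
    linarith

/-- Routing the values `x` to all nodes from their roots in a layer. -/
theorem Comp.forestFlow (h : Comp B k F G) (hn : 2 ≤ n) (hB : 2 * (n ^ c * n ^ c + n + 1) < 2 ^ B)
    (kn : X → NodeKnowledge) (hkn : ∀ I v, kn (F I v) = nodeKnowledge I.S v)
    (ek : Y → EdgeKnowledge) (hek : ∀ I e, ek (G I e) = edgeKnowledge I.N e) (i t : ℕ)
    (x : X → ℤ) {M : ℤ} (hM : 0 ≤ M) (hMB : 10 * n ^ 2 * (n ^ 2 * M) < 2 ^ B)
    (hx : ∀ I v, |x (F I v)| ≤ M) :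
    Comp B (k + (3 + forestRounds c n)) F
      (fun I e => (G I e, ∑ v, unitFlow I.S c n i t v e * x (F I v))) := by
  have h1 := h.layer hB kn hkn ek hek i t
  have hn2 : (1 : ℤ) ≤ (n : ℤ) ^ 2 := one_le_pow₀ (by exact_mod_cast (by omega))
  have h2 := h1.treeFlow (b := idBits c n) hB (fun x => (kn x).id) (fun I v => by rw [hkn]; rfl)
    (fun y => (ek y.1).srcId * n ^ c + (ek y.1).tgtId + 1) (fun I e => by rw [hek]; rfl)
    (fun y => y.2) x (M := n ^ 2 * M) (by positivity) hMB
    (fun I v => (hx I v).trans (le_mul_of_one_le_left hM hn2)) (numSteps n (idBits c n))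
    (fun I e => ∑ v, unitFlow I.S c n i t v e * x (F I v))
    (fun I e he => Finset.sum_eq_zero fun v _ => by
      obtain ⟨p, -, -, hp⟩ := isUnitFlow_unitFlow (I.admissible hn) i t v
      rw [hp, walkFlow_eq_zero p he, zero_mul])
    (fun I e => abs_sum_unitFlow_mul_le I hn i t (hx I) e)
    (fun I v => by
      convert netInflow_treeFlow (isUnitFlow_unitFlow (I.admissible hn) i t) (fun v => x (F I v)) v)
  exact (h2.map id (fun y => (y.1.1, y.2)) (fun _ _ => rfl) (fun _ _ => rfl)).mono
    (by unfold forestRounds; omega)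

/-- Adding up an edge vector along the paths from the roots in a layer. -/
theorem Comp.forestPot (h : Comp B k F G) (hn : 2 ≤ n) (hB : 2 * (n ^ c * n ^ c + n + 1) < 2 ^ B)
    (kn : X → NodeKnowledge) (hkn : ∀ I v, kn (F I v) = nodeKnowledge I.S v)
    (ek : Y → EdgeKnowledge) (hek : ∀ I e, ek (G I e) = edgeKnowledge I.N e) (i t : ℕ)
    (f : Y → ℤ) {M : ℤ} (hM : 0 ≤ M) (hMB : 8 * 4 ^ numSteps n (idBits c n) * M < 2 ^ B)
    (hf : ∀ I e, |f (G I e)| ≤ M) :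
    Comp B (k + (3 + forestRounds c n))
      (fun I v => (F I v, ∑ e, unitFlow I.S c n i t v e * f (G I e))) G ∧
    ∀ I v, 2 * |∑ e, unitFlow I.S c n i t v e * f (G I e)| < 2 ^ B := by
  have h1 := h.layer hB kn hkn ek hek i t
  have h2 := h1.pot (b := idBits c n) hB (fun x => (kn x).id) (fun I v => by rw [hkn]; rfl)
    (fun y => (ek y.1).srcId * n ^ c + (ek y.1).tgtId + 1) (fun I e => by rw [hek]; rfl)
    (fun y => y.2) (fun y => f y.1) hM hMB hf _ le_rfl
  have hp : (0 : ℤ) ≤ 4 ^ numSteps n (idBits c n) * M := by positivity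
  have h0 : (0 : ℤ) < 2 ^ B := by positivity
  have hpot : ∀ (I : Inst c n w) v, |MinorAgg.pot (idBits c n) (n ^ c) (MinorAgg.layer I.S c n i t)
      (fun e => f (G I e)) (numSteps n (idBits c n)) v| ≤ (4 ^ numSteps n (idBits c n) - 1) * M :=
    fun I v => abs_pot_le I.id_lt hM (hf I) _ v
  have h3 := h2.atRoot hB (fun x => (kn x.1).id) (fun I v => by rw [hkn]; rfl) (fun y => y.2)
    (fun x => x.2) (fun I v => by have := hpot I v; linarith)
  -- The path uses forest edges only, along which `f` is the difference of the potential.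
  have key : ∀ (I : Inst c n w) v, ∑ e, unitFlow I.S c n i t v e * f (G I e) =
      MinorAgg.pot (idBits c n) (n ^ c) (MinorAgg.layer I.S c n i t)
        (fun e => f (G I e)) (numSteps n (idBits c n)) v -
      MinorAgg.pot (idBits c n) (n ^ c) (MinorAgg.layer I.S c n i t)
        (fun e => f (G I e)) (numSteps n (idBits c n)) (root I.N (MinorAgg.layer I.S c n i t) v) := by
    intro I v
    obtain ⟨p, -, -, hp⟩ := isUnitFlow_unitFlow (I.admissible hn) i t v
    rw [hp]
    exact_mod_cast sum_walkFlow_mul p (fun e => f (G I e)) _ fun e he =>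
      (pot_sub (f := fun e => f (G I e)) I.id_lt _ e he).symm
  refine ⟨(h3.map (fun x => (x.1.1, x.1.2 - x.2)) (fun y => y.1) (fun I v => ?_)
    (fun _ _ => rfl)).mono ?_, fun I v => ?_⟩
  · rw [key]
  · have : numSteps n (idBits c n) * (5 * numSteps n (idBits c n) + 7) ≤ forestRounds c n := by
      unfold forestRounds; gcongr; norm_num
    omega
  · rw [key]
    have := (abs_sub _ _).trans (add_le_add (hpot I v) (hpot I (root I.N (MinorAgg.layer I.S c n i t) v)))
    linarith

end

section
variable {c n w B k : ℕ}

/-- Adding one part of the routed flow. -/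
theorem Comp.routingPart {acc : ∀ I : Inst c n w, I.E → ℝ} (hn : 2 ≤ n)
    (hB : 2 * (n ^ c * n ^ c + n + 1) < 2 ^ B) (i t t' : ℕ)
    (hMB : 10 * n ^ 5 * (rho n i * rho n (i + 1)) * 2 ^ w < 2 ^ B)
    (h : Comp B k (fun I => I.nodeIn) (fun I e => (I.edgeIn e, acc I e))) :
    Comp B (k + (6 + forestRounds c n)) (fun I : Inst c n w => I.nodeIn)
      (fun I e => (I.edgeIn e,
        acc I e + ∑ v, MinorAgg.routingPart I.S c n i t t' e v * (I.b v : ℝ))) := by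
  classical
  have hMB' : (10 : ℤ) * n ^ 5 * (rho n i * rho n (i + 1)) * 2 ^ w < 2 ^ B := by exact_mod_cast hMB
  -- Up to `n` scaled demands meet at one root. They stay integers, as the denominators are divided
  -- out only after the communication.
  let M : ℤ := n * (rho n i * rho n (i + 1) * 2 ^ w)
  have hM : 0 ≤ M := by positivity
  let m : NodeKnowledge × ℤ → ℤ := fun x => weight c n i t x.1 * weight c n (i + 1) t' x.1 * x.2
  have hm : ∀ (I : Inst c n w) v, |m (I.nodeIn v)| ≤ rho n i * rho n (i + 1) * 2 ^ w := by
    intro I v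
    have h1 : (weight c n i t (nodeKnowledge I.S v) : ℤ) ≤ rho n i := by
      exact_mod_cast weight_le_rho _
    have h2 : (weight c n (i + 1) t' (nodeKnowledge I.S v) : ℤ) ≤ rho n (i + 1) := by
      exact_mod_cast weight_le_rho _
    change |(weight c n i t (nodeKnowledge I.S v) : ℤ) * weight c n (i + 1) t' (nodeKnowledge I.S v) *
      I.b v| ≤ _
    rw [abs_mul, abs_mul, Nat.abs_cast, Nat.abs_cast]
    have h3 := (I.b_lt v).le
    gcongr
  have hsum : ∀ (I : Inst c n w) S v, |∑ u ∈ comp I.N S v, m (I.nodeIn u)| ≤ M := fun I S v =>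
    abs_sum_le_card_mul _ (I.card_le _) (by positivity) fun u _ => hm I u
  have hMn : M * 10 ≤ 10 * n ^ 5 * (rho n i * rho n (i + 1)) * 2 ^ w := by
    have : (n : ℤ) ≤ n ^ 5 := by exact_mod_cast Nat.le_self_pow (by norm_num) n
    have : (0 : ℤ) ≤ rho n i * rho n (i + 1) * 2 ^ w := by positivity
    change n * (rho n i * rho n (i + 1) * 2 ^ w) * (10 : ℤ) ≤ _
    nlinarith
  have h1 := h.layer hB (fun x => x.1) (fun _ _ => rfl) (fun y => y.1.1) (fun _ _ => rfl) i t
  have h2 := (h1.nodeMax (fun y => y.2) (fun x => x.1.id) (fun I v => by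
    have h1 := I.id_lt v
    have h2 : n ^ c ≤ n ^ c * n ^ c := Nat.le_mul_self _
    change I.N.id v < _
    omega)).nodeSum (fun y => y.2) (fun x => m x.1) (fun I v => by
      have := hsum I (MinorAgg.layer I.S c n i t) v
      linarith)
  have h3 : Comp B (k + 3) (fun I v => (I.nodeIn v,
      if I.N.id v = leader I.N (MinorAgg.layer I.S c n i t) v then
        ∑ u ∈ comp I.N (MinorAgg.layer I.S c n i t) v, m (I.nodeIn u) else 0))
      (fun I e => (I.edgeIn e, acc I e)) :=
    h2.map (fun x => (x.1.1, if x.1.1.1.id = x.1.2 then x.2 else 0)) (fun y => y.1) (fun _ _ => rfl)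
      (fun _ _ => rfl)
  have h4 := h3.forestFlow hn hB (fun x => x.1.1) (fun _ _ => rfl) (fun y => y.1.1)
    (fun _ _ => rfl) (i + 1) t' (fun x => x.2) hM
    (by
      have e : (10 : ℤ) * n ^ 2 * (n ^ 2 * M) = 10 * n ^ 5 * (rho n i * rho n (i + 1)) * 2 ^ w := by
        change (10 : ℤ) * n ^ 2 * (n ^ 2 * (n * (rho n i * rho n (i + 1) * 2 ^ w))) = _
        ring
      rwa [e])
    (fun I v => by
      split_ifs
      · exact hsum I _ v
      · simpa using hM)
  refine (h4.map (fun x => x.1)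
    (fun y => (y.1.1, y.1.2 + (y.2 : ℝ) / (rho n i * rho n (i + 1)))) (fun _ _ => rfl)
    (fun I e => ?_)).mono (by omega)
  rw [← sum_root_mul]
  refine Prod.ext rfl (congrArg₂ _ rfl ?_)
  push_cast
  rw [Finset.sum_div]
  refine Finset.sum_congr rfl fun v _ => ?_
  change coef c n i t t' (nodeKnowledge I.S v) * _ * _ = _ * ((_ : ℤ) : ℝ) / _
  simp only [m, coef, Inst.nodeIn]
  push_cast
  ring

/-- Adding one part of the result of the transposed routing. -/
theorem Comp.routingPart_transpose {acc : ∀ I : Inst c n w, I.V → ℝ} (hn : 2 ≤ n)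
    (hB : 2 * (n ^ c * n ^ c + n + 1) < 2 ^ B) (i t t' : ℕ)
    (hMB : 8 * 4 ^ numSteps n (idBits c n) * 2 ^ w < 2 ^ B)
    (h : Comp B k (fun I v => (I.nodeIn v, acc I v)) (fun I => I.edgeIn)) :
    Comp B (k + (6 + forestRounds c n)) (fun I v => (I.nodeIn v,
        acc I v + ∑ e, MinorAgg.routingPart I.S c n i t t' e v * (I.f e : ℝ)))
      (fun I : Inst c n w => I.edgeIn) := by
  obtain ⟨h1, h2⟩ := h.forestPot hn hB (fun x => x.1.1) (fun _ _ => rfl) (fun y => y.1)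
    (fun _ _ => rfl) (i + 1) t' (fun y => y.2) (M := 2 ^ w) (by positivity)
    (by exact_mod_cast hMB) (fun I e => (I.f_lt e).le)
  -- The order of the layers is reversed: path sums of layer `i + 1` are fetched from the root in
  -- layer `i`, and the real coefficient of `v` is applied locally.
  have h3 := (h1.layer hB (fun x => x.1.1.1) (fun _ _ => rfl) (fun y => y.1) (fun _ _ => rfl) i
    t).atRoot hB (fun x => x.1.1.1.id) (fun _ _ => rfl) (fun y => y.2) (fun x => x.2) h2
  refine (h3.map (fun x => (x.1.1.1, x.1.1.2 + coef c n i t t' x.1.1.1.1 * x.2)) (fun y => y.1)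
    (fun I v => ?_) (fun _ _ => rfl)).mono (by omega)
  refine Prod.ext rfl (congrArg₂ _ rfl ?_)
  push_cast
  rw [Finset.mul_sum]
  exact Finset.sum_congr rfl fun e _ => mul_assoc _ _ _

/-- The number of rounds used to evaluate the routing. -/
def evalRounds (c n : ℕ) : ℕ :=
  3 + forestRounds c n + numLayers c n * (numSets c n * (numSets c n * (6 + forestRounds c n)))

theorem Comp.routing (hn : 2 ≤ n) (hB : 2 * (n ^ c * n ^ c + n + 1) < 2 ^ B)
    (hMB : ∀ i < numLayers c n, 10 * n ^ 5 * (rho n i * rho n (i + 1)) * 2 ^ w < 2 ^ B)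
    (hMB₀ : 10 * n ^ 4 * 2 ^ w < 2 ^ B) :
    Comp B (evalRounds c n) (fun (_ : Inst c n w) _ => ())
      (fun I e => (MinorAgg.routing I.S c n).mulVec (fun v => (I.b v : ℝ)) e) := by
  have h1 := (comp_input (c := c) (n := n) (w := w) B).forestFlow hn hB (fun x => x.1)
    (fun _ _ => rfl) (fun y => y.1) (fun _ _ => rfl) 0 0 (fun x => x.2) (M := 2 ^ w) (by positivity)
    (by
      have e : (10 : ℤ) * n ^ 2 * (n ^ 2 * 2 ^ w) = 10 * n ^ 4 * 2 ^ w := by ring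
      rw [e]
      exact_mod_cast hMB₀) (fun I v => (I.b_lt v).le)
  have h2 := h1.map id (fun y => (y.1, (y.2 : ℝ))) (fun _ _ => rfl) (fun _ _ => rfl)
  have h3 := Comp.edgeLoop (r := numSets c n * (numSets c n * (6 + forestRounds c n)))
    -- The loop rule asks for a step at every `i`, but the messages are known to fit only below
    -- `numLayers c n`.
    (fun i I e => if i < numLayers c n then
      ∑ t ∈ Finset.range (numSets c n), ∑ t' ∈ Finset.range (numSets c n),
        ∑ v, MinorAgg.routingPart I.S c n i t t' e v * (I.b v : ℝ) else 0)
    (fun k acc i h => by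
      by_cases hi : i < numLayers c n
      · simp only [hi, if_true]
        exact Comp.edgeLoop _ (fun k acc t h => Comp.edgeLoop _ (fun k acc t' h =>
          h.routingPart hn hB i t t' (hMB i hi)) _ _ _ h) _ _ _ h
      · simp only [hi, if_false, add_zero]
        exact h.mono (Nat.le_add_right _ _)) (numLayers c n) _ _ h2
  refine (h3.map (fun _ => ()) (fun y => y.2) (fun _ _ => rfl) (fun I e => ?_)).mono
    (by unfold evalRounds; omega)
  simp only [Matrix.mulVec, dotProduct, MinorAgg.routing, add_mul, Finset.sum_add_distrib,
    Finset.sum_mul]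
  refine congrArg₂ _ (by push_cast; rfl) ?_
  rw [Finset.sum_comm]
  refine Finset.sum_congr rfl fun i hi => ?_
  rw [if_pos (Finset.mem_range.1 hi), Finset.sum_comm]
  refine Finset.sum_congr rfl fun t _ => ?_
  rw [Finset.sum_comm]

theorem Comp.routing_transpose (hn : 2 ≤ n) (hB : 2 * (n ^ c * n ^ c + n + 1) < 2 ^ B)
    (hMB : 8 * 4 ^ numSteps n (idBits c n) * 2 ^ w < 2 ^ B) :
    Comp B (evalRounds c n)
      (fun I v => (MinorAgg.routing I.S c n).transpose.mulVec (fun e => (I.f e : ℝ)) v)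
      (fun (_ : Inst c n w) _ => ()) := by
  have h1 := ((comp_input (c := c) (n := n) (w := w) B).forestPot hn hB (fun x => x.1)
    (fun _ _ => rfl) (fun y => y.1) (fun _ _ => rfl) 0 0 (fun y => y.2) (M := 2 ^ w) (by positivity)
    (by exact_mod_cast hMB) (fun I e => (I.f_lt e).le)).1
  have h2 := h1.map (fun x => (x.1, (x.2 : ℝ))) id (fun _ _ => rfl) (fun _ _ => rfl)
  have h3 := Comp.nodeLoop _ (fun k acc i h => Comp.nodeLoop _ (fun k acc t h =>
    Comp.nodeLoop _ (fun k acc t' h => h.routingPart_transpose hn hB i t t' hMB) (numSets c n) _ _ h)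
      (numSets c n) _ _ h) (numLayers c n) _ _ h2
  refine (h3.map (fun x => x.2) (fun _ => ()) (fun I v => ?_) (fun _ _ => rfl)).mono
    (by unfold evalRounds; omega)
  simp only [Matrix.mulVec, dotProduct, Matrix.transpose_apply, MinorAgg.routing, add_mul,
    Finset.sum_add_distrib, Finset.sum_mul]
  refine congrArg₂ _ (by push_cast; rfl) ?_
  rw [Finset.sum_comm]
  refine Finset.sum_congr rfl fun i hi => ?_
  rw [Finset.sum_comm]
  refine Finset.sum_congr rfl fun t _ => ?_
  rw [Finset.sum_comm]

end

/-! ## Polylogarithmic bounds -/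

/-- A function bounded by a polynomial in `log n`. -/
def IsPolylog (q : ℕ → ℕ) : Prop := ∃ C, ∀ n, q n ≤ polylog C n

theorem polylog_mono {C C' : ℕ} (h : C ≤ C') (n : ℕ) : polylog C n ≤ polylog C' n :=
  Nat.mul_le_mul h (Nat.pow_le_pow_right (Nat.succ_pos _) h)

theorem IsPolylog.const (a : ℕ) : IsPolylog fun _ => a :=
  ⟨a, fun _ => Nat.le_mul_of_pos_right _ (by positivity)⟩

theorem IsPolylog.log : IsPolylog fun n => Nat.log 2 n + 1 := ⟨1, fun n => by simp [polylog]⟩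

theorem IsPolylog.add {p q : ℕ → ℕ} (hp : IsPolylog p) (hq : IsPolylog q) :
    IsPolylog fun n => p n + q n := by
  obtain ⟨C, hC⟩ := hp
  obtain ⟨C', hC'⟩ := hq
  refine ⟨C + C', fun n => (add_le_add (hC n) (hC' n)).trans ?_⟩
  unfold polylog
  rw [add_mul]
  gcongr <;> omega

theorem IsPolylog.mul {p q : ℕ → ℕ} (hp : IsPolylog p) (hq : IsPolylog q) :
    IsPolylog fun n => p n * q n := by
  obtain ⟨C, hC⟩ := hp
  obtain ⟨C', hC'⟩ := hq
  -- One constant has to dominate both the factor `C * C'` and the exponent `C + C'`.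
  refine ⟨C * C' + C + C', fun n => (Nat.mul_le_mul (hC n) (hC' n)).trans ?_⟩
  unfold polylog
  rw [mul_mul_mul_comm, ← pow_add]
  gcongr <;> nlinarith

theorem IsPolylog.pow {p : ℕ → ℕ} (hp : IsPolylog p) (k : ℕ) : IsPolylog fun n => p n ^ k := by
  induction k with
  | zero => exact .const 1
  | succ k ih => simpa only [pow_succ] using ih.mul hp

theorem isPolylog_numSets (c : ℕ) : IsPolylog (numSets c) :=
  ((IsPolylog.const c).mul .log).add (.const 1)

theorem isPolylog_idBits (c : ℕ) : IsPolylog (idBits c) := (IsPolylog.const c).mul .log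

theorem isPolylog_numLayers (c : ℕ) : IsPolylog (numLayers c) := (IsPolylog.const (c + 2)).mul .log

theorem isPolylog_numSteps (c : ℕ) : IsPolylog fun n => numSteps n (idBits c n) :=
  IsPolylog.log.mul (((IsPolylog.const 2).mul (isPolylog_idBits c)).add (.const 1))

theorem isPolylog_forestRounds (c : ℕ) : IsPolylog (forestRounds c) :=
  (isPolylog_numSteps c).mul (((IsPolylog.const 5).mul (isPolylog_numSteps c)).add (.const 8))

theorem isPolylog_evalRounds (c : ℕ) : IsPolylog (evalRounds c) :=
  ((IsPolylog.const 3).add (isPolylog_forestRounds c)).add ((isPolylog_numLayers c).mul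
    ((isPolylog_numSets c).mul ((isPolylog_numSets c).mul
      ((IsPolylog.const 6).add (isPolylog_forestRounds c)))))

theorem tau_le {n : ℕ} (hn : 2 ≤ n) : tau n ≤ ((Nat.log 2 n + 1 : ℕ) : ℝ) ^ 7 := by
  have h : (0 : ℝ) ≤ Real.logb 2 n :=
    Real.logb_nonneg (by norm_num) (by exact_mod_cast (by omega))
  refine pow_le_pow_left₀ h ?_ 7
  rw [Real.logb_le_iff_le_rpow (by norm_num) (by positivity), Real.rpow_natCast]
  exact_mod_cast (Nat.lt_pow_succ_log_self (by omega) n).le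

/-- An integer bound for the competitive ratio. -/
def ratioBound (c n : ℕ) : ℕ :=
  numLayers c n * (numSets c n) ^ 3 * (8 * (8 * (Nat.log 2 n + 1) ^ 7) ^ 2)

theorem isPolylog_ratioBound (c : ℕ) : IsPolylog (ratioBound c) :=
  ((isPolylog_numLayers c).mul ((isPolylog_numSets c).pow 3)).mul
    ((IsPolylog.const 8).mul (((IsPolylog.const 8).mul (IsPolylog.log.pow 7)).pow 2))

theorem ratio_le {c n : ℕ} (hn : 2 ≤ n) : ratio c n ≤ ratioBound c n := by
  unfold ratio ratioBound
  have h := tau_le hn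
  have h1 := one_le_tau hn
  push_cast at h ⊢
  gcongr

/-- The number of bits by which messages exceed the input numbers. -/
def extraBits (c n : ℕ) : ℕ :=
  2 * idBits c n + 6 * (Nat.log 2 n + 1) + 4 +
    2 * ((3 + 7 * (Nat.log 2 n + 1)) * numLayers c n) + 2 * numSteps n (idBits c n)

theorem isPolylog_extraBits (c : ℕ) : IsPolylog (extraBits c) :=
  (((((IsPolylog.const 2).mul (isPolylog_idBits c)).add ((IsPolylog.const 6).mul .log)).add
    (.const 4)).add ((IsPolylog.const 2).mul (((IsPolylog.const 3).add
      ((IsPolylog.const 7).mul .log)).mul (isPolylog_numLayers c)))).add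
        ((IsPolylog.const 2).mul (isPolylog_numSteps c))

theorem rho_le_two_pow {c n i : ℕ} (hn : 2 ≤ n) (hi : i ≤ numLayers c n) :
    rho n i ≤ 2 ^ ((3 + 7 * (Nat.log 2 n + 1)) * numLayers c n) := by
  have h1 : 8 * tau n ≤ 2 ^ (3 + 7 * (Nat.log 2 n + 1)) := by
    have h2 : ((Nat.log 2 n + 1 : ℕ) : ℝ) ≤ 2 ^ (Nat.log 2 n + 1) := by
      exact_mod_cast Nat.lt_two_pow_self.le
    calc 8 * tau n ≤ 8 * ((2 : ℝ) ^ (Nat.log 2 n + 1)) ^ 7 := by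
          have := tau_le hn
          gcongr
          exact this.trans (by gcongr)
      _ = _ := by rw [pow_add 2 3, ← pow_mul, mul_comm 7]; norm_num
  have h3 : (rho n i : ℝ) ≤ (2 ^ (3 + 7 * (Nat.log 2 n + 1))) ^ numLayers c n := by
    refine (rho_le hn i).trans ((scaleD_mono hn ((Nat.sub_le _ _).trans hi)).trans ?_)
    exact pow_le_pow_left₀ (by linarith [one_le_tau hn]) h1 _
  rw [← pow_mul] at h3
  exact_mod_cast h3

theorem two_mul_lt_two_pow {c n w : ℕ} (hn : 2 ≤ n) :
    2 * (n ^ c * n ^ c + n + 1) < 2 ^ (w + extraBits c n) := by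
  have h1 : n < 2 ^ (Nat.log 2 n + 1) := Nat.lt_pow_succ_log_self (by omega) n
  have h2 : n ^ c ≤ 2 ^ idBits c n := by
    rw [idBits, mul_comm, pow_mul]
    exact Nat.pow_le_pow_left h1.le c
  have h3 : 1 ≤ 2 ^ idBits c n := Nat.one_le_two_pow
  have h4 : 1 ≤ 2 ^ (Nat.log 2 n + 1) := Nat.one_le_two_pow
  calc 2 * (n ^ c * n ^ c + n + 1)
      ≤ 2 * (2 ^ idBits c n * 2 ^ idBits c n * 2 ^ (Nat.log 2 n + 1) +
        2 ^ idBits c n * 2 ^ idBits c n * 2 ^ (Nat.log 2 n + 1)) := by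
        have h5 : n ^ c * n ^ c ≤ 2 ^ idBits c n * 2 ^ idBits c n := Nat.mul_le_mul h2 h2
        have h6 : 1 ≤ 2 ^ idBits c n * 2 ^ idBits c n := Nat.mul_le_mul h3 h3
        nlinarith
    _ = 2 ^ (2 * idBits c n + (Nat.log 2 n + 1) + 2) := by rw [pow_add, pow_add, two_mul, pow_add]; ring
    _ < 2 ^ (w + extraBits c n) := Nat.pow_lt_pow_right one_lt_two (by unfold extraBits; omega)

theorem mul_rho_lt_two_pow {c n w i : ℕ} (hn : 2 ≤ n) (hi : i < numLayers c n) :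
    10 * n ^ 5 * (rho n i * rho n (i + 1)) * 2 ^ w < 2 ^ (w + extraBits c n) := by
  have h1 : n < 2 ^ (Nat.log 2 n + 1) := Nat.lt_pow_succ_log_self (by omega) n
  have h2 := rho_le_two_pow hn hi.le
  have h3 := rho_le_two_pow hn (Nat.succ_le_of_lt hi)
  set P := (3 + 7 * (Nat.log 2 n + 1)) * numLayers c n with hP
  calc 10 * n ^ 5 * (rho n i * rho n (i + 1)) * 2 ^ w
      ≤ 2 ^ 4 * (2 ^ (Nat.log 2 n + 1)) ^ 5 * (2 ^ P * 2 ^ P) * 2 ^ w := by gcongr; norm_num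
    _ = 2 ^ (w + (4 + (Nat.log 2 n + 1) * 5 + 2 * P)) := by
      rw [← pow_mul, ← pow_add, ← pow_add, ← pow_add, ← pow_add]; congr 1; ring
    _ < _ := Nat.pow_lt_pow_right one_lt_two (by unfold extraBits; omega)

theorem mul_four_pow_lt_two_pow {c n w : ℕ} :
    8 * 4 ^ numSteps n (idBits c n) * 2 ^ w < 2 ^ (w + extraBits c n) := by
  have h : 8 * 4 ^ numSteps n (idBits c n) * 2 ^ w =
      2 ^ (w + (3 + 2 * numSteps n (idBits c n))) := by
    rw [pow_add, pow_add, pow_mul]; norm_num; ring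
  rw [h]
  exact Nat.pow_lt_pow_right one_lt_two (by unfold extraBits; omega)

/-! ## The algorithms -/

/-- An algorithm without communication that outputs zero. -/
def zeroAlgorithm (NI EI : Type) {NO EO : Type} (x : NO) (y : EO) : MinorAggAlgorithm NI EI NO EO where
  bits := 0
  rounds := 0
  NodeState := Unit
  EdgeState := Unit
  nodeInit _ := ()
  edgeInit _ := ()
  contract _ _ := false
  nodeMsg _ _ := (0 : Fin 1)
  consensusOp _ := inferInstanceAs (CommMonoid (Fin 1))
  edgeMsg _ _ x y := (x, y)
  aggregationOp _ := inferInstanceAs (CommMonoid (Fin 1))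
  nodeStep _ _ _ _ := ()
  edgeStep _ _ _ := ()
  nodeOut _ := x
  edgeOut _ := y

/-- An algorithm with its inputs translated. -/
def comapInput {NI EI NI' EI' NO EO : Type} (A : MinorAggAlgorithm NI EI NO EO) (p : NI' → NI)
    (q : EI' → EI) : MinorAggAlgorithm NI' EI' NO EO :=
  { A with nodeInit := A.nodeInit ∘ p, edgeInit := A.edgeInit ∘ q }

theorem comapInput_states {NI EI NI' EI' NO EO V : Type} (A : MinorAggAlgorithm NI EI NO EO)
    (p : NI' → NI) (q : EI' → EI) [Fintype V] (N : Network V) [Fintype N.graph.edgeSet]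
    (x : V → NI') (y : N.graph.edgeSet → EI') (t : ℕ) :
    (comapInput A p q).states N x y t = A.states N (fun v => p (x v)) (fun e => q (y e)) t := by
  induction t with
  | zero => rfl
  | succ t ih => rw [states_succ, states_succ, ih]; rfl

theorem exists_routing_algorithm (c n w : ℕ) :
    ∃ A : MinorAggAlgorithm (NodeKnowledge × ℤ) EdgeKnowledge Unit ℝ,
      A.rounds ≤ evalRounds c n ∧ A.bits ≤ w + extraBits c n ∧
      (2 ≤ n → ∀ I : Inst c n w, ∀ e, A.edgeResult I.N I.nodeIn (edgeKnowledge I.N) e =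
        (routing I.S c n).mulVec (fun v => (I.b v : ℝ)) e) := by
  by_cases hn : 2 ≤ n
  swap
  · exact ⟨zeroAlgorithm _ _ () 0, Nat.zero_le _, Nat.zero_le _, fun h => absurd h hn⟩
  have hMB₀ : 10 * n ^ 4 * 2 ^ w < 2 ^ (w + extraBits c n) := by
    have h0 : 0 < numLayers c n := by unfold numLayers; positivity
    refine lt_of_le_of_lt ?_ (mul_rho_lt_two_pow hn h0)
    have h1 := rho_pos hn 0
    have h2 := rho_pos hn 1
    have h3 : 1 ≤ rho n 0 * rho n (0 + 1) := Nat.mul_le_mul h1 h2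
    have h4 : n ^ 4 ≤ n ^ 5 := Nat.pow_le_pow_right (by omega) (by norm_num)
    calc 10 * n ^ 4 * 2 ^ w = 10 * n ^ 4 * 1 * 2 ^ w := by ring
      _ ≤ _ := by gcongr
  obtain ⟨A, hB, hk, hA⟩ := Comp.routing (c := c) (n := n) (w := w) hn (two_mul_lt_two_pow hn)
    (fun i hi => mul_rho_lt_two_pow hn hi) hMB₀
  refine ⟨comapInput A id fun k => (k, 0), hk, hB.le, fun _ I e => ?_⟩
  -- An instance carries both vectors; the one that is not an input here is zero, which the edges
  -- supply themselves.
  have h := (hA { I with f := fun _ => 0, f_lt := fun _ => by simp }).2 e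
  unfold MinorAggAlgorithm.edgeResult
  rw [comapInput_states]
  exact h

theorem exists_transpose_algorithm (c n w : ℕ) :
    ∃ A : MinorAggAlgorithm NodeKnowledge (EdgeKnowledge × ℤ) ℝ Unit,
      A.rounds ≤ evalRounds c n ∧ A.bits ≤ w + extraBits c n ∧
      (2 ≤ n → ∀ I : Inst c n w, ∀ v, A.nodeResult I.N (nodeKnowledge I.S) I.edgeIn v =
        (routing I.S c n).transpose.mulVec (fun e => (I.f e : ℝ)) v) ∧
      (n < 2 → ∀ (V : Type) [Fintype V] (N : Network V) [Fintype N.graph.edgeSet] x y v,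
        A.nodeResult N x y v = 0) := by
  by_cases hn : 2 ≤ n
  swap
  · exact ⟨zeroAlgorithm _ _ 0 (), Nat.zero_le _, Nat.zero_le _, fun h => absurd h hn,
      fun _ _ _ _ _ _ _ _ => rfl⟩
  obtain ⟨A, hB, hk, hA⟩ := Comp.routing_transpose (c := c) (n := n) (w := w) hn
    (two_mul_lt_two_pow hn) mul_four_pow_lt_two_pow
  refine ⟨comapInput A (fun k => (k, 0)) id, hk, hB.le, fun _ I v => ?_,
    fun h => absurd h (not_lt.2 hn)⟩
  have h := (hA { I with b := fun _ => 0, b_lt := fun _ => by simp }).1 v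
  unfold MinorAggAlgorithm.nodeResult
  rw [comapInput_states]
  exact h

theorem isEmpty_edgeSet {V : Type} [Fintype V] (N : Network V) (h : Fintype.card V < 2) :
    IsEmpty N.graph.edgeSet := by
  have : Subsingleton V := Fintype.card_le_one_iff_subsingleton.1 (by omega)
  exact ⟨fun e => src_ne_tgt N e (Subsingleton.elim _ _)⟩

theorem isObliviousRouting_of_card_lt_two {V : Type} [Fintype V] (N : Network V)
    [Fintype N.graph.edgeSet] (h : Fintype.card V < 2) (α : ℝ) (R : Matrix N.graph.edgeSet V ℝ) :
    N.IsObliviousRouting α R := by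
  have := isEmpty_edgeSet N h
  have : Subsingleton V := Fintype.card_le_one_iff_subsingleton.1 (by omega)
  refine fun b hb => ⟨fun v => ?_, fun f _ => ?_⟩
  · rw [Fintype.sum_subsingleton _ v] at hb
    simp [hb]
  · simp [Network.cost]

end MinorAgg

end

theorem mainTheorem5 (c : ℕ) :
    ∃ C : ℕ,
    ∃ A : ℕ → ℕ → MinorAggAlgorithm (NodeKnowledge × ℤ) EdgeKnowledge Unit ℝ,
    ∃ A' : ℕ → ℕ → MinorAggAlgorithm NodeKnowledge (EdgeKnowledge × ℤ) ℝ Unit,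
      (∀ n w : ℕ,
        (A n w).rounds ≤ polylog C n ∧ (A n w).bits ≤ (w + 1) * polylog C n ∧
        (A' n w).rounds ≤ polylog C n ∧ (A' n w).bits ≤ (w + 1) * polylog C n) ∧
      ∀ (V : Type) [Fintype V] (N : Network V) [Fintype N.graph.edgeSet]
        (S : DistanceStructures N) (n : ℕ),
        Fintype.card V = n →
        (∀ e ∈ N.graph.edgeSet, N.len e ≤ n ^ c) →
        (∀ v, N.id v < n ^ c) →
        (∀ i hi, (S i hi).numClusterings ≤ c * (Nat.log 2 n + 1)) →
        ∃ R : Matrix N.graph.edgeSet V ℝ,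
          N.IsObliviousRouting (polylog C n : ℝ) R ∧
          ∀ w : ℕ,
            (∀ b : V → ℤ, (∀ v, |b v| < 2 ^ w) →
              ∀ e, (A n w).edgeResult N (fun v => (nodeKnowledge S v, b v)) (edgeKnowledge N) e =
                R.mulVec (fun v => (b v : ℝ)) e) ∧
            (∀ f : N.graph.edgeSet → ℤ, (∀ e, |f e| < 2 ^ w) →
              ∀ v, (A' n w).nodeResult N (nodeKnowledge S)
                  (fun e => (edgeKnowledge N e, f e)) v =
                R.transpose.mulVec (fun e => (f e : ℝ)) v) := by
  obtain ⟨C₁, h₁⟩ := MinorAgg.isPolylog_evalRounds c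
  -- The added one makes the polylogarithmic bound at least one, so that multiplying it by `w + 1`
  -- also absorbs the summand `w`.
  obtain ⟨C₂, h₂⟩ := (MinorAgg.isPolylog_extraBits c).add (.const 1)
  obtain ⟨C₃, h₃⟩ := MinorAgg.isPolylog_ratioBound c
  choose A hA using fun n w => MinorAgg.exists_routing_algorithm c n w
  choose A' hA' using fun n w => MinorAgg.exists_transpose_algorithm c n w
  have hr : ∀ n, MinorAgg.evalRounds c n ≤ polylog (C₁ + C₂ + C₃) n := fun n =>
    (h₁ n).trans (MinorAgg.polylog_mono (by omega) n)
  have hb : ∀ n w, w + MinorAgg.extraBits c n ≤ (w + 1) * polylog (C₁ + C₂ + C₃) n := fun n w => by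
    have h := (h₂ n).trans (MinorAgg.polylog_mono (C' := C₁ + C₂ + C₃) (by omega) n)
    nlinarith
  refine ⟨C₁ + C₂ + C₃, A, A', fun n w => ⟨(hA n w).1.trans (hr n), (hA n w).2.1.trans (hb n w),
    (hA' n w).1.trans (hr n), (hA' n w).2.1.trans (hb n w)⟩, ?_⟩
  intro V _ N _ S n hV hlen hid hnum
  by_cases hn : 2 ≤ n
  · refine ⟨MinorAgg.routing S c n, fun b hb => ?_, fun w => ⟨fun b hb => ?_, fun f hf => ?_⟩⟩
    · have h := MinorAgg.isObliviousRouting_routing ⟨hV, hn, hlen, hid, hnum⟩ b hb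
      refine ⟨h.1, fun f hf => (h.2 f hf).trans (mul_le_mul_of_nonneg_right ?_ ?_)⟩
      · refine (MinorAgg.ratio_le hn).trans ?_
        exact_mod_cast (h₃ n).trans (MinorAgg.polylog_mono (by omega) n)
      · exact Finset.sum_nonneg fun e _ => by positivity
    · exact (hA n w).2.2 hn
        ⟨V, N, S, b, fun _ => 0, hV, hlen, hid, hnum, hb, fun _ => by simp⟩
    · exact (hA' n w).2.2.1 hn
        ⟨V, N, S, fun _ => 0, f, hV, hlen, hid, hnum, fun _ => by simp, hf⟩
  -- Without edges the zero matrix is a routing, and its transpose outputs zero at every node, as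
  -- the trivial algorithm does.
  · have hV' : Fintype.card V < 2 := by omega
    have := MinorAgg.isEmpty_edgeSet N hV'
    refine ⟨0, MinorAgg.isObliviousRouting_of_card_lt_two N hV' _ 0, fun w =>
      ⟨fun b _ e => isEmptyElim e, fun f _ v => ?_⟩⟩
    rw [(hA' n w).2.2.2 (by omega)]
    simp
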